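/- For each of the two attention types (softmax attention and average hard attention) there is an $\mathsf L$-uniform family $\{\mathcal T_N\}_{N\in\mathbb N}$ of looped transformers with constant numeric precision $\Theta(1)$, width $\Theta(\log N)$ (and feed-forward hidden width $O(\log N)$), $\Theta(1)$ layers, and one designated block of layers that is applied $\Theta(\log N)$ times, which solves connectivity on (directed or undirected) graphs. That is, for every $N$, every adjacency matrix $A\in\{0,1\}^{N\times N}$ of a directed graph $G$ (undirected graphs being the symmetric matrices) and all vertices $s,t\in\{0,\dots,N-1\}$, on the input string $$A_{0,0}\,A_{0,1}\cdots A_{N-1,N-1}\ \underbrace{\square\cdots\square}_{N^3}\ \&\ \mathrm B(s)\ \&\ \mathrm B(t)$$ over the alphabet $\{0,1,\square,\&\}$, where $\square$ is the padding symbol and $\mathrm B(v)$ is the binary encoding of $v$ with $\lceil\log_2 N\rceil$ digits, $\mathcal T_N$ runs without error and accepts if and only if $G$ has a (possibly empty) path from $s$ to $t$. Here a looped transformer of precision $b$ and width $D$ computes in fixed-point arithmetic over $\mathbb F_b=\{\pm a2^{-b}: 0\le a<2^{2b}\}$: every operation is followed by rounding to the nearest element (ties to the larger absolute value, values out of range to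 the extreme element), sums are rounded after each addition from left to right, and division by zero is an error. Its initial state at position $n$ is $\mathbf e(w_n)+\mathbf p(n,N)$ (symbol embedding plus positional encoding), and each layer maps $H$ to $G+\nu_2(f(G))$ with $G=\nu_1(\mathrm{Attn}(HW_Q,HW_K)\,HW_V)+H$, where attention is single-head (each layer may or may not be causally masked), $f$ is a position-wise two-layer ReLU network, and $\nu_1,\nu_2$ are layer normalizations, with gain, bias and stabilizer $\varepsilon\ge 0$, applied separately to the parts of a partition of the coordinates. The weights of softmax attention are $\exp(x_j/\tau)/\sum_k\exp(x_k/\tau)$ with a temperature $\tau>0$ that may depend on $N$; those of average hard attention are $\mathbf 1[x_j=\max x]/\sum_k\mathbf 1[x_k=\max x]$; both, including the denominators, are computed in the fixed-point arithmetic. The layers are applied in the order: initial layers (at least one), looped block repeated, final layers; a linear threshold at the last position gives the decision. The family is $\mathsf L$-uniform if there are two deterministic Turing machines with a read-only input tape, a write-only output tape and work space logarithmic in the input length: one outputs on input $1^N$ a description of $\mathcal T_N$ (all parameters and the loop count), the other outputs $\mathbf p(n,N)$ on input $(1^N,\mathrm B(n))$ for every position $n$ of the input string of $\mathcal T_N$.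 -/

import Mathlib

open Filter Asymptotics

noncomputable section

namespace LPT

/-! ### Fixed-point arithmetic -/

/-- Signed fixed-point numbers `± a * 2 ^ (-b)` with `a < 2 ^ (2 * b)`; `mant` is `± a`. -/
structure Fx (b : ℕ) where
  mant : ℤ
  bound : mant.natAbs < 2 ^ (2 * b)

namespace Fx

variable {b : ℕ}

/-- The real number that a fixed-point number denotes. -/
def val (x : Fx b) : ℝ := (x.mant : ℝ) / 2 ^ b

/-- Rounding to the nearest fixed-point number: ties go to the larger absolute value, and values out
of range go to the extreme representable number of the same sign. -/
def rnd (b : ℕ) (x : ℝ) : Fx b :=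
  let m : ℕ := min ⌊|x| * 2 ^ b + 1 / 2⌋₊ (2 ^ (2 * b) - 1)
  have hm : m < 2 ^ (2 * b) :=
    lt_of_le_of_lt (min_le_right _ _) (Nat.sub_lt (by positivity) one_pos)
  if x < 0 then ⟨-(m : ℤ), by simpa using hm⟩ else ⟨(m : ℤ), by simpa using hm⟩

instance : Zero (Fx b) := ⟨⟨0, by simp⟩⟩

/-- Every operation is the ideal real operation followed by rounding. -/
def add (x y : Fx b) : Fx b := rnd b (x.val + y.val)
def sub (x y : Fx b) : Fx b := rnd b (x.val - y.val)
def mul (x y : Fx b) : Fx b := rnd b (x.val * y.val)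
/-- Division. It is only ever used where the denominator has been checked to be non-zero. -/
def div (x y : Fx b) : Fx b := rnd b (x.val / y.val)
def exp (x : Fx b) : Fx b := rnd b (Real.exp x.val)
def sqrt (x : Fx b) : Fx b := rnd b (Real.sqrt x.val)
def relu (x : Fx b) : Fx b := rnd b (max x.val 0)

/-- Summation from left to right, with rounding after every addition. -/
def sum (l : List (Fx b)) : Fx b := l.foldl add 0

/-- Fixed-point inner product. -/
def dot {n : ℕ} (x y : Fin n → Fx b) : Fx b := sum (List.ofFn fun i => mul (x i) (y i))

/-- Fixed-point product of a row vector and a matrix. -/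
def vecMul {m n : ℕ} (x : Fin m → Fx b) (W : Matrix (Fin m) (Fin n) (Fx b)) : Fin n → Fx b :=
  fun j => dot x fun i => W i j

end Fx

/-! ### Transformers -/

/-- The two attention variants: softmax attention, and its zero-temperature limit. -/
inductive Attention
  | softmax
  | averageHard

/-- The input symbols `0`, `1`, the padding symbol `□` and the separator `&`. -/
inductive Tok
  | zero
  | one
  | pad
  | sep

/-- Parameters of a layer normalization that is applied individually to the parts of a partition of
the coordinates (coordinates with the same label form a part; constant labels give the ordinary
layer normalization), with gain, bias and the usual stabilizer `eps ≥ 0`. -/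
structure LayerNorm (b D : ℕ) where
  part : Fin D → Fin D
  gain : Fin D → Fx b
  bias : Fin D → Fx b
  eps : Fx b
  eps_nonneg : 0 ≤ eps.mant

/-- Parameters of a layer: single-head self-attention, and a position-wise two-layer ReLU network
with `F` hidden units, each followed by a layer normalization. -/
structure Layer (b D F : ℕ) where
  causal : Bool
  WQ : Matrix (Fin D) (Fin D) (Fx b)
  WK : Matrix (Fin D) (Fin D) (Fx b)
  WV : Matrix (Fin D) (Fin D) (Fx b)
  norm₁ : LayerNorm b D
  W₁ : Matrix (Fin D) (Fin F) (Fx b)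
  c₁ : Fin F → Fx b
  W₂ : Matrix (Fin F) (Fin D) (Fx b)
  c₂ : Fin D → Fx b
  norm₂ : LayerNorm b D

/-- A looped transformer: `b` bits of precision (integer and fractional part each), width `D`,
feed-forward width `F`, temperature `tau`, symbol embedding, positional encoding (`pe n` is the
encoding of the position with zero-based index `n`), the layers before, in and after the looped
block, the loop count, and a linear-threshold output layer. -/
structure LoopedTransformer where
  b : ℕ
  D : ℕ
  F : ℕ
  tau : Fx b
  tau_pos : 0 < tau.mant
  embed : Tok → Fin D → Fx b
  pe : ℕ → Fin D → Fx b
  pre : List (Layer b D F)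
  pre_ne : pre ≠ []
  block : List (Layer b D F)
  post : List (Layer b D F)
  loops : ℕ
  outW : Fin D → Fx b
  outC : Fx b

/-! ### Semantics

A division by zero anywhere is an error; the computation then has the result `none`. -/

section Semantics

variable {b D F n : ℕ}

namespace LayerNorm

/-- The entries of `x` in the part of coordinate `d`. -/
def entries (p : LayerNorm b D) (x : Fin D → Fx b) (d : Fin D) : List (Fx b) :=
  ((List.finRange D).filter fun e => p.part e = p.part d).map x

/-- Mean of a non-empty list. -/
def mean (l : List (Fx b)) : Fx b := Fx.div (Fx.sum l) (Fx.rnd b l.length)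

/-- Mean of the part of coordinate `d`. -/
def mu (p : LayerNorm b D) (x : Fin D → Fx b) (d : Fin D) : Fx b := mean (p.entries x d)

/-- Stabilized standard deviation `√(σ² + ε)` of the part of coordinate `d`. -/
def sigma (p : LayerNorm b D) (x : Fin D → Fx b) (d : Fin D) : Fx b :=
  Fx.sqrt (Fx.add (mean ((p.entries x d).map fun y =>
    Fx.mul (Fx.sub y (p.mu x d)) (Fx.sub y (p.mu x d)))) p.eps)

/-- All divisors are non-zero. -/
def Safe (p : LayerNorm b D) (x : Fin D → Fx b) : Prop :=
  ∀ d, Fx.rnd b (p.entries x d).length ≠ 0 ∧ p.sigma x d ≠ 0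

def eval (p : LayerNorm b D) (x : Fin D → Fx b) : Fin D → Fx b := fun d =>
  Fx.add (Fx.mul (p.gain d) (Fx.div (Fx.sub (x d) (p.mu x d)) (p.sigma x d))) (p.bias d)

end LayerNorm

/-- Unnormalized attention weight of position `j` for the scores `s`, where `vis` tells which
positions are not masked. Masked positions get weight `0`; among the others, softmax gives
`exp (s j / tau)`, and average hard attention gives the indicator of the maximal scores. -/
def rawWeight (κ : Attention) (tau : Fx b) (vis : Fin n → Prop) (s : Fin n → Fx b) (j : Fin n) :
    Fx b :=
  open Classical in
  if vis j then
    match κ with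
    | .softmax => Fx.exp (Fx.div (s j) tau)
    | .averageHard => if ∀ k, vis k → (s k).val ≤ (s j).val then Fx.rnd b 1 else 0
  else 0

/-- The normalizing denominator: the sum of the unnormalized weights (for average hard attention,
the number of maximal scores), computed in fixed-point arithmetic. -/
def denominator (κ : Attention) (tau : Fx b) (vis : Fin n → Prop) (s : Fin n → Fx b) : Fx b :=
  Fx.sum (List.ofFn (rawWeight κ tau vis s))

def weight (κ : Attention) (tau : Fx b) (vis : Fin n → Prop) (s : Fin n → Fx b) (j : Fin n) :
    Fx b :=
  Fx.div (rawWeight κ tau vis s j) (denominator κ tau vis s)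

namespace Layer

/-- Position `i` may attend to position `j`. -/
def vis (L : Layer b D F) (i j : Fin n) : Prop := L.causal = true → j ≤ i

/-- The attention scores of position `i`. -/
def scores (L : Layer b D F) (H : Fin n → Fin D → Fx b) (i j : Fin n) : Fx b :=
  Fx.dot (Fx.vecMul (H i) L.WQ) (Fx.vecMul (H j) L.WK)

/-- Output of self-attention at position `i`, before normalization. -/
def attend (L : Layer b D F) (κ : Attention) (tau : Fx b) (H : Fin n → Fin D → Fx b) (i : Fin n) :
    Fin D → Fx b := fun d =>
  Fx.dot (weight κ tau (L.vis i) (L.scores H i)) fun j => Fx.vecMul (H j) L.WV d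

/-- The residual stream after the attention sub-layer. -/
def mid (L : Layer b D F) (κ : Attention) (tau : Fx b) (H : Fin n → Fin D → Fx b) (i : Fin n) :
    Fin D → Fx b := fun d =>
  Fx.add (L.norm₁.eval (L.attend κ tau H i) d) (H i d)

/-- The position-wise feed-forward network. -/
def ffn (L : Layer b D F) (x : Fin D → Fx b) : Fin D → Fx b := fun d =>
  Fx.add (Fx.vecMul (fun e => Fx.relu (Fx.add (Fx.vecMul x L.W₁ e) (L.c₁ e))) L.W₂ d) (L.c₂ d)

/-- No division by zero happens in the layer. -/
def Safe (L : Layer b D F) (κ : Attention) (tau : Fx b) (H : Fin n → Fin D → Fx b) : Prop :=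
  ∀ i, denominator κ tau (L.vis i) (L.scores H i) ≠ 0 ∧
    L.norm₁.Safe (L.attend κ tau H i) ∧ L.norm₂.Safe (L.ffn (L.mid κ tau H i))

/-- The function that a layer computes. -/
def eval (L : Layer b D F) (κ : Attention) (tau : Fx b) (H : Fin n → Fin D → Fx b) :
    Option (Fin n → Fin D → Fx b) :=
  open Classical in
  if L.Safe κ tau H then
    some fun i d =>
      Fx.add (L.mid κ tau H i d) (L.norm₂.eval (L.ffn (L.mid κ tau H i)) d)
  else none

end Layer

/-- Sequential composition of layers. -/
def evalLayers (κ : Attention) (tau : Fx b) :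
    List (Layer b D F) → (Fin n → Fin D → Fx b) → Option (Fin n → Fin D → Fx b)
  | [], H => some H
  | L :: Ls, H => (L.eval κ tau H).bind (evalLayers κ tau Ls)

end Semantics

namespace LoopedTransformer

/-- Number of layers, each layer of the looped block being counted once. -/
def depth (T : LoopedTransformer) : ℕ := T.pre.length + T.block.length + T.post.length

/-- All layers in the order in which they are applied, the looped block repeated `loops` times. -/
def unrolled (T : LoopedTransformer) : List (Layer T.b T.D T.F) :=
  T.pre ++ (List.replicate T.loops T.block).flatten ++ T.post

/-- The final contextual representations of the symbols of the string `w`. -/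
def represent (T : LoopedTransformer) (κ : Attention) (w : List Tok) :
    Option (Fin w.length → Fin T.D → Fx T.b) :=
  evalLayers κ T.tau T.unrolled fun i d => Fx.add (T.embed (w.get i) d) (T.pe i d)

/-- The output layer. -/
def classify (T : LoopedTransformer) (h : Fin T.D → Fx T.b) : Bool :=
  decide (0 < (Fx.add (Fx.dot T.outW h) T.outC).mant)

/-- The decision on `w`, read off at the final symbol; `none` is an error. -/
def run (T : LoopedTransformer) (κ : Attention) (w : List Tok) : Option Bool :=
  if h : 0 < w.length then
    (T.represent κ w).map fun H => T.classify (H ⟨w.length - 1, Nat.sub_lt h one_pos⟩)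
  else none

end LoopedTransformer

/-! ### Descriptions as bit strings -/

/-- The `w` low-order binary digits of `n`, most significant digit first. -/
def bits (w n : ℕ) : List Bool := (List.range w).reverse.map n.testBit

/-- Self-delimiting unary code. -/
def unary (k : ℕ) : List Bool := List.replicate k true ++ [false]

/-- Sign bit and `2 * b` digits. -/
def Fx.code {b : ℕ} (x : Fx b) : List Bool := decide (x.mant < 0) :: bits (2 * b) x.mant.natAbs

def vecCode {b n : ℕ} (x : Fin n → Fx b) : List Bool := (List.finRange n).flatMap fun i => (x i).code

/-- Row after row. -/
def matCode {b m n : ℕ} (W : Matrix (Fin m) (Fin n) (Fx b)) : List Bool :=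
  (List.finRange m).flatMap fun i => vecCode (W i)

def LayerNorm.code {b D : ℕ} (p : LayerNorm b D) : List Bool :=
  ((List.finRange D).flatMap fun d => unary (p.part d)) ++
    vecCode p.gain ++ vecCode p.bias ++ p.eps.code

def Layer.code {b D F : ℕ} (L : Layer b D F) : List Bool :=
  L.causal :: (matCode L.WQ ++ matCode L.WK ++ matCode L.WV ++ L.norm₁.code ++
    matCode L.W₁ ++ vecCode L.c₁ ++ matCode L.W₂ ++ vecCode L.c₂ ++ L.norm₂.code)

/-- The description of a looped transformer, without its positional encoding. -/
def LoopedTransformer.code (T : LoopedTransformer) : List Bool :=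
  unary T.b ++ unary T.D ++ unary T.F ++
    unary T.pre.length ++ unary T.block.length ++ unary T.post.length ++ unary T.loops ++
    T.tau.code ++
    vecCode (T.embed .zero) ++ vecCode (T.embed .one) ++
    vecCode (T.embed .pad) ++ vecCode (T.embed .sep) ++
    (T.pre ++ T.block ++ T.post).flatMap Layer.code ++
    vecCode T.outW ++ T.outC.code

/-! ### Logspace Turing machines -/

/-- Head moves. -/
inductive Move
  | left
  | stay
  | right

/-- What the input head sees: an input symbol or one of the two end markers. -/
inductive InSym (α : Type)
  | leftEnd
  | sym (a : α)
  | rightEnd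

/-- What a machine does in a step: new state, move of the input head, symbol written and head move
on each work tape, and possibly an output symbol. -/
structure Action (α State Γ : Type) (k : ℕ) where
  next : State
  inMove : Move
  write : Fin k → Γ
  move : Fin k → Move
  emit : Option α

/-- Deterministic Turing machines with a two-way read-only input tape, `k` two-way infinite work
tapes and a one-way write-only output tape. The input symbols are bits and a separator `none`, the
output symbols are bits. The machine halts when `δ` gives `none`. -/
structure Machine where
  State : Type
  finite_state : Finite State
  Γ : Type
  finite_Γ : Finite Γ
  blank : Γ
  k : ℕ
  start : State
  δ : State → InSym (Option Bool) → (Fin k → Γ) → Option (Action Bool State Γ k)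

namespace Machine

/-- Configurations. The input head is at a position in `{0, …, |x| + 1}`, where `0` and `|x| + 1`
hold the end markers. -/
structure Cfg (M : Machine) where
  state : M.State
  inHead : ℕ
  tape : Fin M.k → ℤ → M.Γ
  head : Fin M.k → ℤ
  out : List Bool

def init (M : Machine) : M.Cfg where
  state := M.start
  inHead := 0
  tape := fun _ _ => M.blank
  head := fun _ => 0
  out := []

def readIn (x : List (Option Bool)) : ℕ → InSym (Option Bool)
  | 0 => .leftEnd
  | i + 1 => match x[i]? with
    | some a => .sym a
    | none => .rightEnd

def moveIn (x : List (Option Bool)) (i : ℕ) : Move → ℕ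
  | .left => i - 1
  | .stay => i
  | .right => min (i + 1) (x.length + 1)

def moveHead (i : ℤ) : Move → ℤ
  | .left => i - 1
  | .stay => i
  | .right => i + 1

/-- One step on the input `x`; `none` if the machine halts. -/
def step (M : Machine) (x : List (Option Bool)) (c : M.Cfg) : Option M.Cfg :=
  (M.δ c.state (readIn x c.inHead) fun j => c.tape j (c.head j)).map fun a =>
    { state := a.next
      inHead := moveIn x c.inHead a.inMove
      tape := fun j => Function.update (c.tape j) (c.head j) (a.write j)
      head := fun j => moveHead (c.head j) (a.move j)
      out := c.out ++ a.emit.toList }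

/-- `M` reaches the configuration `c` on the input `x`. -/
def Reaches (M : Machine) (x : List (Option Bool)) (c : M.Cfg) : Prop :=
  Relation.ReflTransGen (fun c₁ c₂ => M.step x c₁ = some c₂) M.init c

/-- On the input `x`, `M` halts with output `y`, and its work heads never leave the cells
`-S, …, S`. -/
def ComputesInSpace (M : Machine) (x : List (Option Bool)) (y : List Bool) (S : ℕ) : Prop :=
  (∃ c, M.Reaches x c ∧ M.step x c = none ∧ c.out = y) ∧
    ∀ c, M.Reaches x c → ∀ j, |c.head j| ≤ (S : ℤ)

end Machine

/-- A single machine, working in logarithmic space, outputs `y i` on the input `x i` for every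
`i`. -/
def LogspaceComputable {ι : Type} (x : ι → List (Option Bool)) (y : ι → List Bool) : Prop :=
  ∃ (M : Machine) (C : ℕ), ∀ i, M.ComputesInSpace (x i) (y i) (C * (Nat.log 2 (x i).length + 1))

/-- The string `1^N`. -/
def ones (N : ℕ) : List (Option Bool) := List.replicate N (some true)

/-- `L`-uniformity of a family in which `T N` is run on strings of length `len N`: one logspace
machine maps `1^N` to the description of `T N`, and one maps `1^N` and a position `n < len N` in
binary to the positional encoding of that position. -/
def LUniform (T : ℕ → LoopedTransformer) (len : ℕ → ℕ) : Prop :=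
  LogspaceComputable (fun N : ℕ => ones N) (fun N => (T N).code) ∧
  LogspaceComputable
    (fun q : (Σ N : ℕ, Fin (len N)) =>
      ones q.1 ++ none :: (bits (Nat.clog 2 (len q.1)) q.2).map some)
    (fun q => vecCode ((T q.1).pe q.2))

/-- Constant precision, logarithmic width (also inside the feed-forward networks), a constant number
of layers, and a logarithmic loop count. -/
structure ConstPrecLogWidthLogLooped (T : ℕ → LoopedTransformer) : Prop where
  precision : (fun N => ((T N).b : ℝ)) =Θ[atTop] fun _ => (1 : ℝ)
  width : (fun N => ((T N).D : ℝ)) =Θ[atTop] fun N : ℕ => Real.log N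
  hidden : (fun N => ((T N).F : ℝ)) =O[atTop] fun N : ℕ => Real.log N
  depth : (fun N => ((T N).depth : ℝ)) =Θ[atTop] fun _ => (1 : ℝ)
  loops : (fun N => ((T N).loops : ℝ)) =Θ[atTop] fun N : ℕ => Real.log N

/-! ### Graph connectivity -/

/-- Bits as input symbols. -/
def Tok.ofBool : Bool → Tok
  | false => .zero
  | true => .one

/-- The input string `A₁₁ … A_NN □ … □ & s & t`: the adjacency matrix row after row, `N ^ 3` padding
symbols, and the (zero-based) vertices `s`, `t` in binary with `⌈log₂ N⌉` digits each. -/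
def connInput {N : ℕ} (A : Matrix (Fin N) (Fin N) Bool) (s t : Fin N) : List Tok :=
  ((List.finRange N).flatMap fun i => (List.finRange N).map fun j => Tok.ofBool (A i j)) ++
    List.replicate (N ^ 3) Tok.pad ++
    Tok.sep :: (bits (Nat.clog 2 N) s).map Tok.ofBool ++
    Tok.sep :: (bits (Nat.clog 2 N) t).map Tok.ofBool

/-- The length of the input strings for graphs with `N` vertices. -/
def connLen (N : ℕ) : ℕ := N ^ 2 + N ^ 3 + 2 * (Nat.clog 2 N + 1)

theorem length_connInput {N : ℕ} (A : Matrix (Fin N) (Fin N) Bool) (s t : Fin N) :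
    (connInput A s t).length = connLen N := by
  simp [connInput, connLen, bits, List.length_flatMap]
  ring

/-- There is a (directed, possibly empty) path from `s` to `t`. -/
def HasPath {N : ℕ} (A : Matrix (Fin N) (Fin N) Bool) (s t : Fin N) : Prop :=
  Relation.ReflTransGen (fun i j => A i j = true) s t

end LPT

end

/-! Reachability is decided by repeated squaring. Let R_d(i, j) mean that some path with at most d
edges leads from i to j. Then R_1 is the edge relation together with the identity, R_{2d}(i, j)
holds iff R_d(i, k) and R_d(k, j) hold for some k (`reachIn_add`), and R_d is full reachability once
d ≥ N (`reachIn_card`), so ⌈log₂ N⌉ squarings suffice. The N³ padding symbols provide one position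
for each triple (i, j, k), and this position maintains R_d(i, j). One pass through the looped block
fetches R_d(i, k), fetches R_d(k, j) and forms the conjunction, and takes the disjunction over k
(`Found.computes_block`). The initial layers fetch the edges from the adjacency positions and
broadcast the digits of s and t (`computes_pre`); the final layer looks up the pair (s, t) at every
position.

One bit of precision is enough because an activation only has to be zero or positive; its size
carries no information. The numbers are the multiples of 1/2 in [-3/2, 3/2]. Ties are rounded away
from zero, so non-zero products stay non-zero, and a saturating sum of terms of one sign is the
exact sum clipped once. A vertex is an address of about log N bits, spread over equal slices of the
residual stream, each of which holds one bit and its complement. Comparing bits with complements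
yields the score 0 if two addresses agree and a score of at most -1 otherwise (`scores_spec`). At
temperature 1/2 the exponentials of these scores round to 1 and 0, so softmax and average hard
attention have the same weights as soon as some position matches (`rawWeight_spec`). The denominator
saturates at 3/2, but quotients stay positive, and attention becomes a disjunction over the matching
positions (`attend_spec`). Layer normalization is made harmless by pairing every channel with its
negative: on such pairs it is the identity (`pairNorm_spec`). The ReLU networks compute conjunctions
and negations (`hidden_spec`). `layer_spec` summarizes a layer by a purely Boolean semantics, and
what remains is combinatorics of positions and paths.

Uniformity is proved by programming. Structured programs are executed by Turing machines
(`TProg.Maps.computesInSpace`), and programs with counters are compiled to them by keeping the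
counters in binary on the work tapes (`Exec.maps`); polynomially bounded counters need logarithmic
space. The functions computable in this way are closed under primitive recursion with polynomially
bounded values (`Cmp.prec`), which gives arithmetic, and output can be produced in bounded loops
(`Emits.range`). All weights repeat one fixed table in every slice, and the positional encoding
needs only quotients, remainders and binary digits. -/

noncomputable section

namespace LPT

/-! ### Structured programs for Turing machines with `k` binary work tapes -/

/-- Tape symbols: a bit or blank. -/
abbrev Cell := Option Bool

/-- Configurations without the control state. -/
structure Mem (k : ℕ) where
  inHead : ℕ
  tape : Fin k → ℤ → Cell
  head : Fin k → ℤ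
  out : List Bool

/-- What a machine sees. -/
structure View (k : ℕ) where
  inp : InSym (Option Bool)
  cells : Fin k → Cell

/-- Elementary instructions. Work tapes are addressed by natural numbers. -/
inductive Instr
  | nop
  | write (r : ℕ) (f : Cell → Cell) (mv : Move)
  | emit (b : Bool)
  | next

/-- Structured programs. -/
inductive TProg (k : ℕ)
  | instr (a : Instr)
  | seq (p q : TProg k)
  | loop (c : View k → Bool) (p : TProg k)
  | cond (c : View k → Bool) (p : TProg k)

variable {k : ℕ}

def Instr.action {σ : Type} (a : Instr) (v : View k) (s : σ) :
    Action Bool σ Cell k where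
  next := s
  inMove := match a with
    | .next => .right
    | _ => .stay
  write := fun j => match a with
    | .write r f _ => if j.val = r then f (v.cells j) else v.cells j
    | _ => v.cells j
  move := fun j => match a with
    | .write r _ mv => if j.val = r then mv else .stay
    | _ => .stay
  emit := match a with
    | .emit b => some b
    | _ => none

/-- The effect of an action on a memory. -/
def Mem.act {σ : Type} (x : List (Option Bool)) (m : Mem k) (a : Action Bool σ Cell k) : Mem k where
  inHead := Machine.moveIn x m.inHead a.inMove
  tape := fun j => Function.update (m.tape j) (m.head j) (a.write j)
  head := fun j => Machine.moveHead (m.head j) (a.move j)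
  out := m.out ++ a.emit.toList

def Mem.view (x : List (Option Bool)) (m : Mem k) : View k where
  inp := Machine.readIn x m.inHead
  cells := fun j => m.tape j (m.head j)

def Instr.apply (x : List (Option Bool)) (a : Instr) (m : Mem k) : Mem k :=
  m.act x (a.action (m.view x) ())

namespace TProg

/-- Control states of a program. -/
def Pos : TProg k → Type
  | instr _ => Unit
  | seq p q => Pos p ⊕ Pos q
  | loop _ p => Option (Pos p)
  | cond _ p => Option (Pos p)

theorem finite_pos : (p : TProg k) → Finite p.Pos
  | instr _ => inferInstanceAs (Finite Unit)
  | seq p q => by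
      have := finite_pos p
      have := finite_pos q
      exact inferInstanceAs (Finite (Pos p ⊕ Pos q))
  | loop _ p => by
      have := finite_pos p
      exact inferInstanceAs (Finite (Option (Pos p)))
  | cond _ p => by
      have := finite_pos p
      exact inferInstanceAs (Finite (Option (Pos p)))

def entry : (p : TProg k) → p.Pos
  | instr _ => ()
  | seq p _ => Sum.inl (entry p)
  | loop _ _ => none
  | cond _ _ => none

/-- The instruction executed in a control state, and the next control state. -/
def trans : (p : TProg k) → p.Pos → View k → Option p.Pos × Instr
  | instr a, _, _ => (none, a)
  | seq p q, .inl s, v => (some (match (trans p s v).1 with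
      | some s' => Sum.inl s'
      | none => Sum.inr (entry q)), (trans p s v).2)
  | seq _ q, .inr s, v => ((trans q s v).1.map Sum.inr, (trans q s v).2)
  | loop c p, none, v => (if c v then some (some (entry p)) else none, .nop)
  | loop _ p, some s, v => (some (trans p s v).1, (trans p s v).2)
  | cond c p, none, v => (if c v then some (some (entry p)) else none, .nop)
  | cond _ p, some s, v => ((trans p s v).1.map some, (trans p s v).2)

/-- All work heads are in the cells `-S, …, S`. -/
def _root_.LPT.Mem.Within (S : ℕ) (m : Mem k) : Prop := ∀ j, |m.head j| ≤ (S : ℤ)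

/-- From the control state `s` and the memory `m`, the program halts with memory `m'`, and uses
space `S`. -/
inductive Run (x : List (Option Bool)) (S : ℕ) (p : TProg k) : p.Pos → Mem k → Mem k → Prop
  | halt {s m} (hm : m.Within S) (h : (p.trans s (m.view x)).1 = none)
      (hm' : ((p.trans s (m.view x)).2.apply x m).Within S) :
      Run x S p s m ((p.trans s (m.view x)).2.apply x m)
  | step {s s' m m'} (hm : m.Within S) (h : (p.trans s (m.view x)).1 = some s')
      (hr : Run x S p s' ((p.trans s (m.view x)).2.apply x m) m') : Run x S p s m m'

/-- The program maps the memory `m` to `m'` in space `S`. -/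
def Maps (x : List (Option Bool)) (S : ℕ) (p : TProg k) (m m' : Mem k) : Prop :=
  Run x S p p.entry m m'

variable {x : List (Option Bool)} {S : ℕ}

theorem Run.within {p : TProg k} {s m m'} (h : Run x S p s m m') : m.Within S := by
  cases h <;> assumption

theorem Run.within' {p : TProg k} {s m m'} (h : Run x S p s m m') : m'.Within S := by
  induction h <;> assumption

theorem maps_instr {a : Instr} {m : Mem k} (hm : m.Within S) (hm' : (a.apply x m).Within S) :
    Maps x S (instr a) m (a.apply x m) :=
  Run.halt (p := instr a) (s := ()) hm rfl hm'

theorem run_seq_right {p q : TProg k} {s m m'} (h : Run x S q s m m') :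
    Run x S (seq p q) (Sum.inr s) m m' := by
  induction h with
  | @halt s m hm h hm' =>
    exact Run.halt (p := seq p q) (s := Sum.inr s) hm (by simp [trans, h]; rfl) hm'
  | @step s s' m m' hm h _ ih =>
    exact Run.step (p := seq p q) (s := Sum.inr s) (s' := Sum.inr s') hm (by simp [trans, h]; rfl) ih

theorem run_seq_left {p q : TProg k} {s m m₁ m'} (h : Run x S p s m m₁) (hq : Maps x S q m₁ m') :
    Run x S (seq p q) (Sum.inl s) m m' := by
  induction h with
  | @halt s m hm h hm' =>
    exact Run.step (p := seq p q) (s := Sum.inl s) (s' := Sum.inr q.entry) hm (by simp [trans, h])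
      (run_seq_right hq)
  | @step s s' m m₁ hm h _ ih =>
    exact Run.step (p := seq p q) (s := Sum.inl s) (s' := Sum.inl s') hm (by simp [trans, h])
      (ih hq)

theorem Maps.seq {p q : TProg k} {m m₁ m'} (h : Maps x S p m m₁) (hq : Maps x S q m₁ m') :
    Maps x S (seq p q) m m' := run_seq_left h hq

theorem nop_apply (m : Mem k) : Instr.nop.apply x m = m := by
  simp [Instr.apply, Mem.act, Instr.action, Machine.moveIn, Machine.moveHead, Mem.view]

theorem maps_loop_done {c : View k → Bool} {p : TProg k} {m : Mem k} (hm : m.Within S)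
    (hc : c (m.view x) = false) : Maps x S (loop c p) m m := by
  have := Run.halt (p := loop c p) (s := none) (x := x) (S := S) hm (by simp [trans, hc])
    (by simpa [trans, nop_apply] using hm)
  simp only [trans, nop_apply] at this
  exact this

theorem run_loop_body {c : View k → Bool} {p : TProg k} {s m m₁ m'} (h : Run x S p s m m₁)
    (hq : Maps x S (loop c p) m₁ m') : Run x S (loop c p) (some s) m m' := by
  induction h with
  | @halt s m hm h hm' =>
    exact Run.step (p := loop c p) (s := some s) (s' := none) hm (by simp [trans, h]) hq
  | @step s s' m m₁ hm h _ ih =>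
    exact Run.step (p := loop c p) (s := some s) (s' := some s') hm (by simp [trans, h]) (ih hq)

theorem maps_loop_more {c : View k → Bool} {p : TProg k} {m m₁ m'} (hc : c (m.view x) = true)
    (h : Maps x S p m m₁) (hq : Maps x S (loop c p) m₁ m') : Maps x S (loop c p) m m' := by
  refine Run.step (p := loop c p) (s := none) (s' := some p.entry) h.within
    (by simp [trans, hc]) ?_
  simp only [trans, nop_apply]
  exact run_loop_body h hq

theorem maps_cond_false {c : View k → Bool} {p : TProg k} {m : Mem k} (hm : m.Within S)
    (hc : c (m.view x) = false) : Maps x S (cond c p) m m := by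
  have := Run.halt (p := cond c p) (s := none) (x := x) (S := S) hm (by simp [trans, hc])
    (by simpa [trans, nop_apply] using hm)
  simp only [trans, nop_apply] at this
  exact this

theorem run_cond_body {c : View k → Bool} {p : TProg k} {s m m'} (h : Run x S p s m m') :
    Run x S (cond c p) (some s) m m' := by
  induction h with
  | @halt s m hm h hm' =>
    exact Run.halt (p := cond c p) (s := some s) hm (by simp [trans, h]; rfl) hm'
  | @step s s' m m' hm h _ ih =>
    exact Run.step (p := cond c p) (s := some s) (s' := some s') hm (by simp [trans, h]; rfl) ih

theorem maps_cond_true {c : View k → Bool} {p : TProg k} {m m'} (hc : c (m.view x) = true)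
    (h : Maps x S p m m') : Maps x S (cond c p) m m' := by
  refine Run.step (p := cond c p) (s := none) (s' := some p.entry) h.within
    (by simp [trans, hc]) ?_
  simp only [trans, nop_apply]
  exact run_cond_body h

/-- The Turing machine that executes a program. -/
def machine (p : TProg k) : Machine where
  State := Option p.Pos
  finite_state := by
    have := p.finite_pos
    infer_instance
  Γ := Cell
  finite_Γ := inferInstance
  blank := none
  k := k
  start := some p.entry
  δ := fun s i t => match s with
    | none => none
    | some s => some ((p.trans s ⟨i, t⟩).2.action ⟨i, t⟩ (p.trans s ⟨i, t⟩).1)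

def cfg (p : TProg k) (s : Option p.Pos) (m : Mem k) : p.machine.Cfg where
  state := s
  inHead := m.inHead
  tape := m.tape
  head := m.head
  out := m.out

def _root_.LPT.Mem.init (k : ℕ) : Mem k where
  inHead := 0
  tape := fun _ _ => none
  head := fun _ => 0
  out := []

theorem step_cfg (p : TProg k) (s : p.Pos) (m : Mem k) :
    p.machine.step x (p.cfg (some s) m) =
      some (p.cfg (p.trans s (m.view x)).1 ((p.trans s (m.view x)).2.apply x m)) := rfl

theorem step_cfg_none (p : TProg k) (m : Mem k) : p.machine.step x (p.cfg none m) = none := rfl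

theorem Run.reaches {p : TProg k} {s m m'} (h : Run x S p s m m') :
    Relation.ReflTransGen (fun c₁ c₂ => p.machine.step x c₁ = some c₂)
      (p.cfg (some s) m) (p.cfg none m') := by
  induction h with
  | @halt s m hm h hm' =>
    refine Relation.ReflTransGen.single ?_
    rw [step_cfg, h]
  | @step s s' m m' hm h _ ih =>
    refine Relation.ReflTransGen.head ?_ ih
    rw [step_cfg, h]

/-- The machine is deterministic, so every reachable configuration lies on the one run, and `Run`
records the space bound at each of its memories. -/
theorem Maps.computesInSpace {p : TProg k} {m' : Mem k} (h : Maps x S p (Mem.init k) m') :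
    p.machine.ComputesInSpace x m'.out S := by
  refine ⟨⟨p.cfg none m', h.reaches, step_cfg_none p m', rfl⟩, ?_⟩
  have key : ∀ c, p.machine.Reaches x c →
      (∃ s m, c = p.cfg (some s) m ∧ Run x S p s m m') ∨ c = p.cfg none m' := by
    intro c hc
    induction hc with
    | refl => exact Or.inl ⟨p.entry, Mem.init k, rfl, h⟩
    | tail _ hstep ih =>
      rcases ih with ⟨s, m, rfl, hr⟩ | rfl
      · rw [step_cfg] at hstep
        obtain rfl := Option.some.inj hstep
        cases hr with
        | halt hm hn hm' => exact Or.inr (by rw [hn])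
        | @step _ s' _ _ hm hn hr => exact Or.inl ⟨s', _, by rw [hn], hr⟩
      · rw [step_cfg_none] at hstep
        cases hstep
  intro c hc
  rcases key c hc with ⟨s, m, rfl, hr⟩ | rfl
  · exact hr.within
  · exact h.within'

end TProg

/-! ### Binary counters on work tapes -/

/-- The tape that holds `l` on the cells `0, 1, …`. -/
def tapeOf (l : List Bool) : ℤ → Cell := fun z => if 0 ≤ z then l[z.toNat]? else none

theorem tapeOf_neg_one (l : List Bool) : tapeOf l (-1) = none := by simp [tapeOf]

theorem tapeOf_length (l : List Bool) : tapeOf l (l.length : ℤ) = none := by simp [tapeOf]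

theorem tapeOf_mid (l₁ l₂ : List Bool) (b : Bool) :
    tapeOf (l₁ ++ b :: l₂) (l₁.length : ℤ) = some b := by simp [tapeOf]

theorem update_tapeOf_mid (l₁ l₂ : List Bool) (b g : Bool) :
    Function.update (tapeOf (l₁ ++ b :: l₂)) (l₁.length : ℤ) (some g) = tapeOf (l₁ ++ g :: l₂) := by
  funext z
  by_cases hz : z = l₁.length
  · subst hz
    simp [tapeOf]
  · rw [Function.update_of_ne hz]
    unfold tapeOf
    split_ifs with h0
    · have : z.toNat ≠ l₁.length := by omega
      rcases lt_or_gt_of_ne this with h | h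
      · rw [List.getElem?_append_left h, List.getElem?_append_left h]
      · rw [List.getElem?_append_right h.le, List.getElem?_append_right h.le]
        obtain ⟨d, hd⟩ : ∃ d, z.toNat - l₁.length = d + 1 := ⟨z.toNat - l₁.length - 1, by omega⟩
        rw [hd]
        simp
    · rfl

theorem update_tapeOf_length (l : List Bool) (g : Bool) :
    Function.update (tapeOf l) (l.length : ℤ) (some g) = tapeOf (l ++ [g]) := by
  funext z
  by_cases hz : z = l.length
  · subst hz
    simp [tapeOf]
  · rw [Function.update_of_ne hz]
    unfold tapeOf
    split_ifs with h0
    · have : z.toNat ≠ l.length := by omega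
      rcases lt_or_gt_of_ne this with h | h
      · rw [List.getElem?_append_left h]
      · rw [List.getElem?_eq_none (by omega), List.getElem?_eq_none (by simp; omega)]
    · rfl

/-- The number with the binary digits `l`, least significant digit first. -/
def binVal : List Bool → ℕ
  | [] => 0
  | b :: l => b.toNat + 2 * binVal l

theorem binVal_replicate_false (n : ℕ) (l : List Bool) :
    binVal (List.replicate n false ++ l) = 2 ^ n * binVal l := by
  induction n with
  | zero => simp
  | succ n ih => simp [List.replicate_succ, binVal, ih, pow_succ]; ring

theorem binVal_replicate_true (n : ℕ) (l : List Bool) :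
    binVal (List.replicate n true ++ l) + 1 = 2 ^ n * (binVal l + 1) := by
  induction n with
  | zero => simp
  | succ n ih =>
    simp only [List.replicate_succ, List.cons_append, binVal, Bool.toNat_true, pow_succ]
    linarith

theorem exists_replicate_append (b : Bool) (l : List Bool) :
    ∃ n rest, l = List.replicate n b ++ rest ∧ rest.head? ≠ some b := by
  induction l with
  | nil => exact ⟨0, [], by simp⟩
  | cons a l ih =>
    by_cases h : a = b
    · obtain ⟨n, rest, rfl, hr⟩ := ih
      exact ⟨n + 1, rest, by simp [List.replicate_succ, h], hr⟩
    · exact ⟨0, a :: l, by simp, by simpa using h⟩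

theorem eq_nil_or_cons_not {b : Bool} {rest : List Bool} (h : rest.head? ≠ some b) :
    rest = [] ∨ ∃ l, rest = (!b) :: l := by
  cases rest with
  | nil => exact Or.inl rfl
  | cons a l =>
    refine Or.inr ⟨l, ?_⟩
    cases a <;> cases b <;> simp_all

namespace Mem

variable {k : ℕ}

/-- Replace the content and the head position of a tape. -/
def put (m : Mem k) (r : Fin k) (T : ℤ → Cell) (h : ℤ) : Mem k :=
  { m with tape := Function.update m.tape r T, head := Function.update m.head r h }

theorem within_put {S : ℕ} {m : Mem k} (hm : m.Within S) (r : Fin k) (T : ℤ → Cell) {h : ℤ}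
    (hh : |h| ≤ (S : ℤ)) : (m.put r T h).Within S := by
  intro j
  by_cases hj : j = r
  · subst hj
    simpa [put] using hh
  · simpa [put, hj] using hm j

theorem apply_write_put (x : List (Option Bool)) (m : Mem k) (r : Fin k) (T : ℤ → Cell) (h : ℤ)
    (f : Cell → Cell) (mv : Move) :
    (Instr.write r f mv).apply x (m.put r T h) =
      m.put r (Function.update T h (f (T h))) (Machine.moveHead h mv) := by
  simp only [Instr.apply, Mem.act, Instr.action, put, view, Machine.moveIn, Option.toList_none,
    List.append_nil, Mem.mk.injEq, true_and, and_true]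
  constructor
  · funext j
    by_cases hj : j = r
    · subst hj
      simp
    · have : j.val ≠ r.val := fun e => hj (Fin.ext e)
      simp [hj, this]
  · funext j
    by_cases hj : j = r
    · subst hj
      simp
    · have : j.val ≠ r.val := fun e => hj (Fin.ext e)
      simp [hj, this, Machine.moveHead]

/-- The memory whose tapes hold the strings `ls`, with all work heads at `0`. -/
def ofLists (ls : Fin k → List Bool) (i : ℕ) (o : List Bool) : Mem k where
  inHead := i
  tape := fun j => tapeOf (ls j)
  head := fun _ => 0
  out := o

theorem ofLists_update (ls : Fin k → List Bool) (i : ℕ) (o : List Bool) (r : Fin k)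
    (l : List Bool) :
    ofLists (Function.update ls r l) i o = (ofLists ls i o).put r (tapeOf l) 0 := by
  simp only [ofLists, put, Mem.mk.injEq, true_and, and_true]
  constructor
  · funext j
    by_cases hj : j = r
    · subst hj
      simp
    · simp [hj]
  · funext j
    by_cases hj : j = r
    · subst hj
      simp
    · simp [hj]

theorem ofLists_eq_put (ls : Fin k → List Bool) (i : ℕ) (o : List Bool) (r : Fin k) :
    ofLists ls i o = (ofLists ls i o).put r (tapeOf (ls r)) 0 := by
  rw [← ofLists_update, Function.update_eq_self]

theorem within_ofLists (S : ℕ) (ls : Fin k → List Bool) (i : ℕ) (o : List Bool) :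
    (ofLists ls i o).Within S := by
  intro j
  simp [ofLists]

end Mem

namespace TProg

variable {k : ℕ} {x : List (Option Bool)} {S : ℕ}

/-- Test the scanned cell of tape `r`. -/
def cellTest (r : ℕ) (t : Cell → Bool) : View k → Bool := fun v =>
  if h : r < k then t (v.cells ⟨r, h⟩) else false

theorem cellTest_put (m : Mem k) (r : Fin k) (T : ℤ → Cell) (h : ℤ) (t : Cell → Bool) :
    cellTest r.val t ((m.put r T h).view x) = t (T h) := by
  simp [cellTest, Mem.view, Mem.put]

theorem maps_write {m : Mem k} (hm : m.Within S) (r : Fin k) (T : ℤ → Cell) {h : ℤ}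
    (f : Cell → Cell) (mv : Move) (hh : |h| ≤ (S : ℤ))
    (hh' : |Machine.moveHead h mv| ≤ (S : ℤ)) :
    Maps x S (instr (.write r f mv)) (m.put r T h)
      (m.put r (Function.update T h (f (T h))) (Machine.moveHead h mv)) := by
  rw [← Mem.apply_write_put x]
  refine maps_instr (Mem.within_put hm _ _ hh) ?_
  rw [Mem.apply_write_put]
  exact Mem.within_put hm _ _ hh'

/-- Replace a run of the bit `b` by a run of `g`, moving right. -/
def walkRight (r : ℕ) (b g : Bool) : TProg k :=
  loop (cellTest r fun c => c == some b) (instr (.write r (fun _ => some g) .right))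

theorem maps_walkRight {m : Mem k} (hm : m.Within S) (r : Fin k) (b g : Bool) (n : ℕ) :
    ∀ (l₁ rest : List Bool), rest.head? ≠ some b → l₁.length + n ≤ S →
    Maps x S (walkRight r b g)
      (m.put r (tapeOf (l₁ ++ (List.replicate n b ++ rest))) l₁.length)
      (m.put r (tapeOf (l₁ ++ (List.replicate n g ++ rest))) (l₁.length + n : ℕ)) := by
  induction n with
  | zero =>
    intro l₁ rest hr hS
    simp only [List.replicate_zero, List.nil_append, Nat.add_zero]
    refine maps_loop_done (Mem.within_put hm _ _ (by rw [abs_of_nonneg] <;> omega)) ?_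
    rw [cellTest_put]
    cases rest with
    | nil => simp [tapeOf_length]
    | cons a rest =>
      rw [tapeOf_mid]
      simpa using hr
  | succ n ih =>
    intro l₁ rest hr hS
    rw [List.replicate_succ, List.cons_append]
    refine maps_loop_more (by rw [cellTest_put, tapeOf_mid]; simp)
      (maps_write hm r _ _ _ ?_ ?_) ?_
    · rw [abs_of_nonneg] <;> omega
    · simp only [Machine.moveHead]
      rw [abs_of_nonneg] <;> omega
    · have := ih (l₁ ++ [g]) rest hr (by simp; omega)
      simp only [List.append_assoc, List.singleton_append, List.length_append,
        List.length_singleton] at this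
      rw [update_tapeOf_mid, List.replicate_succ (a := g), List.cons_append]
      rw [show l₁.length + 1 + n = l₁.length + (n + 1) by ring] at this
      exact this

/-- Apply `f` to all bits to the left, moving left, and return to cell `0`. -/
def walkLeft (r : ℕ) (f : Bool → Bool) : TProg k :=
  seq (loop (cellTest r fun c => c.isSome) (instr (.write r (Option.map f) .left)))
    (instr (.write r id .right))

/-- The blank in cell `-1` stops the walk, whence `1 ≤ S`. The digits `l₂` to the right of the
starting cell are not touched. -/
theorem maps_walkLeft {m : Mem k} (hm : m.Within S) (r : Fin k) (f : Bool → Bool)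
    (hS : 1 ≤ S) (l₁ : List Bool) :
    ∀ l₂ : List Bool, l₁.length ≤ S →
    Maps x S (walkLeft r f)
      (m.put r (tapeOf (l₁ ++ l₂)) (l₁.length - 1 : ℤ)) (m.put r (tapeOf (l₁.map f ++ l₂)) 0) := by
  intro l₂ hl
  have habs : |(-1 : ℤ)| ≤ (S : ℤ) := by simpa using hS
  have key : Maps x S (loop (cellTest r fun c => c.isSome) (instr (.write r (Option.map f) .left)))
      (m.put r (tapeOf (l₁ ++ l₂)) (l₁.length - 1 : ℤ))
      (m.put r (tapeOf (l₁.map f ++ l₂)) (-1)) := by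
    clear hS
    induction l₁ using List.reverseRecOn generalizing l₂ with
    | nil =>
      refine maps_loop_done (Mem.within_put hm _ _ habs) ?_
      rw [cellTest_put]
      simp [tapeOf_neg_one]
    | append_singleton l₁ b ih =>
      have hlen : (((l₁ ++ [b]).length : ℕ) : ℤ) - 1 = l₁.length := by simp
      simp only [List.length_append, List.length_singleton] at hl
      rw [hlen, List.append_assoc, List.singleton_append]
      refine maps_loop_more (by rw [cellTest_put, tapeOf_mid]; simp)
        (maps_write hm r _ _ _ ?_ ?_) ?_
      · rw [abs_of_nonneg] <;> omega
      · simp only [Machine.moveHead]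
        rw [abs_le]
        constructor <;> omega
      · rw [tapeOf_mid, Option.map_some, update_tapeOf_mid]
        have := ih (f b :: l₂) (by omega)
        simpa [Machine.moveHead] using this
  refine key.seq ?_
  have := maps_write (x := x) hm r (tapeOf (l₁.map f ++ l₂)) (h := -1) id .right habs
    (by simp [Machine.moveHead])
  rw [id, Function.update_eq_self] at this
  exact this

/-- Carry propagation: the low-order ones become zeros, and the first cell behind them, be it `0` or
blank, becomes `1`. -/
def incr (r : ℕ) : TProg k :=
  seq (walkRight r true false) (seq (instr (.write r (fun _ => some true) .left)) (walkLeft r id))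

theorem maps_incr {m : Mem k} (hm : m.Within S) (r : Fin k) (hS : 1 ≤ S) (l : List Bool)
    (hl : l.length ≤ S) (hb : binVal l + 1 < 2 ^ S) :
    ∃ l', l'.length ≤ S ∧ binVal l' = binVal l + 1 ∧
      Maps x S (incr r) (m.put r (tapeOf l) 0) (m.put r (tapeOf l') 0) := by
  obtain ⟨n, rest, rfl, hr⟩ := exists_replicate_append true l
  have hval := binVal_replicate_true n rest
  simp only [List.length_append, List.length_replicate] at hl
  have h1 := maps_walkRight (x := x) hm r true false n [] rest hr (by simp; omega)
  simp only [List.nil_append, List.length_nil, Nat.zero_add, Nat.cast_zero] at h1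
  have hlen : ((List.replicate n false).length : ℤ) = n := by simp
  have habs : |(n : ℤ)| ≤ S := by rw [abs_of_nonneg] <;> omega
  have habs' : |Machine.moveHead (n : ℤ) .left| ≤ S := by
    simp only [Machine.moveHead]
    rw [abs_le]
    constructor <;> omega
  have h2 := maps_write (x := x) hm r (tapeOf (List.replicate n false ++ rest))
    (fun _ => some true) .left habs habs'
  rcases eq_nil_or_cons_not hr with rfl | ⟨rest, rfl⟩
  · refine ⟨List.replicate n false ++ [true], ?_, ?_, h1.seq (h2.seq ?_)⟩
    · simp only [List.length_append, List.length_replicate, List.length_singleton]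
      rw [hval] at hb
      -- All `n` digits are ones, so the new value is `2 ^ n`; its bound leaves room for the
      -- additional digit.
      have : n < S := (Nat.pow_lt_pow_iff_right (a := 2) (by norm_num)).1 (by simpa [binVal] using hb)
      omega
    · rw [hval, binVal_replicate_false]
      simp [binVal]
    · have := maps_walkLeft (x := x) hm r id hS (List.replicate n false) [true] (by simp; omega)
      rw [← hlen, List.append_nil, update_tapeOf_length, hlen]
      simpa [Machine.moveHead] using this
  · refine ⟨List.replicate n false ++ true :: rest, ?_, ?_, h1.seq (h2.seq ?_)⟩
    · simp only [List.length_append, List.length_replicate, List.length_cons] at hl ⊢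
      omega
    · rw [hval, binVal_replicate_false]
      simp [binVal]
      ring
    · have := maps_walkLeft (x := x) hm r id hS (List.replicate n false) (true :: rest)
        (by simp; omega)
      rw [← hlen, update_tapeOf_mid, hlen]
      simpa [Machine.moveHead] using this

/-- Subtract `1`, with the head on the lowest digit `1`. -/
def decr (r : ℕ) : TProg k :=
  seq (instr (.write r (fun _ => some false) .left)) (walkLeft r fun _ => true)

/-- Borrowing: the zeros below the lowest one become ones, and that one becomes a zero. The length
does not change, so counters may carry leading zeros, and every string of zeros stands for zero. -/
theorem maps_decr {m : Mem k} (hm : m.Within S) (r : Fin k) (hS : 1 ≤ S) (n : ℕ)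
    (rest : List Bool) (hn : n ≤ S) :
    Maps x S (decr r) (m.put r (tapeOf (List.replicate n false ++ true :: rest)) n)
      (m.put r (tapeOf (List.replicate n true ++ false :: rest)) 0) := by
  have hlen : ((List.replicate n false).length : ℤ) = n := by simp
  have habs : |(n : ℤ)| ≤ S := by rw [abs_of_nonneg] <;> omega
  have habs' : |Machine.moveHead (n : ℤ) .left| ≤ S := by
    simp only [Machine.moveHead]
    rw [abs_le]
    constructor <;> omega
  have h2 := maps_write (x := x) hm r (tapeOf (List.replicate n false ++ true :: rest))
    (fun _ => some false) .left habs habs'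
  refine h2.seq ?_
  have := maps_walkLeft (x := x) hm r (fun _ => true) hS (List.replicate n false) (false :: rest)
    (by simp; omega)
  rw [← hlen, update_tapeOf_mid, hlen]
  simpa [Machine.moveHead] using this

/-- Execute `p` as often as the value of counter `r`, counting it down. -/
def countLoop (r : ℕ) (p : TProg k) : TProg k :=
  seq (walkRight r false false)
    (seq (loop (cellTest r fun c => c == some true) (seq (decr r) (seq p (walkRight r false false))))
      (seq (instr (.write r id .left)) (walkLeft r id)))

end TProg

/-! ### Counter programs -/

/-- Programs for a machine with counters, a read-only input tape and an output tape. -/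
inductive CProg
  | skip
  | inc (r : ℕ)
  | emit (b : Bool)
  | next
  | seq (p q : CProg)
  | loop (r : ℕ) (p : CProg)
  | whileIn (c : InSym (Option Bool) → Bool) (p : CProg)
  | ifIn (c : InSym (Option Bool) → Bool) (p : CProg)

structure CState where
  regs : ℕ → ℕ
  inHead : ℕ
  out : List Bool

def CState.set (s : CState) (r v : ℕ) : CState := { s with regs := Function.update s.regs r v }

/-- Execution with `k` counters whose values stay below `B`. The body of `loop r p` must not change
the counter `r`. -/
inductive Exec (k B : ℕ) (x : List (Option Bool)) : CProg → CState → CState → Prop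
  | skip (s) : Exec k B x .skip s s
  | inc (s r) (hr : r < k) (hB : s.regs r + 1 ≤ B) : Exec k B x (.inc r) s (s.set r (s.regs r + 1))
  | emit (s b) : Exec k B x (.emit b) s { s with out := s.out ++ [b] }
  | next (s) : Exec k B x .next s { s with inHead := Machine.moveIn x s.inHead .right }
  | seq {p q s₁ s₂ s₃} (h : Exec k B x p s₁ s₂) (h' : Exec k B x q s₂ s₃) :
      Exec k B x (.seq p q) s₁ s₃
  | loop {r p} (hr : r < k) (n : ℕ) (s : ℕ → CState) (hs : ∀ i ≤ n, (s i).regs r = n - i)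
      (h : ∀ i < n, Exec k B x p ((s i).set r (n - i - 1)) (s (i + 1))) :
      Exec k B x (.loop r p) (s 0) (s n)
  | whileIn {c p} (n : ℕ) (s : ℕ → CState)
      (hs : ∀ i < n, c (Machine.readIn x (s i).inHead) = true)
      (hn : c (Machine.readIn x (s n).inHead) = false)
      (h : ∀ i < n, Exec k B x p (s i) (s (i + 1))) :
      Exec k B x (.whileIn c p) (s 0) (s n)
  | ifFalse {c p} (s) (hc : c (Machine.readIn x s.inHead) = false) : Exec k B x (.ifIn c p) s s
  | ifTrue {c p s s'} (hc : c (Machine.readIn x s.inHead) = true) (h : Exec k B x p s s') :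
      Exec k B x (.ifIn c p) s s'

theorem Exec.mono {k k' B B' : ℕ} {x : List (Option Bool)} (hk : k ≤ k') (hB : B ≤ B')
    {p : CProg} {s s' : CState} (h : Exec k B x p s s') : Exec k' B' x p s s' := by
  induction h with
  | skip s => exact .skip s
  | inc s r hr hb => exact .inc s r (by omega) (by omega)
  | emit s b => exact .emit s b
  | next s => exact .next s
  | seq _ _ ih ih' => exact .seq ih ih'
  | loop hr n s hs _ ih => exact .loop (by omega) n s hs ih
  | whileIn n s hs hn _ ih => exact .whileIn n s hs hn ih
  | ifFalse s hc => exact .ifFalse s hc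
  | ifTrue hc _ ih => exact .ifTrue hc ih

namespace CProg

def compile (k : ℕ) : CProg → TProg k
  | skip => .instr .nop
  | inc r => TProg.incr r
  | emit b => .instr (.emit b)
  | next => .instr .next
  | seq p q => .seq (compile k p) (compile k q)
  | loop r p => TProg.countLoop r (compile k p)
  | whileIn c p => .loop (fun v => c v.inp) (compile k p)
  | ifIn c p => .cond (fun v => c v.inp) (compile k p)

end CProg

/-- The strings on the work tapes represent the counters. -/
def Represents {k : ℕ} (S : ℕ) (ls : Fin k → List Bool) (s : CState) : Prop :=
  ∀ j, (ls j).length ≤ S ∧ binVal (ls j) = s.regs j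

theorem Represents.set {k S : ℕ} {ls : Fin k → List Bool} {s : CState} (h : Represents S ls s)
    (r : Fin k) {l : List Bool} {v : ℕ} (hl : l.length ≤ S) (hv : binVal l = v) :
    Represents S (Function.update ls r l) (s.set r v) := by
  intro j
  by_cases hj : j = r
  · subst hj
    simp [CState.set, hl, hv]
  · have : j.val ≠ r.val := fun e => hj (Fin.ext e)
    simpa [CState.set, hj, this] using h j

-- After each scan the head of tape `r` is on the lowest digit `1`, or on the blank behind the
-- digits if the counter is zero. The loop test therefore decides whether the counter is positive,
-- and the head is already where `decr` expects it.
open TProg in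
theorem maps_countLoop {k S : ℕ} {x : List (Option Bool)} (hS : 1 ≤ S) (r : Fin k) (p : TProg k)
    (n : ℕ) (s : ℕ → CState) (hs : ∀ i ≤ n, (s i).regs r = n - i)
    (ih : ∀ i < n, ∀ ls : Fin k → List Bool, Represents S ls ((s i).set r (n - i - 1)) →
      ∃ ls' : Fin k → List Bool, Represents S ls' (s (i + 1)) ∧
        Maps x S p (Mem.ofLists ls (s i).inHead (s i).out)
          (Mem.ofLists ls' (s (i + 1)).inHead (s (i + 1)).out))
    (ls : Fin k → List Bool) (h : Represents S ls (s 0)) :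
    ∃ ls' : Fin k → List Bool, Represents S ls' (s n) ∧
      Maps x S (countLoop r p) (Mem.ofLists ls (s 0).inHead (s 0).out)
        (Mem.ofLists ls' (s n).inHead (s n).out) := by
  have scan : ∀ (ls : Fin k → List Bool) (i : ℕ), Represents S ls (s i) →
      ∃ m rest, ls r = List.replicate m false ++ rest ∧ rest.head? ≠ some false ∧ m ≤ S ∧
        Maps x S (walkRight r false false) (Mem.ofLists ls (s i).inHead (s i).out)
          ((Mem.ofLists ls (s i).inHead (s i).out).put r (tapeOf (ls r)) m) := by
    intro ls i hls
    obtain ⟨m, rest, hl, hr⟩ := exists_replicate_append false (ls r)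
    have hm : m ≤ S := by
      have := (hls r).1
      rw [hl] at this
      simp at this
      omega
    refine ⟨m, rest, hl, hr, hm, ?_⟩
    have := maps_walkRight (x := x) (Mem.within_ofLists S ls (s i).inHead (s i).out) r false false m
      [] rest hr (by simpa using hm)
    simp only [List.nil_append, List.length_nil, Nat.zero_add, Nat.cast_zero, ← hl] at this
    rwa [← Mem.ofLists_eq_put] at this
  -- Induction on the number `d` of iterations that are left, starting with the scan completed.
  have main : ∀ d i, i + d = n → ∀ (ls : Fin k → List Bool) (m : ℕ) (rest : List Bool),
      Represents S ls (s i) → ls r = List.replicate m false ++ rest → rest.head? ≠ some false →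
      m ≤ S → ∃ (ls' : Fin k → List Bool) (m' : ℕ), Represents S ls' (s n) ∧
        ls' r = List.replicate m' false ∧ m' ≤ S ∧
        Maps x S (loop (cellTest r fun c => c == some true)
            (seq (decr r) (seq p (walkRight r false false))))
          ((Mem.ofLists ls (s i).inHead (s i).out).put r (tapeOf (ls r)) m)
          ((Mem.ofLists ls' (s n).inHead (s n).out).put r (tapeOf (ls' r)) m') := by
    intro d
    induction d with
    | zero =>
      rintro i rfl ls m rest hls hl hr hm
      have hv : binVal (ls r) = 0 := by rw [(hls r).2, hs i le_rfl]; simp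
      rcases eq_nil_or_cons_not hr with rfl | ⟨rest, rfl⟩
      · rw [List.append_nil] at hl
        refine ⟨ls, m, hls, hl, hm, maps_loop_done (Mem.within_put (Mem.within_ofLists _ _ _ _) _ _
          (by rw [abs_of_nonneg] <;> omega)) ?_⟩
        rw [cellTest_put, hl]
        have := tapeOf_length (List.replicate m false)
        rw [List.length_replicate] at this
        rw [this]
        rfl
      · rw [hl, binVal_replicate_false] at hv
        simp [binVal] at hv
    | succ d ihd =>
      intro i hi ls m rest hls hl hr hm
      have hv : binVal (ls r) = n - i := by rw [(hls r).2, hs i (by omega)]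
      rcases eq_nil_or_cons_not hr with rfl | ⟨rest, rfl⟩
      · have := binVal_replicate_false m []
        rw [hl, this] at hv
        simp [binVal] at hv
        omega
      · simp only [Bool.not_false] at hl
        have hlen := (hls r).1
        have hv' : binVal (List.replicate m true ++ false :: rest) = n - i - 1 := by
          have h1 := binVal_replicate_true m (false :: rest)
          rw [hl, binVal_replicate_false] at hv
          have h2 : binVal (true :: rest) = binVal (false :: rest) + 1 := by
            simp [binVal]; omega
          rw [h2, ← h1] at hv
          omega
        have hrep : Represents S (Function.update ls r (List.replicate m true ++ false :: rest))
            ((s i).set r (n - i - 1)) := by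
          refine hls.set r ?_ hv'
          rw [hl] at hlen
          simpa using hlen
        obtain ⟨ls₁, hls₁, hmaps⟩ := ih i (by omega) _ hrep
        obtain ⟨m₁, rest₁, hl₁, hr₁, hm₁, hscan⟩ := scan ls₁ (i + 1) hls₁
        obtain ⟨ls', m', h1, h2, h3, h4⟩ := ihd (i + 1) (by omega) ls₁ m₁ rest₁ hls₁ hl₁ hr₁ hm₁
        refine ⟨ls', m', h1, h2, h3, maps_loop_more ?_ (Maps.seq ?_ (hmaps.seq hscan)) h4⟩
        · rw [cellTest_put, hl]
          have := tapeOf_mid (List.replicate m false) rest true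
          rw [List.length_replicate] at this
          rw [this]
          rfl
        · rw [Mem.ofLists_update, hl]
          exact maps_decr (Mem.within_ofLists _ _ _ _) r hS m rest hm
  obtain ⟨m, rest, hl, hr, hm, hscan⟩ := scan ls 0 h
  obtain ⟨ls', m', h1, h2, h3, h4⟩ := main n 0 (by omega) ls m rest h hl hr hm
  refine ⟨ls', h1, hscan.seq (h4.seq ?_)⟩
  have hw := Mem.within_ofLists S ls' (s n).inHead (s n).out
  have habs' : |Machine.moveHead (m' : ℤ) .left| ≤ S := by
    simp only [Machine.moveHead]
    rw [abs_le]
    constructor <;> omega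
  have e1 := maps_write (x := x) hw r (tapeOf (ls' r)) id .left
    (h := (m' : ℤ)) (by rw [abs_of_nonneg] <;> omega) habs'
  rw [id, Function.update_eq_self] at e1
  refine e1.seq ?_
  have e2 := maps_walkLeft (x := x) hw r id hS (ls' r) [] (h1 r).1
  rw [List.append_nil, List.map_id, List.append_nil, ← Mem.ofLists_eq_put] at e2
  convert e2 using 2
  rw [h2]
  simp [Machine.moveHead]

-- Counters determine the strings on the tapes only up to leading zeros, so the final strings are
-- merely asserted to exist. `B < 2 ^ S` is what makes every increment fit into `S` cells.
open TProg in
theorem Exec.maps {k B S : ℕ} {x : List (Option Bool)} (hS : 1 ≤ S) (hB : B < 2 ^ S) {p : CProg}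
    {s s' : CState} (h : Exec k B x p s s') : ∀ ls : Fin k → List Bool, Represents S ls s →
      ∃ ls' : Fin k → List Bool, Represents S ls' s' ∧
        Maps x S (p.compile k) (Mem.ofLists ls s.inHead s.out)
          (Mem.ofLists ls' s'.inHead s'.out) := by
  induction h with
  | skip s =>
    intro ls hls
    refine ⟨ls, hls, ?_⟩
    have hw := Mem.within_ofLists S ls s.inHead s.out
    have := maps_instr (x := x) (S := S) (a := .nop) hw (by rwa [nop_apply])
    rwa [nop_apply] at this
  | inc s r hr hb =>
    intro ls hls
    have hls_r := hls ⟨r, hr⟩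
    obtain ⟨l', h1, h2, h3⟩ := maps_incr (x := x) (Mem.within_ofLists S ls s.inHead s.out) ⟨r, hr⟩ hS
      (ls ⟨r, hr⟩) hls_r.1 (by rw [hls_r.2]; simp only; omega)
    refine ⟨Function.update ls ⟨r, hr⟩ l', hls.set ⟨r, hr⟩ h1 (by rw [h2, hls_r.2]), ?_⟩
    rw [← Mem.ofLists_eq_put, ← Mem.ofLists_update] at h3
    exact h3
  | emit s b =>
    intro ls hls
    refine ⟨ls, hls, ?_⟩
    have e : (Instr.emit b).apply x (Mem.ofLists ls s.inHead s.out) =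
        Mem.ofLists ls s.inHead (s.out ++ [b]) := by
      simp [Instr.apply, Mem.act, Instr.action, Machine.moveIn, Machine.moveHead, Mem.view,
        Mem.ofLists]
    have := maps_instr (x := x) (S := S) (a := .emit b) (Mem.within_ofLists S ls s.inHead s.out)
      (by rw [e]; exact Mem.within_ofLists _ _ _ _)
    rwa [e] at this
  | next s =>
    intro ls hls
    refine ⟨ls, hls, ?_⟩
    have e : Instr.next.apply x (Mem.ofLists ls s.inHead s.out) =
        Mem.ofLists ls (Machine.moveIn x s.inHead .right) s.out := by
      simp [Instr.apply, Mem.act, Instr.action, Machine.moveHead, Mem.view, Mem.ofLists]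
    have := maps_instr (x := x) (S := S) (a := .next) (Mem.within_ofLists S ls s.inHead s.out)
      (by rw [e]; exact Mem.within_ofLists _ _ _ _)
    rwa [e] at this
  | seq _ _ ih ih' =>
    intro ls hls
    obtain ⟨ls₁, h1, h2⟩ := ih ls hls
    obtain ⟨ls₂, h3, h4⟩ := ih' ls₁ h1
    exact ⟨ls₂, h3, h2.seq h4⟩
  | @loop r p hr n s hs _ ih =>
    intro ls hls
    exact maps_countLoop hS ⟨r, hr⟩ (p.compile k) n s hs ih ls hls
  | @whileIn c p n s hs hn _ ih =>
    have main : ∀ d i, i + d = n → ∀ ls : Fin k → List Bool, Represents S ls (s i) →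
        ∃ ls' : Fin k → List Bool, Represents S ls' (s n) ∧
          Maps x S (CProg.compile k (.whileIn c p)) (Mem.ofLists ls (s i).inHead (s i).out)
            (Mem.ofLists ls' (s n).inHead (s n).out) := by
      intro d
      induction d with
      | zero =>
        rintro i rfl ls hls
        exact ⟨ls, hls, maps_loop_done (Mem.within_ofLists _ _ _ _) hn⟩
      | succ d ihd =>
        intro i hi ls hls
        obtain ⟨ls₁, h1, h2⟩ := ih i (by omega) ls hls
        obtain ⟨ls₂, h3, h4⟩ := ihd (i + 1) (by omega) ls₁ h1
        exact ⟨ls₂, h3, maps_loop_more (hs i (by omega)) h2 h4⟩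
    exact main n 0 (by omega)
  | ifFalse s hc =>
    intro ls hls
    exact ⟨ls, hls, maps_cond_false (Mem.within_ofLists _ _ _ _) hc⟩
  | ifTrue hc _ ih =>
    intro ls hls
    obtain ⟨ls', h1, h2⟩ := ih ls hls
    exact ⟨ls', h1, maps_cond_true hc h2⟩

def CState.init : CState := ⟨fun _ => 0, 0, []⟩

/-- Counter programs with polynomially bounded counters run in logarithmic space. -/
theorem logspaceComputable_of_exec {ι : Type} {x : ι → List (Option Bool)} {y : ι → List Bool}
    (p : CProg) (k c : ℕ)
    (h : ∀ i, ∃ s, Exec k (((x i).length + 2) ^ c) (x i) p CState.init s ∧ s.out = y i) :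
    LogspaceComputable x y := by
  refine ⟨(p.compile k).machine, 2 * c + 1, fun i => ?_⟩
  obtain ⟨s, hs, hy⟩ := h i
  -- With `n` the input length, `(n + 2) ^ c ≤ 2 ^ ((log n + 2) * c)`, and `(log n + 2) * c < (2 * c
  -- + 1) * (log n + 1)`. This is the origin of the constant `2 * c + 1`.
  set S := (2 * c + 1) * (Nat.log 2 (x i).length + 1) with hSdef
  have hS : 1 ≤ S := Nat.succ_le_of_lt (by positivity)
  have hB : ((x i).length + 2) ^ c < 2 ^ S := by
    have h1 : (x i).length + 2 ≤ 2 ^ (Nat.log 2 (x i).length + 2) := by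
      have := Nat.lt_pow_succ_log_self (b := 2) (by norm_num) (x i).length
      have h2 : 1 ≤ 2 ^ (Nat.log 2 (x i).length).succ := Nat.one_le_two_pow
      rw [pow_succ] at this ⊢
      rw [pow_succ]
      omega
    calc ((x i).length + 2) ^ c ≤ (2 ^ (Nat.log 2 (x i).length + 2)) ^ c := Nat.pow_le_pow_left h1 c
      _ = 2 ^ ((Nat.log 2 (x i).length + 2) * c) := by rw [← pow_mul]
      _ < 2 ^ S := by
        refine Nat.pow_lt_pow_right (by norm_num) ?_
        rw [hSdef]
        nlinarith [Nat.zero_le (Nat.log 2 (x i).length), Nat.zero_le c]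
  obtain ⟨ls', -, h2⟩ := hs.maps hS hB (fun _ => []) (by intro j; simp [binVal, CState.init])
  have e : Mem.ofLists (k := k) (fun _ => []) CState.init.inHead CState.init.out = Mem.init k := by
    simp only [Mem.ofLists, Mem.init, CState.init, Mem.mk.injEq, true_and, and_true]
    funext j z
    simp [tapeOf]
  rw [e] at h2
  have := h2.computesInSpace
  simpa [Mem.ofLists, hy] using this

/-! ### Functions computed by counter programs -/

theorem CState.set_set (s : CState) (r v w : ℕ) : (s.set r v).set r w = s.set r w := by
  simp [CState.set]

theorem CState.set_self (s : CState) (r : ℕ) : s.set r (s.regs r) = s := by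
  simp [CState.set]

theorem CState.regs_set_self (s : CState) (r v : ℕ) : (s.set r v).regs r = v := by
  simp [CState.set]

theorem CState.regs_set_of_ne (s : CState) {r i : ℕ} (v : ℕ) (h : i ≠ r) :
    (s.set r v).regs i = s.regs i := by
  simp [CState.set, h]

/-- `Exec.loop` asks for the whole sequence of states in advance. Here the successors are chosen one
at a time along an invariant. -/
theorem Exec.loop_inv {k B : ℕ} {x : List (Option Bool)} {r : ℕ} {p : CProg} (hr : r < k)
    (I : ℕ → CState → Prop) {σ : CState} {n : ℕ} (hn : σ.regs r = n) (h0 : I 0 σ)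
    (hstep : ∀ i < n, ∀ s, I i s → s.regs r = n - i →
      ∃ s', Exec k B x p (s.set r (n - i - 1)) s' ∧ I (i + 1) s' ∧ s'.regs r = n - i - 1) :
    ∃ s', Exec k B x (.loop r p) σ s' ∧ I n s' ∧ s'.regs r = 0 := by
  classical
  let next : ℕ → CState → CState := fun i s =>
    if h : ∃ s', Exec k B x p (s.set r (n - i - 1)) s' ∧ I (i + 1) s' ∧ s'.regs r = n - i - 1 then
      h.choose else s
  let f : ℕ → CState := fun i => Nat.rec σ next i
  have hf : ∀ i, f (i + 1) = next i (f i) := fun i => rfl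
  have key : ∀ i ≤ n, I i (f i) ∧ (f i).regs r = n - i := by
    intro i
    induction i with
    | zero => exact fun _ => ⟨h0, hn⟩
    | succ i ih =>
      intro hi
      obtain ⟨h1, h2⟩ := ih (by omega)
      have hex := hstep i (by omega) _ h1 h2
      rw [hf]
      simp only [next, dif_pos hex]
      exact ⟨hex.choose_spec.2.1, by rw [hex.choose_spec.2.2]; omega⟩
  refine ⟨f n, Exec.loop hr n f (fun i hi => (key i hi).2) ?_, (key n le_rfl).1, by
    rw [(key n le_rfl).2]; simp⟩
  intro i hi
  obtain ⟨h1, h2⟩ := key i hi.le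
  have hex := hstep i hi _ h1 h2
  rw [hf]
  simp only [next, dif_pos hex]
  exact hex.choose_spec.1

theorem Exec.while_inv {k B : ℕ} {x : List (Option Bool)} {c : InSym (Option Bool) → Bool}
    {p : CProg} (I : ℕ → CState → Prop) {σ : CState} (n : ℕ) (h0 : I 0 σ)
    (hc : ∀ i < n, ∀ s, I i s → c (Machine.readIn x s.inHead) = true)
    (hn : ∀ s, I n s → c (Machine.readIn x s.inHead) = false)
    (hstep : ∀ i < n, ∀ s, I i s → ∃ s', Exec k B x p s s' ∧ I (i + 1) s') :
    ∃ s', Exec k B x (.whileIn c p) σ s' ∧ I n s' := by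
  classical
  let next : ℕ → CState → CState := fun i s =>
    if h : ∃ s', Exec k B x p s s' ∧ I (i + 1) s' then h.choose else s
  let f : ℕ → CState := fun i => Nat.rec σ next i
  have hf : ∀ i, f (i + 1) = next i (f i) := fun i => rfl
  have key : ∀ i ≤ n, I i (f i) := by
    intro i
    induction i with
    | zero => exact fun _ => h0
    | succ i ih =>
      intro hi
      have hex := hstep i (by omega) _ (ih (by omega))
      rw [hf]
      simp only [next, dif_pos hex]
      exact hex.choose_spec.2
  refine ⟨f n, Exec.whileIn n f (fun i hi => hc i hi _ (key i hi.le)) (hn _ (key n le_rfl)) ?_,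
    key n le_rfl⟩
  intro i hi
  have hex := hstep i hi _ (key i hi.le)
  rw [hf]
  simp only [next, dif_pos hex]
  exact hex.choose_spec.1

theorem exec_clear {k B : ℕ} {x : List (Option Bool)} {r : ℕ} (hr : r < k) (σ : CState) :
    Exec k B x (.loop r .skip) σ (σ.set r 0) := by
  obtain ⟨s', h1, h2, -⟩ := Exec.loop_inv (k := k) (B := B) (x := x) (p := .skip) hr
    (fun i s => s = σ.set r (σ.regs r - i)) (σ := σ) (n := σ.regs r) rfl
    (by simp [CState.set_self])
    (by
      rintro i hi s rfl -
      refine ⟨_, Exec.skip _, ?_, ?_⟩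
      · rw [CState.set_set]
        rfl
      · rw [CState.set_set, CState.regs_set_self])
  simp only [Nat.sub_self] at h2
  rwa [h2] at h1

theorem exec_addTo {k B : ℕ} {x : List (Option Bool)} {r t : ℕ} (hr : r < k) (ht : t < k)
    (hrt : r ≠ t) (σ : CState) (hB : σ.regs t + σ.regs r ≤ B) :
    Exec k B x (.loop r (.inc t)) σ ((σ.set r 0).set t (σ.regs t + σ.regs r)) := by
  obtain ⟨s', h1, h2, -⟩ := Exec.loop_inv (k := k) (B := B) (x := x) (p := .inc t) hr
    (fun i s => s = (σ.set r (σ.regs r - i)).set t (σ.regs t + i)) (σ := σ) (n := σ.regs r) rfl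
    (by
      rw [Nat.sub_zero, CState.set_self, Nat.add_zero, CState.set_self])
    (by
      rintro i hi s rfl -
      have e : ((σ.set r (σ.regs r - i)).set t (σ.regs t + i)).set r (σ.regs r - i - 1) =
          (σ.set r (σ.regs r - i - 1)).set t (σ.regs t + i) := by
        simp only [CState.set, CState.mk.injEq, and_true]
        rw [Function.update_comm hrt.symm, Function.update_idem]
      rw [e]
      refine ⟨_, Exec.inc _ t ht ?_, ?_, ?_⟩
      · rw [CState.regs_set_self]; omega
      · rw [CState.regs_set_self, CState.set_set]
        rfl
      · rw [CState.regs_set_of_ne _ _ hrt, CState.regs_set_of_ne _ _ hrt, CState.regs_set_self])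
  simp only [Nat.sub_self] at h2
  rwa [h2] at h1

/-! ### Polynomially bounded functions, bounded recursion and bounded output loops -/

section Computable

variable {α : Type}

/-- Polynomially bounded functions. -/
def PolyBdd (sz : α → ℕ) (f : α → ℕ) : Prop := ∃ c, ∀ a, f a ≤ (sz a + 2) ^ c

theorem pow_le_of_le {s c c' : ℕ} (h : c ≤ c') : (s + 2) ^ c ≤ (s + 2) ^ c' :=
  Nat.pow_le_pow_right (by omega) h

theorem PolyBdd.of_le {sz f g : α → ℕ} (hg : PolyBdd sz g) (h : ∀ a, f a ≤ g a) : PolyBdd sz f := by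
  obtain ⟨c, hc⟩ := hg
  exact ⟨c, fun a => (h a).trans (hc a)⟩

theorem PolyBdd.const (sz : α → ℕ) (n : ℕ) : PolyBdd sz fun _ => n :=
  ⟨n, fun a => (Nat.lt_two_pow_self).le.trans (Nat.pow_le_pow_left (by omega) n)⟩

theorem PolyBdd.mul {sz f g : α → ℕ} (hf : PolyBdd sz f) (hg : PolyBdd sz g) :
    PolyBdd sz fun a => f a * g a := by
  obtain ⟨c, hc⟩ := hf
  obtain ⟨d, hd⟩ := hg
  exact ⟨c + d, fun a => by rw [pow_add]; exact Nat.mul_le_mul (hc a) (hd a)⟩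

theorem PolyBdd.add {sz f g : α → ℕ} (hf : PolyBdd sz f) (hg : PolyBdd sz g) :
    PolyBdd sz fun a => f a + g a := by
  obtain ⟨c, hc⟩ := hf
  obtain ⟨d, hd⟩ := hg
  refine ⟨max c d + 1, fun a => ?_⟩
  have h1 := (hc a).trans (pow_le_of_le (le_max_left c d))
  have h2 := (hd a).trans (pow_le_of_le (le_max_right c d))
  rw [pow_succ]
  nlinarith [Nat.zero_le (sz a), Nat.zero_le ((sz a + 2) ^ max c d)]

/-- Nothing but the counters from `h` on and the output changes. -/
def Frame (h : ℕ) (σ σ' : CState) : Prop := σ'.inHead = σ.inHead ∧ ∀ i < h, σ'.regs i = σ.regs i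

theorem Frame.refl (h : ℕ) (σ : CState) : Frame h σ σ := ⟨rfl, fun _ _ => rfl⟩

theorem Frame.trans {h h' : ℕ} {σ₁ σ₂ σ₃ : CState} (h₁ : Frame h σ₁ σ₂) (h₂ : Frame h' σ₂ σ₃)
    (hh : h ≤ h') : Frame h σ₁ σ₃ :=
  ⟨h₂.1.trans h₁.1, fun i hi => (h₂.2 i (by omega)).trans (h₁.2 i hi)⟩

theorem Frame.set {h r : ℕ} {σ σ' : CState} (h₁ : Frame h σ σ') (hr : h ≤ r) (v : ℕ) :
    Frame h σ (σ'.set r v) :=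
  ⟨h₁.1, fun i hi => by rw [CState.regs_set_of_ne _ _ (by omega)]; exact h₁.2 i hi⟩

/-- The counters hold the values of the functions in `Γ`, the counter of `g` being `loc g`. -/
def Holds (Γ : Set (α → ℕ)) (loc : (α → ℕ) → ℕ) (a : α) (σ : CState) : Prop :=
  ∀ g ∈ Γ, σ.regs (loc g) = g a

theorem Holds.frame {Γ : Set (α → ℕ)} {loc : (α → ℕ) → ℕ} {a : α} {σ σ' : CState} {h : ℕ}
    (hσ : Holds Γ loc a σ) (hloc : ∀ g ∈ Γ, loc g < h) (hf : Frame h σ σ') : Holds Γ loc a σ' :=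
  fun g hg => (hf.2 _ (hloc g hg)).trans (hσ g hg)

/-- `f` can be computed from the functions in `Γ` with polynomially bounded counters. -/
def Cmp (sz : α → ℕ) (Γ : Set (α → ℕ)) (f : α → ℕ) : Prop :=
  (∀ g ∈ Γ, PolyBdd sz g) → PolyBdd sz f ∧ ∀ (h : ℕ) (loc : (α → ℕ) → ℕ), (∀ g ∈ Γ, loc g < h) →
    ∃ p k c, ∀ a x σ, Holds Γ loc a σ → ∃ σ', Exec k ((sz a + 2) ^ c) x p σ σ' ∧ Frame h σ σ' ∧
      σ'.out = σ.out ∧ σ'.regs h = f a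

/-- `f` can be written to the output. -/
def Emits (sz : α → ℕ) (Γ : Set (α → ℕ)) (f : α → List Bool) : Prop :=
  (∀ g ∈ Γ, PolyBdd sz g) → ∀ (h : ℕ) (loc : (α → ℕ) → ℕ), (∀ g ∈ Γ, loc g < h) →
    ∃ p k c, ∀ a x σ, Holds Γ loc a σ → ∃ σ', Exec k ((sz a + 2) ^ c) x p σ σ' ∧ Frame h σ σ' ∧
      σ'.out = σ.out ++ f a

variable {sz : α → ℕ} {Γ : Set (α → ℕ)}

/-- Reading a counter means counting it down, which destroys it. So it is copied to `h` and `h + 1`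
simultaneously and then restored from `h + 1`. -/
theorem Cmp.var {g : α → ℕ} (hg : g ∈ Γ) : Cmp sz Γ g := by
  intro hΓ
  obtain ⟨c, hc⟩ := hΓ g hg
  refine ⟨⟨c, hc⟩, fun h loc hloc => ?_⟩
  have hlt := hloc g hg
  refine ⟨.seq (.loop h .skip) (.seq (.loop (h + 1) .skip)
    (.seq (.loop (loc g) (.seq (.inc h) (.inc (h + 1)))) (.loop (h + 1) (.inc (loc g))))),
    h + 2, c, fun a x σ hσ => ?_⟩
  have hv := hσ g hg
  have hb : σ.regs (loc g) ≤ (sz a + 2) ^ c := hv ▸ hc a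
  set B := (sz a + 2) ^ c
  set r := loc g
  have e1 : Exec (h + 2) B x (.loop h .skip) σ (σ.set h 0) := exec_clear (by omega) σ
  have e2 : Exec (h + 2) B x (.loop (h + 1) .skip) (σ.set h 0) ((σ.set h 0).set (h + 1) 0) :=
    exec_clear (by omega) _
  set σ₂ := (σ.set h 0).set (h + 1) 0 with hσ₂
  have hr2 : σ₂.regs r = σ.regs r := by
    rw [hσ₂, CState.regs_set_of_ne _ _ (by omega), CState.regs_set_of_ne _ _ (by omega)]
  obtain ⟨σ₃, e3, ⟨i1, i2, i3, i4, i5⟩, hz⟩ := Exec.loop_inv (k := h + 2) (B := B) (x := x) (r := r)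
    (p := .seq (.inc h) (.inc (h + 1))) (by omega)
    (fun i s => s.regs h = i ∧ s.regs (h + 1) = i ∧ s.inHead = σ.inHead ∧ s.out = σ.out ∧
      ∀ j < h, j ≠ r → s.regs j = σ.regs j) (σ := σ₂) hr2
    ⟨by simp [hσ₂, CState.set], by simp [hσ₂, CState.set], rfl, rfl, fun j hj _ => by
      rw [hσ₂, CState.regs_set_of_ne _ _ (by omega), CState.regs_set_of_ne _ _ (by omega)]⟩
    (by
      rintro i hi s ⟨j1, j2, j3, j4, j5⟩ -
      refine ⟨_, Exec.seq (Exec.inc _ h (by omega) ?_) (Exec.inc _ (h + 1) (by omega) ?_),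
        ⟨?_, ?_, j3, j4, ?_⟩, ?_⟩
      · rw [CState.regs_set_of_ne _ _ (by omega), j1]; omega
      · rw [CState.regs_set_of_ne _ _ (by omega), CState.regs_set_of_ne _ _ (by omega), j2]; omega
      · rw [CState.regs_set_of_ne _ _ (by omega), CState.regs_set_self,
          CState.regs_set_of_ne _ _ (by omega), j1]
      · rw [CState.regs_set_self, CState.regs_set_of_ne _ _ (by omega),
          CState.regs_set_of_ne _ _ (by omega), j2]
      · intro j hj hjr
        rw [CState.regs_set_of_ne _ _ (by omega), CState.regs_set_of_ne _ _ (by omega),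
          CState.regs_set_of_ne _ _ (by omega), j5 j hj hjr]
      · rw [CState.regs_set_of_ne _ _ (by omega), CState.regs_set_of_ne _ _ (by omega),
          CState.regs_set_self])
  have e4 := exec_addTo (k := h + 2) (B := B) (x := x) (r := h + 1) (t := r) (by omega) (by omega)
    (by omega) σ₃ (by rw [hz, i2]; omega)
  refine ⟨_, e1.seq (e2.seq (e3.seq e4)), ⟨i3, fun j hj => ?_⟩, i4, ?_⟩
  · by_cases hjr : j = r
    · rw [hjr, CState.regs_set_self, hz, i2, Nat.zero_add]
    · rw [CState.regs_set_of_ne _ _ hjr, CState.regs_set_of_ne _ _ (by omega), i5 j hj hjr]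
  · rw [CState.regs_set_of_ne _ _ (by omega), CState.regs_set_of_ne _ _ (by omega), i1, hv]

theorem Cmp.zero : Cmp sz Γ fun _ => 0 := by
  refine fun _ => ⟨PolyBdd.const sz 0, fun h loc _ => ⟨.loop h .skip, h + 1, 0, fun a x σ _ => ?_⟩⟩
  exact ⟨_, exec_clear (by omega) σ, (Frame.refl h σ).set le_rfl 0, rfl, CState.regs_set_self _ _ _⟩

theorem Cmp.succ {f : α → ℕ} (hf : Cmp sz Γ f) : Cmp sz Γ fun a => f a + 1 := by
  intro hΓ
  obtain ⟨hb, hf⟩ := hf hΓ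
  have hb' := hb.add (PolyBdd.const sz 1)
  refine ⟨hb', fun h loc hloc => ?_⟩
  obtain ⟨p, k, c, hp⟩ := hf h loc hloc
  obtain ⟨d, hd⟩ := hb'
  refine ⟨.seq p (.inc h), max k (h + 1), max c d, fun a x σ hσ => ?_⟩
  obtain ⟨σ', e, hfr, ho, hv⟩ := hp a x σ hσ
  refine ⟨_, (e.mono (le_max_left _ _) (pow_le_of_le (le_max_left _ _))).seq
    (Exec.inc _ h (by omega) ?_), hfr.set le_rfl _, ho, ?_⟩
  · rw [hv]
    exact (hd a).trans (pow_le_of_le (le_max_right _ _))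
  · rw [CState.regs_set_self, hv]

theorem Cmp.const (n : ℕ) : Cmp sz Γ fun _ => n := by
  induction n with
  | zero => exact Cmp.zero
  | succ n ih => exact ih.succ

theorem Cmp.polyBdd {f : α → ℕ} (hf : Cmp sz Γ f) (hΓ : ∀ g ∈ Γ, PolyBdd sz g) : PolyBdd sz f :=
  (hf hΓ).1

/-- The functions in `Γ` and in `Δ`, with an additional argument `i < t a`. -/
def lift (t : α → ℕ) (Γ : Set (α → ℕ)) (Δ : Set ((Σ a, Fin (t a)) → ℕ)) :
    Set ((Σ a, Fin (t a)) → ℕ) :=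
  (fun g q => g q.1) '' Γ ∪ Δ

theorem PolyBdd.lift {f : α → ℕ} (t : α → ℕ) (hf : PolyBdd sz f) :
    PolyBdd (fun q : Σ a, Fin (t a) => sz q.1) fun q => f q.1 := by
  obtain ⟨c, hc⟩ := hf
  exact ⟨c, fun q => hc q.1⟩

/-- A function computed outside of a loop can be used in the body. -/
theorem Cmp.lift {f : α → ℕ} (hΓ : ∀ g ∈ Γ, PolyBdd sz g) (hf : Cmp sz Γ f) {t : α → ℕ}
    {Δ : Set ((Σ a, Fin (t a)) → ℕ)} :
    Cmp (fun q : Σ a, Fin (t a) => sz q.1) (LPT.lift t Γ Δ) fun q => f q.1 := by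
  intro _
  obtain ⟨hb, hf⟩ := hf hΓ
  refine ⟨hb.lift t, fun h loc hloc => ?_⟩
  obtain ⟨p, k, c, hp⟩ := hf h (fun g => loc fun q => g q.1)
    (fun g hg => hloc _ (Or.inl ⟨g, hg, rfl⟩))
  exact ⟨p, k, c, fun q x σ hσ => hp q.1 x σ fun g hg => hσ _ (Or.inl ⟨g, hg, rfl⟩)⟩

open Classical in
/-- Counters for the functions in `lift t Γ Δ`. -/
def liftLoc {t : α → ℕ} (Γ : Set (α → ℕ)) (loc : (α → ℕ) → ℕ) (loc' : ((Σ a, Fin (t a)) → ℕ) → ℕ) :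
    ((Σ a, Fin (t a)) → ℕ) → ℕ := fun g =>
  if hg : ∃ g₀ ∈ Γ, (fun q : Σ a, Fin (t a) => g₀ q.1) = g then loc hg.choose else loc' g

theorem liftLoc_lt {t : α → ℕ} {loc : (α → ℕ) → ℕ} {loc' : ((Σ a, Fin (t a)) → ℕ) → ℕ}
    {Δ : Set ((Σ a, Fin (t a)) → ℕ)} {h h' : ℕ} (hloc : ∀ g ∈ Γ, loc g < h) (hh : h ≤ h')
    (hloc' : ∀ g ∈ Δ, loc' g < h') : ∀ g ∈ LPT.lift t Γ Δ, liftLoc Γ loc loc' g < h' := by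
  intro g hg
  unfold liftLoc
  split_ifs with h1
  · exact (hloc _ h1.choose_spec.1).trans_le hh
  · rcases hg with ⟨g₀, h2, h3⟩ | hg
    · exact absurd ⟨g₀, h2, h3⟩ h1
    · exact hloc' g hg

/-- Several members of `Γ` may have the same lift, as they can differ where `t a = 0`. Whichever one
is chosen has the right value at `q`, so its counter may be used. -/
theorem Holds.lift {t : α → ℕ} {loc : (α → ℕ) → ℕ} {loc' : ((Σ a, Fin (t a)) → ℕ) → ℕ}
    {Δ : Set ((Σ a, Fin (t a)) → ℕ)} {σ : CState} {q : Σ a, Fin (t a)}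
    (hσ : Holds Γ loc q.1 σ) (hΔ : ∀ g ∈ Δ, σ.regs (loc' g) = g q) :
    Holds (LPT.lift t Γ Δ) (liftLoc Γ loc loc') q σ := by
  intro g hg
  unfold liftLoc
  split_ifs with h1
  · rw [hσ _ h1.choose_spec.1]
    exact congrFun h1.choose_spec.2 q
  · rcases hg with ⟨g₀, h2, h3⟩ | hg
    · exact absurd ⟨g₀, h2, h3⟩ h1
    · exact hΔ g hg

/-- The loop index. -/
def idx (t : α → ℕ) : (Σ a, Fin (t a)) → ℕ := fun q => q.2

theorem polyBdd_idx {t : α → ℕ} (ht : PolyBdd sz t) :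
    PolyBdd (fun q : Σ a, Fin (t a) => sz q.1) (idx t) :=
  (ht.lift t).of_le fun q => q.2.isLt.le

/-- Primitive recursion with polynomially bounded values. -/
theorem Cmp.prec {t : α → ℕ} (F : α → ℕ → ℕ) (ht : Cmp sz Γ t) (h0 : Cmp sz Γ fun a => F a 0)
    (hF : (∀ g ∈ Γ, PolyBdd sz g) → ∃ c, ∀ a, ∀ i ≤ t a, F a i ≤ (sz a + 2) ^ c)
    (hs : (∀ g ∈ Γ, PolyBdd sz g) → Cmp (fun q : Σ a, Fin (t a) => sz q.1)
      (LPT.lift t Γ {idx t, fun q => F q.1 q.2}) fun q => F q.1 (q.2 + 1)) :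
    Cmp sz Γ fun a => F a (t a) := by
  intro hΓ
  obtain ⟨cF, hF⟩ := hF hΓ
  refine ⟨⟨cF, fun a => hF a _ le_rfl⟩, fun h loc hloc => ?_⟩
  obtain ⟨htb, ht⟩ := ht hΓ
  obtain ⟨p₁, k₁, c₁, hp₁⟩ := ht h loc hloc
  obtain ⟨p₂, k₂, c₂, hp₂⟩ := (h0 hΓ).2 (h + 2) loc fun g hg => by have := hloc g hg; omega
  -- The bound for the accumulator has to come from `hF`: iterating a polynomially bounded step can
  -- produce exponential values.
  have hΓ' : ∀ g ∈ LPT.lift t Γ {idx t, fun q => F q.1 q.2},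
      PolyBdd (fun q : Σ a, Fin (t a) => sz q.1) g := by
    rintro g (⟨g₀, hg₀, rfl⟩ | rfl | rfl)
    · exact (hΓ g₀ hg₀).lift t
    · exact polyBdd_idx htb
    · exact ⟨cF, fun q => hF q.1 _ q.2.isLt.le⟩
  classical
  -- Counter `h` counts the iterations down, `h + 1` holds the index and `h + 2` the current value
  -- of `F`; the body leaves the next value in `h + 3`.
  let loc' : ((Σ a, Fin (t a)) → ℕ) → ℕ := fun g => if g = idx t then h + 1 else h + 2
  obtain ⟨p₃, k₃, c₃, hp₃⟩ := (hs hΓ hΓ').2 (h + 3) (liftLoc Γ loc loc')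
    (liftLoc_lt hloc (by omega) fun g _ => by simp only [loc']; split_ifs <;> omega)
  obtain ⟨ct, hct⟩ := htb
  set k := max (max k₁ k₂) (max k₃ (h + 4))
  set c := max (max c₁ c₂) (max c₃ (max cF ct))
  have hk₁ : k₁ ≤ k := by omega
  have hk₂ : k₂ ≤ k := by omega
  have hk₃ : k₃ ≤ k := by omega
  have hk : h + 4 ≤ k := by omega
  refine ⟨.seq p₁ (.seq p₂ (.seq (.loop (h + 1) .skip) (.seq
    (.loop h (.seq p₃ (.seq (.loop (h + 2) .skip) (.seq (.loop (h + 3) (.inc (h + 2)))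
      (.inc (h + 1)))))) (.loop (h + 2) (.inc h))))), k, c, fun a x σ hσ => ?_⟩
  set B := (sz a + 2) ^ c
  have hBF : ∀ i ≤ t a, F a i ≤ B := fun i hi => (hF a i hi).trans (pow_le_of_le (by omega))
  have hBt : t a ≤ B := (hct a).trans (pow_le_of_le (by omega))
  obtain ⟨σ₁, e₁, f₁, o₁, v₁⟩ := hp₁ a x σ hσ
  obtain ⟨σ₂, e₂, f₂, o₂, v₂⟩ := hp₂ a x σ₁ (hσ.frame hloc f₁)
  replace e₁ := e₁.mono hk₁ (pow_le_of_le (by omega) : _ ≤ B)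
  replace e₂ := e₂.mono hk₂ (pow_le_of_le (by omega) : _ ≤ B)
  have f₁₂ : Frame h σ σ₂ := f₁.trans f₂ (by omega)
  have e₃ : Exec k B x (.loop (h + 1) .skip) σ₂ (σ₂.set (h + 1) 0) := exec_clear (by omega) _
  obtain ⟨σ₄, e₄, ⟨g1, g2, g3, g4⟩, hz⟩ := Exec.loop_inv (k := k) (B := B) (x := x) (r := h)
    (p := .seq p₃ (.seq (.loop (h + 2) .skip) (.seq (.loop (h + 3) (.inc (h + 2)))
      (.inc (h + 1))))) (by omega)
    (fun i s => Frame h σ s ∧ s.out = σ.out ∧ s.regs (h + 1) = i ∧ s.regs (h + 2) = F a i)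
    (σ := σ₂.set (h + 1) 0) (n := t a)
    (by rw [CState.regs_set_of_ne _ _ (by omega), f₂.2 h (by omega), v₁])
    ⟨f₁₂.set (by omega) 0, o₂.trans o₁, CState.regs_set_self _ _ _, by
      rw [CState.regs_set_of_ne _ _ (by omega), v₂]⟩
    (by
      rintro i hi s ⟨j1, j2, j3, j4⟩ -
      set s₁ := s.set h (t a - i - 1)
      have j1' : Frame h σ s₁ := j1.set le_rfl _
      have hh : Holds (LPT.lift t Γ {idx t, fun q => F q.1 q.2}) (liftLoc Γ loc loc') ⟨a, ⟨i, hi⟩⟩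
          s₁ := by
        refine Holds.lift (q := ⟨a, ⟨i, hi⟩⟩) (hσ.frame hloc j1') fun g hg => ?_
        simp only [loc']
        split_ifs with hgi
        · rw [CState.regs_set_of_ne _ _ (by omega), j3, hgi]
          rfl
        · rcases hg with hg | hg
          · exact absurd hg hgi
          · rw [CState.regs_set_of_ne _ _ (by omega), j4, hg]
      obtain ⟨s₂, d₂, q₂, r₂, w₂⟩ := hp₃ ⟨a, ⟨i, hi⟩⟩ x s₁ hh
      replace d₂ := d₂.mono hk₃ (pow_le_of_le (by omega) : _ ≤ B)
      have d₃ : Exec k B x (.loop (h + 2) .skip) s₂ (s₂.set (h + 2) 0) := exec_clear (by omega) _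
      have d₄ := exec_addTo (k := k) (B := B) (x := x) (r := h + 3) (t := h + 2) (by omega)
        (by omega) (by omega) (s₂.set (h + 2) 0) (by
          rw [CState.regs_set_self, CState.regs_set_of_ne _ _ (by omega), w₂, Nat.zero_add]
          exact hBF (i + 1) hi)
      have w₁ : s₂.regs (h + 1) = i := by
        rw [q₂.2 (h + 1) (by omega), CState.regs_set_of_ne _ _ (by omega), j3]
      refine ⟨_, d₂.seq (d₃.seq (d₄.seq (Exec.inc _ (h + 1) (by omega) ?_))),
        ⟨?_, r₂.trans j2, ?_, ?_⟩, ?_⟩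
      · rw [CState.regs_set_of_ne _ _ (by omega), CState.regs_set_of_ne _ _ (by omega),
          CState.regs_set_of_ne _ _ (by omega), w₁]
        omega
      · exact ((((j1'.trans q₂ (by omega)).set (by omega) _).set (by omega) _).set (by omega) _).set
          (by omega) _
      · rw [CState.regs_set_self, CState.regs_set_of_ne _ _ (by omega),
          CState.regs_set_of_ne _ _ (by omega), CState.regs_set_of_ne _ _ (by omega), w₁]
      · rw [CState.regs_set_of_ne _ _ (by omega), CState.regs_set_self, CState.regs_set_self,
          CState.regs_set_of_ne _ _ (by omega), w₂, Nat.zero_add]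
      · rw [CState.regs_set_of_ne _ _ (by omega), CState.regs_set_of_ne _ _ (by omega),
          CState.regs_set_of_ne _ _ (by omega), CState.regs_set_of_ne _ _ (by omega),
          q₂.2 h (by omega), CState.regs_set_self])
  have e₅ := exec_addTo (k := k) (B := B) (x := x) (r := h + 2) (t := h) (by omega) (by omega)
    (by omega) σ₄ (by rw [hz, g4, Nat.zero_add]; exact hBF _ le_rfl)
  refine ⟨_, e₁.seq (e₂.seq (e₃.seq (e₄.seq e₅))), (g1.set (by omega) _).set le_rfl _, g2, ?_⟩
  rw [CState.regs_set_self, hz, g4, Nat.zero_add]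

theorem Emits.nil : Emits sz Γ fun _ => [] :=
  fun _ h _ _ => ⟨.skip, 0, 0, fun _ _ σ _ => ⟨σ, .skip σ, Frame.refl h σ, by simp⟩⟩

theorem Emits.single (b : Bool) : Emits sz Γ fun _ => [b] :=
  fun _ h _ _ => ⟨.emit b, 0, 0, fun _ _ σ _ => ⟨_, .emit σ b, Frame.refl h σ, rfl⟩⟩

theorem Emits.append {f g : α → List Bool} (hf : Emits sz Γ f) (hg : Emits sz Γ g) :
    Emits sz Γ fun a => f a ++ g a := by
  intro hΓ h loc hloc
  obtain ⟨p₁, k₁, c₁, hp₁⟩ := hf hΓ h loc hloc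
  obtain ⟨p₂, k₂, c₂, hp₂⟩ := hg hΓ h loc hloc
  refine ⟨.seq p₁ p₂, max k₁ k₂, max c₁ c₂, fun a x σ hσ => ?_⟩
  obtain ⟨σ₁, e₁, f₁, o₁⟩ := hp₁ a x σ hσ
  obtain ⟨σ₂, e₂, f₂, o₂⟩ := hp₂ a x σ₁ (hσ.frame hloc f₁)
  exact ⟨σ₂, (e₁.mono (le_max_left _ _) (pow_le_of_le (le_max_left _ _))).seq
    (e₂.mono (le_max_right _ _) (pow_le_of_le (le_max_right _ _))), f₁.trans f₂ le_rfl, by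
    rw [o₂, o₁, List.append_assoc]⟩

theorem Emits.const (l : List Bool) : Emits sz Γ fun _ => l := by
  induction l with
  | nil => exact Emits.nil
  | cons b l ih => exact (Emits.single b).append ih

/-- The loop counter `h` runs down, so a second counter `h + 1` runs up to supply the index to the
body. -/
theorem Emits.range {t : α → ℕ} {g : α → ℕ → List Bool} (ht : Cmp sz Γ t)
    (hg : (∀ g ∈ Γ, PolyBdd sz g) →
      Emits (fun q : Σ a, Fin (t a) => sz q.1) (LPT.lift t Γ {idx t}) fun q => g q.1 q.2) :
    Emits sz Γ fun a => (List.range (t a)).flatMap (g a) := by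
  intro hΓ h loc hloc
  obtain ⟨htb, ht⟩ := ht hΓ
  obtain ⟨p₁, k₁, c₁, hp₁⟩ := ht h loc hloc
  have hΓ' : ∀ g ∈ LPT.lift t Γ {idx t}, PolyBdd (fun q : Σ a, Fin (t a) => sz q.1) g := by
    rintro g (⟨g₀, hg₀, rfl⟩ | rfl)
    · exact (hΓ g₀ hg₀).lift t
    · exact polyBdd_idx htb
  obtain ⟨p₃, k₃, c₃, hp₃⟩ := hg hΓ hΓ' (h + 2) (liftLoc Γ loc fun _ => h + 1)
    (liftLoc_lt hloc (by omega) fun g _ => by omega)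
  obtain ⟨ct, hct⟩ := htb
  set k := max k₁ (max k₃ (h + 2))
  set c := max c₁ (max c₃ ct)
  refine ⟨.seq p₁ (.seq (.loop (h + 1) .skip) (.loop h (.seq p₃ (.inc (h + 1))))), k, c,
    fun a x σ hσ => ?_⟩
  set B := (sz a + 2) ^ c
  have hBt : t a ≤ B := (hct a).trans (pow_le_of_le (by omega))
  obtain ⟨σ₁, e₁, f₁, o₁, v₁⟩ := hp₁ a x σ hσ
  replace e₁ := e₁.mono (by omega : _ ≤ k) (pow_le_of_le (by omega) : _ ≤ B)
  have e₃ : Exec k B x (.loop (h + 1) .skip) σ₁ (σ₁.set (h + 1) 0) := exec_clear (by omega) _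
  obtain ⟨σ₄, e₄, ⟨g1, g2, g3⟩, -⟩ := Exec.loop_inv (k := k) (B := B) (x := x) (r := h)
    (p := .seq p₃ (.inc (h + 1))) (by omega)
    (fun i s => Frame h σ s ∧ s.out = σ.out ++ (List.range i).flatMap (g a) ∧ s.regs (h + 1) = i)
    (σ := σ₁.set (h + 1) 0) (n := t a)
    (by rw [CState.regs_set_of_ne _ _ (by omega), v₁])
    ⟨f₁.set (by omega) 0, by simpa using (show (σ₁.set (h + 1) 0).out = σ.out from o₁), CState.regs_set_self _ _ _⟩
    (by
      rintro i hi s ⟨j1, j2, j3⟩ -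
      set s₁ := s.set h (t a - i - 1)
      have j1' : Frame h σ s₁ := j1.set le_rfl _
      have hh : Holds (LPT.lift t Γ {idx t}) (liftLoc Γ loc fun _ => h + 1) ⟨a, ⟨i, hi⟩⟩
          s₁ := by
        refine Holds.lift (q := ⟨a, ⟨i, hi⟩⟩) (hσ.frame hloc j1') fun g hg => ?_
        rw [CState.regs_set_of_ne _ _ (by omega), j3, Set.mem_singleton_iff.1 hg]
        rfl
      obtain ⟨s₂, d₂, q₂, r₂⟩ := hp₃ ⟨a, ⟨i, hi⟩⟩ x s₁ hh
      replace d₂ := d₂.mono (by omega : _ ≤ k) (pow_le_of_le (by omega) : _ ≤ B)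
      have w₁ : s₂.regs (h + 1) = i := by
        rw [q₂.2 (h + 1) (by omega), CState.regs_set_of_ne _ _ (by omega), j3]
      refine ⟨_, d₂.seq (Exec.inc _ (h + 1) (by omega) (by rw [w₁]; omega)), ⟨?_, ?_, ?_⟩, ?_⟩
      · exact (j1'.trans q₂ (by omega)).set (by omega) _
      · rw [List.range_succ, List.flatMap_append]
        simp only [CState.set, List.flatMap_singleton]
        rw [r₂, ← List.append_assoc, ← j2]
        rfl
      · rw [CState.regs_set_self, w₁]
      · rw [CState.regs_set_of_ne _ _ (by omega), q₂.2 h (by omega), CState.regs_set_self])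
  exact ⟨σ₄, e₁.seq (e₃.seq e₄), g1, g2⟩

end Computable

/-! ### Arithmetic, decidable predicates and case distinctions -/

section Computable

variable {α : Type} {sz : α → ℕ} {Γ : Set (α → ℕ)}

theorem Cmp.congr {f g : α → ℕ} (hf : Cmp sz Γ f) (h : ∀ a, f a = g a) : Cmp sz Γ g := by
  rwa [← funext h]

theorem Emits.congr {f g : α → List Bool} (hf : Emits sz Γ f) (h : ∀ a, f a = g a) :
    Emits sz Γ g := by
  rwa [← funext h]

theorem Cmp.idx {t : α → ℕ} {Δ : Set ((Σ a, Fin (t a)) → ℕ)} (h : LPT.idx t ∈ Δ) :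
    Cmp (fun q : Σ a, Fin (t a) => sz q.1) (LPT.lift t Γ Δ) fun q => q.2 :=
  Cmp.var (Or.inr h)

theorem Cmp.acc {t : α → ℕ} (F : α → ℕ → ℕ) :
    Cmp (fun q : Σ a, Fin (t a) => sz q.1) (LPT.lift t Γ {LPT.idx t, fun q => F q.1 q.2})
      fun q => F q.1 q.2 :=
  Cmp.var (Or.inr (Or.inr rfl))

theorem Cmp.add {f g : α → ℕ} (hf : Cmp sz Γ f) (hg : Cmp sz Γ g) :
    Cmp sz Γ fun a => f a + g a := by
  refine Cmp.prec (fun a i => f a + i) hg hf (fun hΓ => ?_) fun _ => (Cmp.acc fun a i => f a + i).succ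
  obtain ⟨c, hc⟩ := (hf.polyBdd hΓ).add (hg.polyBdd hΓ)
  exact ⟨c, fun a i hi => (Nat.add_le_add_left hi _).trans (hc a)⟩

theorem Cmp.pred {f : α → ℕ} (hf : Cmp sz Γ f) : Cmp sz Γ fun a => f a - 1 := by
  refine Cmp.prec (fun _ i => i - 1) hf Cmp.zero (fun hΓ => ?_) fun _ => Cmp.idx (Or.inl rfl)
  obtain ⟨c, hc⟩ := hf.polyBdd hΓ
  exact ⟨c, fun a i hi => (Nat.sub_le _ _).trans (hi.trans (hc a))⟩

theorem Cmp.sub {f g : α → ℕ} (hf : Cmp sz Γ f) (hg : Cmp sz Γ g) :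
    Cmp sz Γ fun a => f a - g a := by
  refine Cmp.prec (fun a i => f a - i) hg hf (fun hΓ => ?_) fun _ => (Cmp.acc fun a i => f a - i).pred
  obtain ⟨c, hc⟩ := hf.polyBdd hΓ
  exact ⟨c, fun a i _ => (Nat.sub_le _ _).trans (hc a)⟩

theorem Cmp.mul {f g : α → ℕ} (hf : Cmp sz Γ f) (hg : Cmp sz Γ g) :
    Cmp sz Γ fun a => f a * g a := by
  refine Cmp.prec (fun a i => f a * i) hg Cmp.zero (fun hΓ => ?_)
    fun hΓ => (Cmp.acc fun a i => f a * i).add (hf.lift hΓ)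
  obtain ⟨c, hc⟩ := (hf.polyBdd hΓ).mul (hg.polyBdd hΓ)
  exact ⟨c, fun a i hi => (Nat.mul_le_mul_left _ hi).trans (hc a)⟩

/-- Recursion along `c a`: the initial value is `f a`, and any step at all overwrites it with `g a`.
-/
theorem Cmp.ite_zero {c f g : α → ℕ} (hc : Cmp sz Γ c) (hf : Cmp sz Γ f) (hg : Cmp sz Γ g) :
    Cmp sz Γ fun a => if c a = 0 then f a else g a := by
  refine Cmp.prec (fun a i => if i = 0 then f a else g a) hc (hf.congr fun a => (if_pos rfl).symm)
    (fun hΓ => ?_) fun hΓ => (hg.lift hΓ).congr fun q => (if_neg (Nat.succ_ne_zero _)).symm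
  obtain ⟨c, hc⟩ := (hf.polyBdd hΓ).add (hg.polyBdd hΓ)
  refine ⟨c, fun a i _ => le_trans ?_ (hc a)⟩
  dsimp only
  split_ifs <;> omega

open Classical in
/-- The predicate `P` can be decided. -/
def CmpP (sz : α → ℕ) (Γ : Set (α → ℕ)) (P : α → Prop) : Prop :=
  Cmp sz Γ fun a => if P a then 0 else 1

theorem CmpP.congr {P Q : α → Prop} (h : CmpP sz Γ P) (hPQ : ∀ a, P a ↔ Q a) : CmpP sz Γ Q := by
  rwa [← funext fun a => propext (hPQ a)]

theorem Cmp.ite {P : α → Prop} [DecidablePred P] {f g : α → ℕ} (hP : CmpP sz Γ P)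
    (hf : Cmp sz Γ f) (hg : Cmp sz Γ g) : Cmp sz Γ fun a => if P a then f a else g a := by
  refine (Cmp.ite_zero hP hf hg).congr fun a => ?_
  by_cases h : P a <;> simp [h]

theorem CmpP.of_zero {c : α → ℕ} (hc : Cmp sz Γ c) : CmpP sz Γ fun a => c a = 0 := by
  refine (Cmp.ite_zero hc (Cmp.const 0) (Cmp.const 1)).congr fun a => ?_
  by_cases h : c a = 0 <;> simp [h]

theorem CmpP.not {P : α → Prop} (hP : CmpP sz Γ P) : CmpP sz Γ fun a => ¬ P a := by
  classical
  refine (Cmp.ite hP (Cmp.const 1) (Cmp.const 0)).congr fun a => ?_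
  by_cases h : P a <;> simp [h]

theorem CmpP.and {P Q : α → Prop} (hP : CmpP sz Γ P) (hQ : CmpP sz Γ Q) :
    CmpP sz Γ fun a => P a ∧ Q a := by
  classical
  refine (Cmp.ite hP hQ (Cmp.const 1)).congr fun a => ?_
  by_cases h : P a <;> by_cases h' : Q a <;> simp [h, h']

theorem CmpP.or {P Q : α → Prop} (hP : CmpP sz Γ P) (hQ : CmpP sz Γ Q) :
    CmpP sz Γ fun a => P a ∨ Q a := by
  classical
  refine (Cmp.ite hP (Cmp.const 0) hQ).congr fun a => ?_
  by_cases h : P a <;> by_cases h' : Q a <;> simp [h, h']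

theorem CmpP.const (P : Prop) : CmpP sz Γ fun _ => P := by
  by_cases h : P
  · exact (Cmp.const 0).congr fun a => by simp [h]
  · exact (Cmp.const 1).congr fun a => by simp [h]

theorem CmpP.le {f g : α → ℕ} (hf : Cmp sz Γ f) (hg : Cmp sz Γ g) :
    CmpP sz Γ fun a => f a ≤ g a :=
  (CmpP.of_zero (hf.sub hg)).congr fun _ => Nat.sub_eq_zero_iff_le

theorem CmpP.lt {f g : α → ℕ} (hf : Cmp sz Γ f) (hg : Cmp sz Γ g) :
    CmpP sz Γ fun a => f a < g a :=
  CmpP.le hf.succ hg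

theorem CmpP.eq {f g : α → ℕ} (hf : Cmp sz Γ f) (hg : Cmp sz Γ g) :
    CmpP sz Γ fun a => f a = g a :=
  ((CmpP.le hf hg).and (CmpP.le hg hf)).congr fun _ => le_antisymm_iff.symm

/-- A candidate quotient is raised `f a` times, each time only if its successor times `g a` does not
exceed `f a`; after `i` steps it is `min i (f a / g a)`. The extra test `0 < g a` keeps it at `0`
for division by zero. -/
theorem Cmp.div {f g : α → ℕ} (hf : Cmp sz Γ f) (hg : Cmp sz Γ g) :
    Cmp sz Γ fun a => f a / g a := by
  have h : Cmp sz Γ fun a => min (f a) (f a / g a) := by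
    refine Cmp.prec (fun a i => min i (f a / g a)) hf (Cmp.zero.congr fun a => by simp)
      (fun hΓ => ?_) fun hΓ => ?_
    · obtain ⟨c, hc⟩ := hf.polyBdd hΓ
      exact ⟨c, fun a i hi => (min_le_left _ _).trans (hi.trans (hc a))⟩
    · have hacc := Cmp.acc (sz := sz) (Γ := Γ) (t := f) fun a i => min i (f a / g a)
      refine (Cmp.ite ((CmpP.le (hacc.succ.mul (hg.lift hΓ)) (hf.lift hΓ)).and
        (CmpP.lt (Cmp.const 0) (hg.lift hΓ))) hacc.succ hacc).congr fun q => ?_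
      obtain ⟨a, i⟩ := q
      dsimp only
      rcases Nat.eq_zero_or_pos (g a) with h0 | h0
      · simp [h0]
      · simp only [h0, and_true, ← Nat.le_div_iff_mul_le h0]
        split_ifs <;> omega
  exact h.congr fun a => min_eq_right (Nat.div_le_self _ _)

theorem Cmp.mod {f g : α → ℕ} (hf : Cmp sz Γ f) (hg : Cmp sz Γ g) :
    Cmp sz Γ fun a => f a % g a :=
  (hf.sub (hg.mul (hf.div hg))).congr fun _ => (Nat.mod_eq_sub _ _).symm

/-- Powers of two are not polynomially bounded in general, hence the hypothesis `hb`. In the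
applications the exponent is at most a ceiling logarithm, and `two_pow_clog_le` provides the bound.
-/
theorem Cmp.two_pow {f : α → ℕ} (hf : Cmp sz Γ f)
    (hb : (∀ g ∈ Γ, PolyBdd sz g) → PolyBdd sz fun a => 2 ^ f a) :
    Cmp sz Γ fun a => 2 ^ f a := by
  refine Cmp.prec (fun _ i => 2 ^ i) hf (Cmp.const 1) (fun hΓ => ?_)
    fun _ => ((Cmp.acc fun _ i => 2 ^ i).mul (Cmp.const 2)).congr fun q => (pow_succ _ _).symm
  obtain ⟨c, hc⟩ := hb hΓ
  exact ⟨c, fun a i hi => (Nat.pow_le_pow_right (by norm_num) hi).trans (hc a)⟩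

theorem two_pow_clog_le (n : ℕ) : 2 ^ Nat.clog 2 n ≤ 2 * n + 1 := by
  rcases Nat.lt_or_ge n 2 with h | h
  · interval_cases n <;> simp
  · have := Nat.pow_pred_clog_lt_self (b := 2) (by norm_num) (x := n) (by omega)
    have hpos : 0 < Nat.clog 2 n := Nat.clog_pos (by norm_num) h
    obtain ⟨m, hm⟩ : ∃ m, Nat.clog 2 n = m + 1 := ⟨Nat.clog 2 n - 1, by omega⟩
    rw [hm] at this ⊢
    rw [pow_succ]
    simp at this
    omega

/-- The exponent is raised as long as its power of two is below `f a`; capping it at the logarithm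
keeps all the powers that are tested polynomial. -/
theorem Cmp.clog {f : α → ℕ} (hf : Cmp sz Γ f) : Cmp sz Γ fun a => Nat.clog 2 (f a) := by
  have hle : ∀ n, Nat.clog 2 n ≤ n := fun n =>
    Nat.clog_le_of_le_pow (Nat.lt_two_pow_self).le
  have h : Cmp sz Γ fun a => min (f a) (Nat.clog 2 (f a)) := by
    refine Cmp.prec (fun a i => min i (Nat.clog 2 (f a))) hf (Cmp.zero.congr fun a => by simp)
      (fun hΓ => ?_) fun hΓ => ?_
    · obtain ⟨c, hc⟩ := hf.polyBdd hΓ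
      exact ⟨c, fun a i hi => (min_le_left _ _).trans (hi.trans (hc a))⟩
    · have hacc := Cmp.acc (sz := sz) (Γ := Γ) (t := f) fun a i => min i (Nat.clog 2 (f a))
      have hb : PolyBdd (fun q : Σ a, Fin (f a) => sz q.1)
          fun q => 2 ^ min q.2.val (Nat.clog 2 (f q.1)) := by
        have h1 := (((PolyBdd.const sz 2).mul (hf.polyBdd hΓ)).add (PolyBdd.const sz 1)).lift f
        exact h1.of_le fun q => (Nat.pow_le_pow_right (by norm_num) (min_le_right _ _)).trans
          (two_pow_clog_le _)
      refine (Cmp.ite (CmpP.lt (hacc.two_pow fun _ => hb) (hf.lift hΓ)) hacc.succ hacc).congr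
        fun q => ?_
      obtain ⟨a, i⟩ := q
      dsimp only
      simp only [← Nat.lt_clog_iff_pow_lt (b := 2) (by norm_num)]
      split_ifs <;> omega
  exact h.congr fun a => min_eq_right (hle _)

theorem Emits.lift {f : α → List Bool} (hΓ : ∀ g ∈ Γ, PolyBdd sz g) (hf : Emits sz Γ f) {t : α → ℕ}
    {Δ : Set ((Σ a, Fin (t a)) → ℕ)} :
    Emits (fun q : Σ a, Fin (t a) => sz q.1) (LPT.lift t Γ Δ) fun q => f q.1 := by
  intro _ h loc hloc
  obtain ⟨p, k, c, hp⟩ := hf hΓ h (fun g => loc fun q => g q.1)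
    (fun g hg => hloc _ (Or.inl ⟨g, hg, rfl⟩))
  exact ⟨p, k, c, fun q x σ hσ => hp q.1 x σ fun g hg => hσ _ (Or.inl ⟨g, hg, rfl⟩)⟩

/-- Two consecutive loops, of which one runs once and the other not at all. -/
theorem Emits.ite {P : α → Prop} [DecidablePred P] {f g : α → List Bool} (hP : CmpP sz Γ P)
    (hf : Emits sz Γ f) (hg : Emits sz Γ g) : Emits sz Γ fun a => if P a then f a else g a := by
  refine ((Emits.range (g := fun a _ => f a) (Cmp.ite hP (Cmp.const 1) (Cmp.const 0))
    fun hΓ => hf.lift hΓ).append (Emits.range (g := fun a _ => g a)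
      (Cmp.ite hP (Cmp.const 0) (Cmp.const 1)) fun hΓ => hg.lift hΓ)).congr fun a => ?_
  by_cases h : P a <;> simp [h]

/-- A finite control can hard-wire `K` alternatives when `K` does not depend on the input. This is
how arbitrary tables of weights get into the programs. -/
theorem Emits.table {f : α → ℕ} {g : ℕ → α → List Bool} (K : ℕ) (hf : Cmp sz Γ f)
    (hK : ∀ a, f a < K) (hg : ∀ c < K, Emits sz Γ (g c)) : Emits sz Γ fun a => g (f a) a := by
  have key : ∀ n ≤ K, Emits sz Γ fun a => if f a < n then g (f a) a else [] := by
    intro n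
    induction n with
    | zero => exact fun _ => Emits.nil.congr fun a => by simp
    | succ n ih =>
      intro hn
      refine (Emits.ite (CmpP.eq hf (Cmp.const n)) (hg n (by omega)) (ih (by omega))).congr
        fun a => ?_
      by_cases h : f a = n
      · simp [h]
      · simp only [h, if_false]
        split_ifs <;> first | rfl | omega
  exact (key K le_rfl).congr fun a => if_pos (hK a)

theorem Emits.unary {f : α → ℕ} (hf : Cmp sz Γ f) : Emits sz Γ fun a => LPT.unary (f a) := by
  refine ((Emits.range (g := fun _ _ => [true]) hf fun _ => Emits.const _).append
    (Emits.const [false])).congr fun a => ?_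
  rw [LPT.unary]
  congr 1
  induction f a with
  | zero => rfl
  | succ n ih => rw [List.range_succ, List.flatMap_append, ih, List.replicate_succ']; rfl

end Computable

/-- A function of the counters that an input program provides is logspace computable. -/
theorem logspaceComputable_of_emits {ι : Type} {x : ι → List (Option Bool)} {y : ι → List Bool}
    {h : ℕ} (v : ℕ → ι → ℕ) (hv : ∀ i < h, PolyBdd (fun a => (x a).length) (v i)) (p : CProg)
    (k c : ℕ)
    (hp : ∀ a, ∃ σ, Exec k (((x a).length + 2) ^ c) (x a) p CState.init σ ∧ σ.out = [] ∧
      ∀ i < h, σ.regs i = v i a)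
    (hy : Emits (fun a => (x a).length) {g | ∃ i < h, v i = g} y) : LogspaceComputable x y := by
  classical
  let loc : (ι → ℕ) → ℕ := fun g => if hg : ∃ i < h, v i = g then hg.choose else 0
  have hloc : ∀ g ∈ {g | ∃ i < h, v i = g}, loc g < h ∧ v (loc g) = g := by
    intro g hg
    have hg' : ∃ i < h, v i = g := hg
    simp only [loc, dif_pos hg']
    exact hg'.choose_spec
  obtain ⟨q, k', c', hq⟩ := hy (by rintro g ⟨i, hi, rfl⟩; exact hv i hi) h loc
    fun g hg => (hloc g hg).1
  refine logspaceComputable_of_exec (.seq p q) (max k k') (max c c') fun a => ?_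
  obtain ⟨σ, e, ho, hr⟩ := hp a
  obtain ⟨σ', e', -, ho'⟩ := hq a (x a) σ fun g hg => by
    rw [hr _ (hloc g hg).1, (hloc g hg).2]
  exact ⟨σ', (e.mono (le_max_left _ _) (pow_le_of_le (le_max_left _ _))).seq
    (e'.mono (le_max_right _ _) (pow_le_of_le (le_max_right _ _))), by rw [ho', ho, List.nil_append]⟩

/-! ### The transformer

The coordinates are divided into `W = ⌈log₂ N⌉ + 1` slices of `46` coordinates. Slice `l` holds `23`
channels; channel `c` occupies the coordinate `2 * c` of the slice, and the coordinate `2 * c + 1` is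
its shadow, which receives the negative of everything that is added to the channel. -/

/-- The number `z / 2`, clipped to the range of `Fx 1`. -/
def ofMant (z : ℤ) : Fx 1 :=
  ⟨max (-3) (min 3 z), by
    have : (2 : ℕ) ^ (2 * 1) = 4 := by norm_num
    omega⟩

/-- A vector that is the same in all slices. -/
def sliceVec (D : ℕ) (v : ℕ → ℤ) : Fin D → Fx 1 := fun d => ofMant (v (d % 46))

/-- A block-diagonal matrix with the same block for all slices. -/
def sliceMat (D : ℕ) (w : ℕ → ℕ → ℤ) : Matrix (Fin D) (Fin D) (Fx 1) := fun d e =>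
  ofMant (if d.val / 46 = e.val / 46 then w (d % 46) (e % 46) else 0)

/-- Boolean functions computed by the feed-forward networks. -/
inductive Gate
  | none
  | and (a b : ℕ)
  | not (a : ℕ)

/-- Specification of a layer: position `i` attends to the positions `j` such that for no slice and no
pair `(a, b)` in `att`, channel `a` of `i` and channel `b` of `j` are both active; channel `c` receives
channel `val c`, and afterwards the result of `gate c`. -/
structure LayerSpec where
  att : List (ℕ × ℕ)
  val : ℕ → Option ℕ
  gate : ℕ → Gate

namespace LayerSpec

variable (s : LayerSpec)

/-- Query and key coordinate `e` of a slice belong to the `e`-th pair of `att`. The weights `3/2`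
and `-3/2` have opposite signs, so a pair that is active on both sides lowers the score and all
other pairs contribute zero. -/
def wq (r e : ℕ) : ℤ := match s.att[e]? with
  | some p => if r = 2 * p.1 then 3 else 0
  | none => 0

def wk (r e : ℕ) : ℤ := match s.att[e]? with
  | some p => if r = 2 * p.2 then -3 else 0
  | none => 0

def wv (r e : ℕ) : ℤ := match s.val (e / 2) with
  | some c => if r = 2 * c then (if e % 2 = 0 then 2 else -2) else 0
  | none => 0

/-- Conjunction: the constant channel has the value `1` and contributes `-3/2`, and an active input
contributes `1` or `3/2` after rounding. One active input leaves at most `0`, two leave at least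
`1/2`. Negation: an active input contributes at most `-1`, which cancels the bias `1`. -/
def w₁ (r e : ℕ) : ℤ := match s.gate e with
  | .none => 0
  | .and a b => if r = 0 then -3 else if r = 2 * a ∨ r = 2 * b then 3 else 0
  | .not a => if r = 2 * a then -3 else 0

def c₁ (e : ℕ) : ℤ := match s.gate e with
  | .not _ => 2
  | _ => 0

end LayerSpec

def shadowW₂ (r e : ℕ) : ℤ := if r = e / 2 then (if e % 2 = 0 then 2 else -2) else 0

/-- Layer normalization of the pairs of a channel and its shadow. -/
def pairNorm (D : ℕ) : LayerNorm 1 D where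
  part := fun d => ⟨d.val / 2, (Nat.div_le_self _ _).trans_lt d.isLt⟩
  gain := sliceVec D fun _ => 2
  bias := sliceVec D fun _ => 0
  eps := ofMant 1
  eps_nonneg := by decide

def LayerSpec.layer (D : ℕ) (s : LayerSpec) : Layer 1 D D where
  causal := false
  WQ := sliceMat D s.wq
  WK := sliceMat D s.wk
  WV := sliceMat D s.wv
  norm₁ := pairNorm D
  W₁ := sliceMat D s.w₁
  c₁ := sliceVec D s.c₁
  W₂ := sliceMat D shadowW₂
  c₂ := sliceVec D fun _ => 0
  norm₂ := pairNorm D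

/-! Channels: `0` constant; `1`–`6` the bits, and their complements, of three vertices `i, j, k`
attached to the position; `7` not an adjacency position; `8` not a padding position; `9`, `10` the
positions of the digits of `s` and `t`; `11` the symbol `1`; `12` reachability of `j` from `i`; `13`
reachability of `k` from `i`; `14` reachability of `j` from `k`; `15` both; `16`, `17` the digits of `s`
and `t` at their positions; `18`–`21` the bits, and their complements, of `s` and `t`; `22` the
answer. -/

/-- Lookup of the adjacency matrix. -/
def specEdge : LayerSpec where
  att := [(1, 2), (2, 1), (3, 4), (4, 3), (0, 7)]
  val := fun c => if c = 12 then some 11 else none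
  gate := fun c => if c = 16 then .and 9 11 else if c = 17 then .and 10 11 else .none

/-- Collecting the digits of `s` and `t`. -/
def specGather : LayerSpec where
  att := []
  val := fun c => if c = 18 then some 16 else if c = 20 then some 17 else none
  gate := fun c => if c = 19 then .not 18 else if c = 21 then .not 20 else .none

/-- Lookup of the entry `(i, k)`. -/
def specLeft : LayerSpec where
  att := [(1, 2), (2, 1), (5, 4), (6, 3), (0, 8)]
  val := fun c => if c = 13 then some 12 else none
  gate := fun _ => .none

/-- Lookup of the entry `(k, j)`. -/
def specRight : LayerSpec where
  att := [(5, 2), (6, 1), (3, 4), (4, 3), (0, 8)]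
  val := fun c => if c = 14 then some 12 else none
  gate := fun c => if c = 15 then .and 13 14 else .none

/-- Disjunction over `k`. -/
def specJoin : LayerSpec where
  att := [(1, 2), (2, 1), (3, 4), (4, 3), (0, 8)]
  val := fun c => if c = 12 then some 15 else none
  gate := fun _ => .none

/-- Lookup of the entry `(s, t)`. -/
def specAnswer : LayerSpec where
  att := [(18, 2), (19, 1), (20, 4), (21, 3), (0, 8)]
  val := fun c => if c = 22 then some 12 else none
  gate := fun _ => .none

section Positions

variable (N p : ℕ)

/-- Position `p` holds an entry of the adjacency matrix. -/
def IsAdj : Prop := p < N * N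

/-- Position `p` holds a padding symbol. -/
def IsPad : Prop := N * N ≤ p ∧ p < N * N + N * N * N

/-- The vertex `i` of position `p`. -/
def vertI : ℕ := if p < N * N then p / N else (p - N * N) / (N * N)

/-- The vertex `j` of position `p`. -/
def vertJ : ℕ := if p < N * N then p % N else (p - N * N) / N % N

/-- The vertex `k` of position `p`. -/
def vertK : ℕ := (p - N * N) % N

/-- Bit `l` of `v` is set. -/
def HasBit (v l : ℕ) : Prop := v / 2 ^ l % 2 = 1

/-- The channels that are active in slice `l` of the positional encoding. -/
def posActive (l : ℕ) : ℕ → Prop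
  | 0 => True
  | 1 => (IsAdj N p ∨ IsPad N p) ∧ HasBit (vertI N p) l
  | 2 => (IsAdj N p ∨ IsPad N p) ∧ ¬ HasBit (vertI N p) l
  | 3 => (IsAdj N p ∨ IsPad N p) ∧ HasBit (vertJ N p) l
  | 4 => (IsAdj N p ∨ IsPad N p) ∧ ¬ HasBit (vertJ N p) l
  | 5 => IsPad N p ∧ HasBit (vertK N p) l
  | 6 => IsPad N p ∧ ¬ HasBit (vertK N p) l
  | 7 => ¬ IsAdj N p
  | 8 => ¬ IsPad N p
  | 9 => N * N + N * N * N ≤ p ∧ p + l = N * N + N * N * N + Nat.clog 2 N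
  | 10 => N * N + N * N * N ≤ p ∧ p + l = N * N + N * N * N + (2 * Nat.clog 2 N + 1)
  | 12 => IsPad N p ∧ vertI N p = vertJ N p
  | _ => False

open Classical in
/-- The positional encoding at coordinate `d`. -/
def posMant (d : ℕ) : ℤ :=
  if d % 46 % 2 = 0 ∧ posActive N p (d / 46) (d % 46 / 2) then 2 else 0

end Positions

def width (N : ℕ) : ℕ := (Nat.clog 2 N + 1) * 46

/-- The transformer for graphs with `N` vertices. -/
def connTransformer (N : ℕ) : LoopedTransformer where
  b := 1
  D := width N
  F := width N
  tau := ofMant 1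
  tau_pos := by decide
  embed := fun t => sliceVec (width N) fun r => match t with
    | .one => if r = 22 then 2 else 0
    | _ => 0
  pe := fun p d => ofMant (posMant N p d)
  pre := [specEdge.layer (width N), specGather.layer (width N)]
  pre_ne := by simp
  block := [specLeft.layer (width N), specRight.layer (width N), specJoin.layer (width N)]
  post := [specAnswer.layer (width N)]
  loops := Nat.clog 2 N
  outW := sliceVec (width N) fun r => if r = 44 then 2 else 0
  outC := ofMant 0

/-! ### Uniformity -/

theorem flatMap_finRange {β : Type} (n : ℕ) (f : ℕ → List β) :
    ((List.finRange n).flatMap fun i => f i.val) = (List.range n).flatMap f := by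
  rw [← List.map_coe_finRange_eq_range, List.flatMap_map]

section

variable {α : Type} {sz : α → ℕ} {Γ : Set (α → ℕ)} {D : α → ℕ}

theorem Cmp.index {t : α → ℕ} :
    Cmp (fun q : Σ a, Fin (t a) => sz q.1) (LPT.lift t Γ {LPT.idx t}) fun q => q.2 :=
  Cmp.idx (Set.mem_singleton _)

theorem Emits.sliceVec (hD : Cmp sz Γ D) (v : ℕ → ℤ) :
    Emits sz Γ fun a => vecCode (LPT.sliceVec (D a) v) := by
  refine (Emits.range (g := fun _ d => (ofMant (v (d % 46))).code) hD fun _ => ?_).congr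
    fun a => (flatMap_finRange (D a) fun d => (ofMant (v (d % 46))).code).symm
  exact Emits.table (g := fun r _ => (ofMant (v r)).code) 46
    (Cmp.index.mod (Cmp.const 46)) (fun q => Nat.mod_lt _ (by norm_num))
    fun r _ => Emits.const _

/-- An entry depends only on whether the two slices agree and on two residues modulo `46`, so a
fixed table of constants suffices for all widths. -/
theorem Emits.sliceMat (hD : Cmp sz Γ D) (w : ℕ → ℕ → ℤ) :
    Emits sz Γ fun a => matCode (LPT.sliceMat (D a) w) := by
  have e : ∀ a, matCode (LPT.sliceMat (D a) w) = (List.range (D a)).flatMap fun d =>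
      (List.range (D a)).flatMap fun e =>
        if d / 46 = e / 46 then (ofMant (w (d % 46) (e % 46))).code else (ofMant 0).code := by
    intro a
    rw [matCode, ← flatMap_finRange]
    congr 1
    funext d
    rw [vecCode, ← flatMap_finRange]
    congr 1
    funext e
    rw [LPT.sliceMat]
    split_ifs <;> rfl
  refine (Emits.range hD fun hΓ => ?_).congr fun a => (e a).symm
  refine Emits.range (t := fun q : Σ a, Fin (D a) => D q.1) (hD.lift hΓ) fun hΓ' => ?_
  have hd : Cmp (fun q : Σ q : Σ a, Fin (D a), Fin (D q.1) => sz q.1.1)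
      (LPT.lift (fun q : Σ a, Fin (D a) => D q.1) (LPT.lift D Γ {idx D}) {idx _})
      fun q => q.1.2 := Cmp.lift hΓ' (Cmp.index (sz := sz) (Γ := Γ) (t := D))
  have he : Cmp (fun q : Σ q : Σ a, Fin (D a), Fin (D q.1) => sz q.1.1)
      (LPT.lift (fun q : Σ a, Fin (D a) => D q.1) (LPT.lift D Γ {idx D}) {idx _})
      fun q => q.2 := Cmp.index (sz := fun q : Σ a, Fin (D a) => sz q.1)
  refine Emits.ite (CmpP.eq (hd.div (Cmp.const 46)) (he.div (Cmp.const 46))) ?_ (Emits.const _)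
  exact Emits.table (f := fun q : Σ q : Σ a, Fin (D a), Fin (D q.1) => q.1.2.val % 46)
    (g := fun r q => (ofMant (w r (q.2.val % 46))).code) 46
    (hd.mod (Cmp.const 46)) (fun q => Nat.mod_lt _ (by norm_num)) fun r _ =>
      Emits.table (f := fun q : Σ q : Σ a, Fin (D a), Fin (D q.1) => q.2.val % 46)
        (g := fun r' _ => (ofMant (w r r')).code) 46 (he.mod (Cmp.const 46))
        (fun q => Nat.mod_lt _ (by norm_num)) fun r' _ => Emits.const _

theorem Emits.pairNorm (hD : Cmp sz Γ D) : Emits sz Γ fun a => (LPT.pairNorm (D a)).code := by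
  refine (((Emits.range (g := fun _ d => LPT.unary (d / 2)) hD fun _ => ?_).congr fun a =>
    (flatMap_finRange (D a) fun d => LPT.unary (d / 2)).symm).append (Emits.sliceVec hD _)).append
      (Emits.sliceVec hD _) |>.append (Emits.const (ofMant 1).code)
  exact Emits.unary (Cmp.index.div (Cmp.const 2))

theorem Emits.layer (hD : Cmp sz Γ D) (s : LayerSpec) :
    Emits sz Γ fun a => (s.layer (D a)).code :=
  (Emits.single false).append
    ((((((((((Emits.sliceMat hD s.wq).append (Emits.sliceMat hD s.wk)).append
      (Emits.sliceMat hD s.wv)).append (Emits.pairNorm hD)).append (Emits.sliceMat hD s.w₁)).append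
      (Emits.sliceVec hD s.c₁)).append (Emits.sliceMat hD shadowW₂)).append
      (Emits.sliceVec hD fun _ => 0)).append (Emits.pairNorm hD)))

theorem Emits.transformer {N : α → ℕ} (hN : Cmp sz Γ N) :
    Emits sz Γ fun a => (connTransformer (N a)).code := by
  have hL := hN.clog
  have hD : Cmp sz Γ fun a => width (N a) := hL.succ.mul (Cmp.const 46)
  have hlayers : Emits sz Γ fun a => ((connTransformer (N a)).pre ++ (connTransformer (N a)).block ++
      (connTransformer (N a)).post).flatMap Layer.code := by
    refine ((Emits.layer hD specEdge).append ((Emits.layer hD specGather).append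
      ((Emits.layer hD specLeft).append ((Emits.layer hD specRight).append
        ((Emits.layer hD specJoin).append ((Emits.layer hD specAnswer).append
          Emits.nil)))))).congr fun a => rfl
  exact (((((((((((((((Emits.const (LPT.unary 1)).append (Emits.unary hD)).append (Emits.unary hD)).append
    (Emits.const (LPT.unary 2))).append (Emits.const (LPT.unary 3))).append (Emits.const (LPT.unary 1))).append
    (Emits.unary hL)).append (Emits.const (ofMant 1).code)).append (Emits.sliceVec hD _)).append
    (Emits.sliceVec hD _)).append (Emits.sliceVec hD _)).append (Emits.sliceVec hD _)).append
    hlayers).append (Emits.sliceVec hD _)).append (Emits.const (ofMant 0).code))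

theorem CmpP.hasBit {f g : α → ℕ} (hf : Cmp sz Γ f) (hg : Cmp sz Γ g)
    (hb : PolyBdd sz fun a => 2 ^ g a) : CmpP sz Γ fun a => HasBit (f a) (g a) :=
  CmpP.eq ((hf.div (hg.two_pow fun _ => hb)).mod (Cmp.const 2)) (Cmp.const 1)

theorem CmpP.posActive {N p l : α → ℕ} (hN : Cmp sz Γ N) (hp : Cmp sz Γ p) (hl : Cmp sz Γ l)
    (hb : PolyBdd sz fun a => 2 ^ l a) (c : ℕ) (hc : c < 23) :
    CmpP sz Γ fun a => LPT.posActive (N a) (p a) (l a) c := by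
  have hNN := hN.mul hN
  have hT := hNN.add (hNN.mul hN)
  have hA : CmpP sz Γ fun a => IsAdj (N a) (p a) := CmpP.lt hp hNN
  have hP : CmpP sz Γ fun a => IsPad (N a) (p a) := (CmpP.le hNN hp).and (CmpP.lt hp hT)
  have hI : Cmp sz Γ fun a => vertI (N a) (p a) :=
    Cmp.ite hA (hp.div hN) ((hp.sub hNN).div hNN)
  have hJ : Cmp sz Γ fun a => vertJ (N a) (p a) :=
    Cmp.ite hA (hp.mod hN) (((hp.sub hNN).div hN).mod hN)
  have hK : Cmp sz Γ fun a => vertK (N a) (p a) := (hp.sub hNN).mod hN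
  interval_cases c
  · exact CmpP.const True
  · exact (hA.or hP).and (CmpP.hasBit hI hl hb)
  · exact (hA.or hP).and (CmpP.hasBit hI hl hb).not
  · exact (hA.or hP).and (CmpP.hasBit hJ hl hb)
  · exact (hA.or hP).and (CmpP.hasBit hJ hl hb).not
  · exact hP.and (CmpP.hasBit hK hl hb)
  · exact hP.and (CmpP.hasBit hK hl hb).not
  · exact hA.not
  · exact hP.not
  · exact (CmpP.le hT hp).and (CmpP.eq (hp.add hl) (hT.add hN.clog))
  · exact (CmpP.le hT hp).and
      (CmpP.eq (hp.add hl) (hT.add (((Cmp.const 2).mul hN.clog).add (Cmp.const 1))))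
  · exact CmpP.const False
  · exact hP.and (CmpP.eq hI hJ)
  all_goals exact CmpP.const False

theorem Emits.posEncoding {N p : α → ℕ} (hN : Cmp sz Γ N) (hp : Cmp sz Γ p) :
    Emits sz Γ fun a => vecCode ((connTransformer (N a)).pe (p a)) := by
  classical
  have hD : Cmp sz Γ fun a => width (N a) := hN.clog.succ.mul (Cmp.const 46)
  refine (Emits.range (g := fun a d => (ofMant (posMant (N a) (p a) d)).code) hD fun hΓ => ?_).congr
    fun a => (flatMap_finRange (width (N a)) fun d => (ofMant (posMant (N a) (p a) d)).code).symm
  have hd := Cmp.index (sz := sz) (Γ := Γ) (t := fun a => width (N a))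
  refine (Emits.table (f := fun q : Σ a, Fin (width (N a)) => q.2.val % 46)
    (g := fun r q => if r % 2 = 0 ∧ LPT.posActive (N q.1) (p q.1) (q.2.val / 46) (r / 2) then
      (ofMant 2).code else (ofMant 0).code) 46 (hd.mod (Cmp.const 46))
      (fun q => Nat.mod_lt _ (by norm_num)) fun r hr => ?_).congr fun q => ?_
  · refine Emits.ite ((CmpP.const _).and (CmpP.posActive (hN.lift hΓ) (hp.lift hΓ)
      (hd.div (Cmp.const 46)) ?_ (r / 2) (by omega))) (Emits.const _) (Emits.const _)
    have h1 := (((PolyBdd.const sz 2).mul (hN.polyBdd hΓ)).add (PolyBdd.const sz 1)).lift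
      fun a => width (N a)
    refine h1.of_le fun q => le_trans ?_ (two_pow_clog_le (N q.1))
    -- The slice of a coordinate below `width` has index at most `Nat.clog 2 N`, so the power of two
    -- in the bit test is at most `2 * N + 1`.
    refine Nat.pow_le_pow_right (by norm_num) ?_
    have : q.2.val < (Nat.clog 2 (N q.1) + 1) * 46 := q.2.isLt
    omega
  · dsimp only [posMant]
    split_ifs <;> rfl

end

/-! ### Reading the inputs `1^N` and `(1^N, B(n))` into counters -/

def isOne : InSym (Option Bool) → Bool
  | .sym (some true) => true
  | _ => false

def isBit : InSym (Option Bool) → Bool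
  | .sym (some _) => true
  | _ => false

/-- Count the leading ones of the input in counter `0`. -/
def readOnes : CProg := .seq .next (.whileIn isOne (.seq (.inc 0) .next))

theorem exec_readOnes {k B N : ℕ} {x rest : List (Option Bool)} (hx : x = ones N ++ rest)
    (hrest : isOne (Machine.readIn x (N + 1)) = false) (hB : N ≤ B) (hk : 0 < k) :
    ∃ σ, Exec k B x readOnes CState.init σ ∧ σ.regs 0 = N ∧ (∀ j, j ≠ 0 → σ.regs j = 0) ∧
      σ.inHead = N + 1 ∧ σ.out = [] := by
  have hlen : N ≤ x.length := by simp [hx, ones]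
  obtain ⟨σ, h1, h2⟩ := Exec.while_inv (k := k) (B := B) (x := x) (c := isOne)
    (p := .seq (.inc 0) .next)
    (fun i s => s.regs 0 = i ∧ (∀ j, j ≠ 0 → s.regs j = 0) ∧ s.inHead = i + 1 ∧ s.out = [])
    (σ := { CState.init with inHead := Machine.moveIn x CState.init.inHead .right }) N
    ⟨rfl, fun _ _ => rfl, by simp [CState.init, Machine.moveIn], rfl⟩
    (by
      rintro i hi s ⟨-, -, h, -⟩
      have : x[i]? = some (some true) := by
        rw [hx, List.getElem?_append_left (by simpa [ones] using hi)]
        simp [ones, hi]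
      simp only [h, Machine.readIn, this, isOne])
    (by
      rintro s ⟨-, -, h, -⟩
      rw [h, hrest])
    (by
      rintro i hi s ⟨j1, j2, j3, j4⟩
      refine ⟨_, Exec.seq (Exec.inc _ 0 hk (by omega)) (Exec.next _), ?_, ?_, ?_, j4⟩
      · simp [CState.set, j1]
      · intro j hj
        simp [CState.set, hj, j2 j hj]
      · simp only [CState.set, Machine.moveIn, j3]
        omega)
  exact ⟨σ, (Exec.next _).seq h1, h2⟩

theorem computable_code :
    LogspaceComputable (fun N : ℕ => ones N) (fun N => (connTransformer N).code) := by
  refine logspaceComputable_of_emits (h := 1) (fun _ N => N) ?_ readOnes 1 1 ?_ ?_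
  · intro _ _
    exact ⟨1, fun N => by simp [ones]⟩
  · intro N
    obtain ⟨σ, h1, h2, -, -, h3⟩ := exec_readOnes (k := 1) (B := ((ones N).length + 2) ^ 1)
      (x := ones N) (rest := []) (N := N) (by simp)
      (by simp [Machine.readIn, ones, isOne]) (by simp [ones]) one_pos
    exact ⟨σ, h1, h3, fun i hi => by rw [Nat.lt_one_iff.1 hi, h2]⟩
  · exact Emits.transformer (Cmp.var ⟨0, one_pos, rfl⟩)

/-- Read a binary number into counter `1`, using counter `2`. -/
def readBits : CProg :=
  .seq .next (.whileIn isBit (.seq (.loop 1 (.seq (.inc 2) (.inc 2)))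
    (.seq (.loop 2 (.inc 1)) (.seq (.ifIn isOne (.inc 1)) .next))))

theorem div_two_pow_succ (n m : ℕ) :
    n / 2 ^ m = 2 * (n / 2 ^ (m + 1)) + (n.testBit m).toNat := by
  rw [Nat.toNat_testBit, pow_succ, ← Nat.div_div_eq_div_mul]
  omega

theorem exec_double {k B : ℕ} {x : List (Option Bool)} (hk : 3 ≤ k) (σ : CState)
    (h2 : σ.regs 2 = 0) (hB : 2 * σ.regs 1 ≤ B) :
    Exec k B x (.seq (.loop 1 (.seq (.inc 2) (.inc 2))) (.loop 2 (.inc 1))) σ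
      (σ.set 1 (2 * σ.regs 1)) := by
  obtain ⟨s', e1, rfl, -⟩ := Exec.loop_inv (k := k) (B := B) (x := x)
    (p := .seq (.inc 2) (.inc 2)) (r := 1) (by omega)
    (fun i s => s = (σ.set 1 (σ.regs 1 - i)).set 2 (2 * i)) (σ := σ) (n := σ.regs 1) rfl
    (by
      rw [Nat.sub_zero, CState.set_self, Nat.mul_zero, ← h2, CState.set_self])
    (by
      rintro i hi s rfl -
      have e : ((σ.set 1 (σ.regs 1 - i)).set 2 (2 * i)).set 1 (σ.regs 1 - i - 1) =
          (σ.set 1 (σ.regs 1 - (i + 1))).set 2 (2 * i) := by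
        simp only [CState.set, CState.mk.injEq, and_true]
        rw [Function.update_comm (by norm_num : (2 : ℕ) ≠ 1), Function.update_idem]
        rfl
      rw [e]
      refine ⟨_, Exec.seq (Exec.inc _ 2 (by omega) ?_) (Exec.inc _ 2 (by omega) ?_), ?_, ?_⟩
      · rw [CState.regs_set_self]; omega
      · rw [CState.regs_set_self, CState.regs_set_self]; omega
      · simp only [CState.regs_set_self, CState.set_set]
        rfl
      · rw [CState.regs_set_of_ne _ _ (by omega), CState.regs_set_of_ne _ _ (by omega),
          CState.regs_set_of_ne _ _ (by omega), CState.regs_set_self]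
        omega)
  have e2 := exec_addTo (k := k) (B := B) (x := x) (r := 2) (t := 1) (by omega) (by omega)
    (by omega) ((σ.set 1 (σ.regs 1 - σ.regs 1)).set 2 (2 * σ.regs 1)) (by
      rw [CState.regs_set_self, CState.regs_set_of_ne _ _ (by omega), CState.regs_set_self]
      omega)
  have e := e1.seq e2
  convert e using 1
  rw [CState.regs_set_self, CState.regs_set_of_ne _ _ (by omega), CState.regs_set_self,
    CState.set_set, ← h2]
  simp only [CState.set, CState.mk.injEq, and_true, Nat.sub_self, Nat.zero_add]
  rw [Function.update_comm (by norm_num : (2 : ℕ) ≠ 1), Function.update_idem,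
    Function.update_comm (by norm_num : (1 : ℕ) ≠ 2), Function.update_eq_self]

theorem exec_readBits {k B N w n : ℕ} {x : List (Option Bool)} (hk : 3 ≤ k)
    (hx : x = ones N ++ none :: (bits w n).map some) (hn : n < 2 ^ w) (hB : n ≤ B) {σ₀ : CState}
    (h0 : σ₀.regs 0 = N) (h1 : ∀ j, j ≠ 0 → σ₀.regs j = 0) (hin : σ₀.inHead = N + 1)
    (ho : σ₀.out = []) :
    ∃ σ, Exec k B x readBits σ₀ σ ∧ σ.regs 0 = N ∧ σ.regs 1 = n ∧ σ.out = [] := by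
  have hlen : x.length = N + 1 + w := by
    simp [hx, ones, bits]
    ring
  have hread : ∀ i < w, x[N + 1 + i]? = some (some (n.testBit (w - 1 - i))) := by
    intro i hi
    rw [hx, List.getElem?_append_right (by simp [ones]; omega)]
    have : N + 1 + i - (ones N).length = i + 1 := by simp [ones]; omega
    rw [this, List.getElem?_cons_succ]
    simp only [bits, List.getElem?_map]
    rw [List.getElem?_reverse (by simpa using hi)]
    simp only [List.length_range]
    rw [List.getElem?_range (by omega)]
    rfl
  -- Horner's scheme: after `i` of the `w` digits, most significant first, counter `1` holds the
  -- number formed by them.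
  let I : ℕ → CState → Prop := fun i s => s.regs 0 = N ∧ s.regs 1 = n / 2 ^ (w - i) ∧
    s.regs 2 = 0 ∧ s.inHead = N + 2 + i ∧ s.out = []
  have c1 : ∀ i < w, ∀ s, I i s → isBit (Machine.readIn x s.inHead) = true := by
    rintro i hi s ⟨-, -, -, h, -⟩
    rw [h, show N + 2 + i = (N + 1 + i) + 1 by ring]
    simp only [Machine.readIn, hread i hi, isBit]
  have c2 : ∀ s, I w s → isBit (Machine.readIn x s.inHead) = false := by
    rintro s ⟨-, -, -, h, -⟩
    rw [h, show N + 2 + w = (N + 1 + w) + 1 by ring]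
    simp only [Machine.readIn, ← hlen, List.getElem?_length, isBit]
  have c3 : ∀ i < w, ∀ s, I i s → ∃ s', Exec k B x
      (.seq (.loop 1 (.seq (.inc 2) (.inc 2))) (.seq (.loop 2 (.inc 1))
        (.seq (.ifIn isOne (.inc 1)) .next))) s s' ∧ I (i + 1) s' := by
    rintro i hi s ⟨j1, j2, j3, j4, j5⟩
    obtain ⟨m, hm⟩ : ∃ m, w - i = m + 1 := ⟨w - i - 1, by omega⟩
    have hdiv := div_two_pow_succ n m
    have hle : n / 2 ^ m ≤ n := Nat.div_le_self _ _
    have ed := exec_double (x := x) (B := B) hk s j3 (by rw [j2, hm]; omega)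
    set s₁ := s.set 1 (2 * s.regs 1) with hs₁
    have hr : Machine.readIn x s₁.inHead = .sym (some (n.testBit m)) := by
      have h4 : s₁.inHead = (N + 1 + i) + 1 := by rw [hs₁]; simp only [CState.set, j4]; ring
      rw [h4]
      simp only [Machine.readIn, hread i hi]
      rw [show w - 1 - i = m by omega]
    have ei : Exec k B x (.ifIn isOne (.inc 1)) s₁ (s.set 1 (n / 2 ^ m)) := by
      have hs₁r : s₁.regs 1 = 2 * (n / 2 ^ (m + 1)) := by rw [hs₁, CState.regs_set_self, j2, hm]
      cases hb : n.testBit m with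
      | true =>
        rw [hb, Bool.toNat_true] at hdiv
        have := Exec.ifTrue (c := isOne) (k := k) (B := B) (x := x) (by rw [hr, hb]; rfl)
          (Exec.inc s₁ 1 (by omega) (by rw [hs₁r]; omega))
        rwa [hs₁r, ← hdiv, hs₁, CState.set_set] at this
      | false =>
        rw [hb, Bool.toNat_false, Nat.add_zero] at hdiv
        have := Exec.ifFalse (c := isOne) (k := k) (B := B) (x := x) (p := .inc 1) s₁
          (by rw [hr, hb]; rfl)
        rwa [hdiv, ← hm, ← j2]
    cases ed with
    | seq d1 d2 =>
      refine ⟨_, d1.seq (d2.seq (ei.seq (Exec.next _))), j1, ?_, ?_, ?_, j5⟩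
      · simp only [CState.set, Function.update_self]
        rw [show w - (i + 1) = m by omega]
      · simpa [CState.set] using j3
      · simp only [CState.set, Machine.moveIn, j4, hlen]
        omega
  obtain ⟨σ, e1, e2⟩ := Exec.while_inv (k := k) (B := B) (x := x) (c := isBit)
    (p := .seq (.loop 1 (.seq (.inc 2) (.inc 2)))
      (.seq (.loop 2 (.inc 1)) (.seq (.ifIn isOne (.inc 1)) .next)))
    I
    (σ := { σ₀ with inHead := Machine.moveIn x σ₀.inHead .right }) w
    ⟨h0, by simp [h1, Nat.div_eq_of_lt hn], h1 2 (by norm_num), by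
      simp only [hin, Machine.moveIn, hlen]; omega, ho⟩
    c1 c2 c3
  refine ⟨σ, (Exec.next _).seq e1, e2.1, ?_, e2.2.2.2.2⟩
  rw [e2.2.1]
  simp

theorem computable_posEncoding :
    LogspaceComputable
      (fun q : (Σ N : ℕ, Fin (connLen N)) =>
        ones q.1 ++ none :: (bits (Nat.clog 2 (connLen q.1)) q.2).map some)
      (fun q => vecCode ((connTransformer q.1).pe q.2)) := by
  have hsz : ∀ q : (Σ N : ℕ, Fin (connLen N)),
      q.1 ≤ (ones q.1 ++ none :: (bits (Nat.clog 2 (connLen q.1)) q.2).map some).length := by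
    intro q
    simp [ones]
  have hlt : ∀ q : (Σ N : ℕ, Fin (connLen N)), q.2.val ≤
      ((ones q.1 ++ none :: (bits (Nat.clog 2 (connLen q.1)) q.2).map some).length + 2) ^ 3 := by
    intro q
    have h1 := q.2.isLt
    -- The strings have cubic length, which is why counters up to the third power of the input
    -- length are allowed.
    have h2 : connLen q.1 ≤ (q.1 + 2) ^ 3 := by
      have : Nat.clog 2 q.1 ≤ q.1 := Nat.clog_le_of_le_pow (Nat.lt_two_pow_self).le
      rw [connLen]
      nlinarith [sq_nonneg q.1]
    exact (h1.le.trans h2).trans (Nat.pow_le_pow_left (by have := hsz q; omega) 3)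
  refine logspaceComputable_of_emits (h := 2)
    (fun i q => if i = 0 then q.1 else q.2) ?_ (.seq readOnes readBits) 3 3 ?_ ?_
  · intro i _
    refine ⟨3, fun q => ?_⟩
    dsimp only
    split_ifs
    · exact (hsz q).trans ((by omega : _ ≤ _ + 2).trans (Nat.le_self_pow (by norm_num) _))
    · exact hlt q
  · intro q
    obtain ⟨σ, h1, h2, h3, h4, h5⟩ := exec_readOnes (k := 3)
      (B := ((ones q.1 ++ none :: (bits (Nat.clog 2 (connLen q.1)) q.2).map some).length + 2) ^ 3)
      (x := ones q.1 ++ none :: (bits (Nat.clog 2 (connLen q.1)) q.2).map some) (N := q.1) rfl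
      (by simp [Machine.readIn, ones, isOne])
      ((hsz q).trans ((by omega : _ ≤ _ + 2).trans (Nat.le_self_pow (by norm_num) _)))
      (by norm_num)
    obtain ⟨σ', e1, e2, e3, e4⟩ := exec_readBits (k := 3) le_rfl rfl
      (q.2.isLt.trans_le (Nat.le_pow_clog (by norm_num) _)) (hlt q) h2 h3 h4 h5
    refine ⟨σ', h1.seq e1, e4, fun i hi => ?_⟩
    interval_cases i
    · simpa using e2
    · simpa using e3
  · exact Emits.posEncoding (N := fun q : (Σ N : ℕ, Fin (connLen N)) => q.1)
      (p := fun q => q.2.val) (Cmp.var ⟨0, by norm_num, by simp⟩) (Cmp.var ⟨1, by norm_num, by simp⟩)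

theorem lUniform_connTransformer : LUniform connTransformer connLen :=
  ⟨computable_code, computable_posEncoding⟩

/-! ### Arithmetic with precision `1` -/

theorem Fx.mant_le (x : Fx 1) : -3 ≤ x.mant ∧ x.mant ≤ 3 := by
  have := x.bound
  norm_num at this
  omega

theorem Fx.val_one (x : Fx 1) : x.val = (x.mant : ℝ) / 2 := by simp [Fx.val]

/-- The mantissa of the rounding of `p / q`. -/
def rq (p : ℤ) (q : ℕ) : ℤ :=
  if p < 0 then -(min ((4 * p.natAbs + q) / (2 * q)) 3 : ℕ)
  else (min ((4 * p.natAbs + q) / (2 * q)) 3 : ℕ)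

/-- The floor of `2 * |p| / q + 1 / 2` is a quotient of natural numbers, so rounding a rational
becomes integer arithmetic that can be decided case by case. -/
theorem rnd_mant (p : ℤ) {q : ℕ} (hq : 0 < q) : (Fx.rnd 1 ((p : ℝ) / q)).mant = rq p q := by
  have hq' : (0 : ℝ) < q := by exact_mod_cast hq
  have h1 : ⌊|(p : ℝ) / q| * 2 ^ 1 + 1 / 2⌋₊ = (4 * p.natAbs + q) / (2 * q) := by
    have : |(p : ℝ) / q| * 2 ^ 1 + 1 / 2 = ((4 * p.natAbs + q : ℕ) : ℝ) / ((2 * q : ℕ) : ℝ) := by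
      rw [abs_div, abs_of_pos hq']
      push_cast
      rw [Nat.cast_natAbs, Int.cast_abs]
      field_simp
      ring
    rw [this, Nat.floor_div_eq_div]
  have h2 : (p : ℝ) / q < 0 ↔ p < 0 := by
    rw [div_neg_iff]
    constructor
    · rintro (⟨_, h⟩ | ⟨h, _⟩)
      · linarith
      · exact_mod_cast h
    · intro h
      exact Or.inr ⟨by exact_mod_cast h, hq'⟩
  unfold Fx.rnd rq
  simp only [h2, h1]
  split_ifs <;> simp

theorem rnd_mant_eq {x : ℝ} {p : ℤ} {q : ℕ} (hq : 0 < q) (h : x = (p : ℝ) / q) :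
    (Fx.rnd 1 x).mant = rq p q := h ▸ rnd_mant p hq

/-- Clipping to the range of mantissas. -/
def clip (z : ℤ) : ℤ := max (-3) (min 3 z)

theorem rq_two (z : ℤ) : rq z 2 = clip z := by
  unfold rq clip
  split_ifs <;> omega

theorem add_mant (x y : Fx 1) : (Fx.add x y).mant = clip (x.mant + y.mant) := by
  rw [← rq_two]
  refine rnd_mant_eq (by norm_num) ?_
  rw [Fx.val_one, Fx.val_one]
  push_cast
  ring

theorem sub_mant (x y : Fx 1) : (Fx.sub x y).mant = clip (x.mant - y.mant) := by
  rw [← rq_two]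
  refine rnd_mant_eq (by norm_num) ?_
  rw [Fx.val_one, Fx.val_one]
  push_cast
  ring

theorem mul_mant (x y : Fx 1) : (Fx.mul x y).mant = rq (x.mant * y.mant) 4 := by
  refine rnd_mant_eq (by norm_num) ?_
  rw [Fx.val_one, Fx.val_one]
  push_cast
  ring

theorem div_mant (x y : Fx 1) (hy : 0 < y.mant) :
    (Fx.div x y).mant = rq x.mant y.mant.natAbs := by
  refine rnd_mant_eq (by omega) ?_
  rw [Fx.val_one, Fx.val_one, Nat.cast_natAbs, abs_of_pos hy]
  have : (y.mant : ℝ) ≠ 0 := by exact_mod_cast hy.ne'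
  field_simp

theorem relu_mant (x : Fx 1) : (Fx.relu x).mant = max x.mant 0 := by
  have h : (Fx.relu x).mant = rq (max x.mant 0) 2 := by
    refine rnd_mant_eq (by norm_num) ?_
    rw [Fx.val_one]
    push_cast
    rw [max_div_div_right (by norm_num : (0 : ℝ) ≤ 2) (x.mant : ℝ) 0 |>.symm]
    simp
  rw [h, rq_two, clip]
  have := x.mant_le
  omega

theorem rnd_natCast_mant (n : ℕ) : (Fx.rnd 1 (n : ℝ)).mant = rq n 1 :=
  rnd_mant_eq one_pos (by simp)

theorem ofMant_mant {z : ℤ} (h : -3 ≤ z ∧ z ≤ 3) : (ofMant z).mant = z := by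
  simp only [ofMant]
  omega

theorem zero_mant {b : ℕ} : (0 : Fx b).mant = 0 := rfl

/-- The roots of `1/2`, `1` and `3/2` are about `0.71`, `1` and `1.22`; the nearest multiples of
`1/2` are `1/2`, `1` and `1`. -/
theorem sqrt_mant (x : Fx 1) (hx : 0 < x.mant) :
    (Fx.sqrt x).mant = if x.mant = 1 then 1 else 2 := by
  have hle := x.mant_le.2
  have hnn : ¬ Real.sqrt x.val < 0 := not_lt.2 (Real.sqrt_nonneg _)
  have key : ∀ m : ℕ, (m : ℝ) ≤ Real.sqrt x.val * 2 + 1 / 2 → Real.sqrt x.val * 2 + 1 / 2 < m + 1 →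
      m ≤ 3 → (Fx.sqrt x).mant = m := by
    intro m h1 h2 h3
    have hf : ⌊|Real.sqrt x.val| * 2 ^ 1 + 1 / 2⌋₊ = m := by
      rw [abs_of_nonneg (Real.sqrt_nonneg _), Nat.floor_eq_iff (by positivity)]
      exact ⟨by simpa using h1, by simpa using h2⟩
    unfold Fx.sqrt Fx.rnd
    simp only [hnn, if_false, hf]
    simpa using h3
  rw [Fx.val_one] at key
  have : x.mant = 1 ∨ x.mant = 2 ∨ x.mant = 3 := by omega
  rcases this with h | h | h <;> rw [h] at key ⊢
  · refine key 1 ?_ ?_ (by norm_num)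
    · have : (1 / 4 : ℝ) ≤ Real.sqrt ((1 : ℤ) / 2) := Real.le_sqrt_of_sq_le (by norm_num)
      push_cast at this ⊢
      linarith
    · have : Real.sqrt ((1 : ℤ) / 2) < 3 / 4 := by
        rw [Real.sqrt_lt' (by norm_num)]; norm_num
      push_cast at this ⊢
      linarith
  · refine key 2 ?_ ?_ (by norm_num)
    · have : (3 / 4 : ℝ) ≤ Real.sqrt ((2 : ℤ) / 2) := Real.le_sqrt_of_sq_le (by norm_num)
      push_cast at this ⊢
      linarith
    · have : Real.sqrt ((2 : ℤ) / 2) < 5 / 4 := by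
        rw [Real.sqrt_lt' (by norm_num)]; norm_num
      push_cast at this ⊢
      linarith
  · refine key 2 ?_ ?_ (by norm_num)
    · have : (3 / 4 : ℝ) ≤ Real.sqrt ((3 : ℤ) / 2) := Real.le_sqrt_of_sq_le (by norm_num)
      push_cast at this ⊢
      linarith
    · have : Real.sqrt ((3 : ℤ) / 2) < 5 / 4 := by
        rw [Real.sqrt_lt' (by norm_num)]; norm_num
      push_cast at this ⊢
      linarith

theorem exp_mant_zero (x : Fx 1) (hx : x.mant = 0) : (Fx.exp x).mant = 2 := by
  have : (Fx.exp x).mant = rq 1 1 := by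
    refine rnd_mant_eq one_pos ?_
    rw [Fx.val_one, hx]
    simp
  rw [this]
  rfl

/-- The smallest representable exponent already gives a weight that vanishes: `exp (-3/2) < 1/4`,
and numbers below `1/4` round to zero. -/
theorem exp_mant_min (x : Fx 1) (hx : x.mant = -3) : (Fx.exp x).mant = 0 := by
  have hv : x.val = -(3 / 2) := by
    rw [Fx.val_one, hx]
    push_cast
    ring
  have hpos := Real.exp_pos x.val
  have hlt : Real.exp x.val < 1 / 4 := by
    rw [hv, Real.exp_neg]
    have h1 : (4 : ℝ) < Real.exp (3 / 2) := by
      have h2 := Real.exp_one_gt_d9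
      -- Squaring reduces `exp (3/2) > 4` to `e ^ 3 > 16`, and `2.7 ^ 3` is about `19.7`.
      have h3 : Real.exp (3 / 2) ^ 2 = Real.exp 1 ^ 3 := by
        rw [← Real.exp_nat_mul, ← Real.exp_nat_mul]
        norm_num
      have h4 : (2.7 : ℝ) ^ 3 < Real.exp 1 ^ 3 := by
        gcongr
        linarith
      have h5 := Real.exp_pos (3 / 2)
      nlinarith
    rw [one_div]
    exact inv_strictAnti₀ (by norm_num) h1
  have hf : ⌊|Real.exp x.val| * 2 ^ 1 + 1 / 2⌋₊ = 0 := by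
    rw [abs_of_pos hpos, Nat.floor_eq_zero]
    linarith
  unfold Fx.exp Fx.rnd
  simp only [not_lt.2 hpos.le, if_false, hf]
  simp

/-! ### Sums -/

/-- Addition of mantissas is exact up to saturation, and a sum of non-negative terms that has
reached the maximum stays there. So clipping after each addition is the same as clipping once at the
end. -/
theorem foldl_add_nonneg (l : List (Fx 1)) (h : ∀ x ∈ l, 0 ≤ x.mant) :
    ∀ s : Fx 1, (l.foldl Fx.add s).mant = min 3 (s.mant + (l.map Fx.mant).sum) := by
  induction l with
  | nil =>
    intro s
    have := s.mant_le
    simp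
    omega
  | cons x l ih =>
    intro s
    have hx := h x (by simp)
    have hs : 0 ≤ (l.map Fx.mant).sum := List.sum_nonneg (by
      intro z hz
      obtain ⟨y, hy, rfl⟩ := List.mem_map.1 hz
      exact h y (by simp [hy]))
    have := s.mant_le
    rw [List.foldl_cons, ih (fun y hy => h y (by simp [hy])), add_mant, clip, List.map_cons,
      List.sum_cons]
    omega

theorem foldl_add_nonpos (l : List (Fx 1)) (h : ∀ x ∈ l, x.mant ≤ 0) :
    ∀ s : Fx 1, (l.foldl Fx.add s).mant = max (-3) (s.mant + (l.map Fx.mant).sum) := by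
  induction l with
  | nil =>
    intro s
    have := s.mant_le
    simp
    omega
  | cons x l ih =>
    intro s
    have hx := h x (by simp)
    have hs : (l.map Fx.mant).sum ≤ 0 := by
      have : ∀ z ∈ l.map Fx.mant, z ≤ 0 := by
        intro z hz
        obtain ⟨y, hy, rfl⟩ := List.mem_map.1 hz
        exact h y (by simp [hy])
      generalize l.map Fx.mant = l' at this ⊢
      clear * - this
      induction l' with
      | nil => simp
      | cons a l' ih =>
        have h1 := this a (by simp)
        have h2 := ih fun z hz => this z (by simp [hz])
        rw [List.sum_cons]
        omega
    have := s.mant_le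
    rw [List.foldl_cons, ih (fun y hy => h y (by simp [hy])), add_mant, clip, List.map_cons,
      List.sum_cons]
    omega

theorem sum_mant_nonneg {n : ℕ} (f : Fin n → Fx 1) (h : ∀ i, 0 ≤ (f i).mant) :
    (Fx.sum (List.ofFn f)).mant = min 3 (∑ i, (f i).mant) := by
  rw [Fx.sum, foldl_add_nonneg _ (by simpa [List.mem_ofFn] using h), zero_mant, zero_add,
    List.map_ofFn, List.sum_ofFn]
  rfl

theorem sum_mant_nonpos {n : ℕ} (f : Fin n → Fx 1) (h : ∀ i, (f i).mant ≤ 0) :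
    (Fx.sum (List.ofFn f)).mant = max (-3) (∑ i, (f i).mant) := by
  rw [Fx.sum, foldl_add_nonpos _ (by simpa [List.mem_ofFn] using h), zero_mant, zero_add,
    List.map_ofFn, List.sum_ofFn]
  rfl

/-- A sum whose terms are non-positive up to the index `p` and non-negative afterwards. -/
theorem sum_mant_mixed {n : ℕ} (f : Fin n → Fx 1) (p : Fin n) (hlt : ∀ i < p, (f i).mant = 0)
    (hgt : ∀ i, p < i → 0 ≤ (f i).mant) :
    (Fx.sum (List.ofFn f)).mant = min 3 (∑ i, (f i).mant) := by
  set l := List.ofFn f with hl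
  have hlen : l.length = n := by simp [hl]
  have hp : p.val < l.length := by rw [hlen]; exact p.isLt
  have htake : ∀ x ∈ l.take p, x.mant = 0 := by
    intro x hx
    obtain ⟨i, hi, rfl⟩ := List.mem_take_iff_getElem.1 hx
    simp only [hl, List.getElem_ofFn]
    exact hlt _ (by rw [Fin.lt_def]; simp only; omega)
  have hdrop : ∀ x ∈ l.drop (p + 1), 0 ≤ x.mant := by
    intro x hx
    obtain ⟨i, hi, rfl⟩ := List.mem_drop_iff_getElem.1 hx
    simp only [hl, List.getElem_ofFn]
    exact hgt _ (by rw [Fin.lt_def]; simp only; omega)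
  have hsplit : l = l.take p ++ f p :: l.drop (p + 1) := by
    conv_lhs => rw [← List.take_append_drop p l, List.drop_eq_getElem_cons hp]
    simp [hl]
  have hzero : ((l.take p).map Fx.mant).sum = 0 := List.sum_eq_zero (by
    intro z hz
    obtain ⟨y, hy, rfl⟩ := List.mem_map.1 hz
    exact htake y hy)
  have hsum : ∑ i, (f i).mant = (l.map Fx.mant).sum := by
    rw [hl, List.map_ofFn, List.sum_ofFn]
    rfl
  have h1 : ((l.take p).foldl Fx.add 0).mant = 0 := by
    rw [foldl_add_nonneg _ (fun x hx => (htake x hx).ge), hzero, zero_mant]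
    rfl
  have hfp := (f p).mant_le
  rw [hsum, hsplit, Fx.sum, List.foldl_append, List.foldl_cons, foldl_add_nonneg _ hdrop, add_mant,
    h1, List.map_append, List.sum_append, hzero, List.map_cons, List.sum_cons, clip]
  congr 1
  omega

/-! ### Layer normalization -/

/-- The coordinates `2 * m + 1` hold the negatives of the coordinates `2 * m`. -/
def Antisymm {D : ℕ} (x : Fin D → Fx 1) : Prop :=
  ∀ d e : Fin D, d.val % 2 = 0 → e.val = d.val + 1 → (x e).mant = -(x d).mant

theorem entries_pairNorm {D : ℕ} (x : Fin D → Fx 1) (d a b : Fin D) (ha : a.val = 2 * (d.val / 2))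
    (hb : b.val = 2 * (d.val / 2) + 1) : (pairNorm D).entries x d = [x a, x b] := by
  have : (List.finRange D).filter (fun e => (pairNorm D).part e = (pairNorm D).part d) = [a, b] := by
    -- Both lists are strictly increasing, so it is enough that they have the same members.
    refine List.Perm.eq_of_pairwise (le := (· < ·))
      (fun u v _ _ h1 h2 => absurd (h1.trans h2) (lt_irrefl _))
      ((List.pairwise_lt_finRange D).filter _) ?_ ?_
    · simp only [List.pairwise_cons, List.mem_singleton, forall_eq, Fin.lt_def]
      simp
      omega
    · refine (List.perm_ext_iff_of_nodup ((List.nodup_finRange D).filter _) ?_).2 fun e => ?_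
      · simp only [List.nodup_cons, List.mem_singleton, Fin.ext_iff]
        simp
        omega
      · simp only [List.mem_filter, List.mem_finRange, true_and, decide_eq_true_eq, pairNorm,
          List.mem_cons, List.not_mem_nil, or_false, Fin.ext_iff]
        omega
  rw [LayerNorm.entries, this]
  rfl

/-- The length `2` of a pair is out of range and is rounded to `3/2`, so a mean in fixed-point
arithmetic divides by `3/2`. -/
theorem rnd_two_mant : (Fx.rnd 1 (2 : ℕ)).mant = 3 := by
  rw [rnd_natCast_mant]
  rfl

theorem mean_pair_mant (x y : Fx 1) :
    (LayerNorm.mean [x, y]).mant = rq (clip (clip x.mant + y.mant)) 3 := by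
  rw [LayerNorm.mean, show [x, y].length = 2 from rfl, div_mant _ _ (by rw [rnd_two_mant]; norm_num),
    rnd_two_mant]
  simp only [Fx.sum, List.foldl_cons, List.foldl_nil, add_mant, zero_mant, zero_add]
  rfl

theorem clip_of {z : ℤ} (h : -3 ≤ z ∧ z ≤ 3) : clip z = z := by
  unfold clip
  omega

/-- A channel and its shadow have mean zero. For a non-zero entry the rounded variance plus `ε =
1/2` is `1` or `3/2`, and the rounded root is `1` in both cases; with gain `1` and bias `0` the
entry is returned unchanged. For a zero pair `ε` keeps the divisor at `1/2`. -/
theorem pairNorm_spec {D : ℕ} (hD : D % 2 = 0) {x : Fin D → Fx 1} (hx : Antisymm x) :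
    (pairNorm D).Safe x ∧ ∀ d, ((pairNorm D).eval x d).mant = (x d).mant := by
  have key : ∀ d, ((pairNorm D).entries x d).length = 2 ∧ ((pairNorm D).mu x d).mant = 0 ∧
      ((pairNorm D).sigma x d).mant = if (x d).mant = 0 then 1 else 2 := by
    intro d
    have hd := d.isLt
    let a : Fin D := ⟨2 * (d.val / 2), by omega⟩
    let b : Fin D := ⟨2 * (d.val / 2) + 1, by omega⟩
    have he := entries_pairNorm x d a b rfl rfl
    have hab : (x b).mant = -(x a).mant := hx a b (by simp [a]) rfl
    have ha := (x a).mant_le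
    have hmu : ((pairNorm D).mu x d).mant = 0 := by
      rw [LayerNorm.mu, he, mean_pair_mant, hab, clip_of ha]
      simp
      rfl
    refine ⟨by rw [he]; rfl, hmu, ?_⟩
    have hda : (x d).mant = (x a).mant ∨ (x d).mant = -(x a).mant := by
      rcases Nat.mod_two_eq_zero_or_one d.val with h | h
      · left
        congr 2
        exact Fin.ext (by simp only [a]; omega)
      · right
        rw [← hab]
        congr 2
        exact Fin.ext (by simp only [b]; omega)
    -- Entries `±1/2`, `±1`, `±3/2` have rounded squares `1/2`, `1`, `3/2`. Their saturated pair
    -- sums `1`, `3/2`, `3/2`, divided by `3/2`, round to `1/2`, `1`, `1`, before `ε` is added.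
    have harg : (Fx.add (LayerNorm.mean (((pairNorm D).entries x d).map fun y =>
        Fx.mul (Fx.sub y ((pairNorm D).mu x d)) (Fx.sub y ((pairNorm D).mu x d))))
        (pairNorm D).eps).mant = if (x a).mant = 0 then 1 else if (x a).mant.natAbs = 1 then 2
          else 3 := by
      rw [he, List.map_cons, List.map_cons, List.map_nil, add_mant, mean_pair_mant, mul_mant,
        mul_mant, sub_mant, sub_mant, hmu, hab, show (pairNorm D).eps.mant = 1 from rfl]
      generalize (x a).mant = z at ha
      obtain ⟨h1, h2⟩ := ha
      interval_cases z <;> rfl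
    rw [LayerNorm.sigma, sqrt_mant _ (by rw [harg]; split_ifs <;> norm_num), harg]
    rcases hda with h | h <;> rw [h] <;> split_ifs <;> omega
  constructor
  · intro d
    obtain ⟨h1, -, h3⟩ := key d
    constructor
    · rw [h1]
      intro h
      have := rnd_two_mant
      rw [h, zero_mant] at this
      norm_num at this
    · intro h
      rw [h, zero_mant] at h3
      split_ifs at h3 <;> omega
  · intro d
    obtain ⟨-, h2, h3⟩ := key d
    have hd := (x d).mant_le
    rw [LayerNorm.eval, add_mant, mul_mant, div_mant _ _ (by rw [h3]; split_ifs <;> norm_num),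
      sub_mant, h2, h3, show ((pairNorm D).gain d).mant = 2 from rfl,
      show ((pairNorm D).bias d).mant = 0 from rfl]
    generalize (x d).mant = z at hd
    obtain ⟨h1, h2⟩ := hd
    interval_cases z <;> rfl

/-! ### Block-diagonal matrices -/

/-- Coordinate `r` of slice `l`. -/
def coord {W : ℕ} (l : ℕ) (hl : l < W) (r : ℕ) (hr : r < 46) : Fin (W * 46) :=
  ⟨l * 46 + r, by nlinarith⟩

theorem coord_div {W l r : ℕ} (hl : l < W) (hr : r < 46) : (coord l hl r hr).val / 46 = l := by
  simp only [coord]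
  omega

theorem coord_mod {W l r : ℕ} (hl : l < W) (hr : r < 46) : (coord l hl r hr).val % 46 = r := by
  simp only [coord]
  omega

theorem eq_coord {W l r : ℕ} (hl : l < W) (hr : r < 46) {d : Fin (W * 46)} (h1 : d.val / 46 = l)
    (h2 : d.val % 46 = r) : d = coord l hl r hr := by
  apply Fin.ext
  simp only [coord]
  omega

theorem exists_coord {W : ℕ} (d : Fin (W * 46)) :
    ∃ l, ∃ hl : l < W, ∃ r, ∃ hr : r < 46, d = coord l hl r hr :=
  ⟨d.val / 46, by have := d.isLt; omega, d.val % 46, by omega, eq_coord _ _ rfl rfl⟩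

theorem rq_zero {q : ℕ} : rq 0 q = 0 := by
  unfold rq
  rcases Nat.eq_zero_or_pos q with rfl | h
  · simp
  · rw [if_neg (lt_irrefl _)]
    have : (4 * (0 : ℤ).natAbs + q) / (2 * q) = 0 := Nat.div_eq_of_lt (by simp; omega)
    rw [this]
    rfl

theorem rq_four_le (z : ℤ) : -3 ≤ rq z 4 ∧ rq z 4 ≤ 3 := by
  unfold rq
  split_ifs <;> omega

theorem rq_four_neg (z : ℤ) : rq (-z) 4 = -rq z 4 := by
  unfold rq
  split_ifs <;> omega

theorem rq_four_nonneg {z : ℤ} (h : 0 ≤ z) : 0 ≤ rq z 4 := by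
  unfold rq
  split_ifs <;> omega

/-- The smallest non-zero product is `1/2 * 1/2 = 1/4`, a tie, and ties are rounded away from zero.
So positivity survives multiplication. -/
theorem rq_four_pos {z : ℤ} (h : 0 < z) : 0 < rq z 4 := by
  unfold rq
  split_ifs <;> omega

/-- With at most one non-zero weight in a column, only the product is rounded and the summation is
exact. The case `z = 0`, with any `r₀`, covers empty columns. -/
theorem vecMul_single {W : ℕ} (x : Fin (W * 46) → Fx 1) (w : ℕ → ℕ → ℤ) {l r r₀ : ℕ} (hl : l < W)
    (hr : r < 46) (hr₀ : r₀ < 46) {z : ℤ} (hz : -3 ≤ z ∧ z ≤ 3)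
    (hw : ∀ r' < 46, w r' r = if r' = r₀ then z else 0) :
    (Fx.vecMul x (sliceMat (W * 46) w) (coord l hl r hr)).mant =
      rq ((x (coord l hl r₀ hr₀)).mant * z) 4 := by
  have hterm : ∀ i, (Fx.mul (x i) (sliceMat (W * 46) w i (coord l hl r hr))).mant =
      if i = coord l hl r₀ hr₀ then rq ((x (coord l hl r₀ hr₀)).mant * z) 4 else 0 := by
    intro i
    rw [mul_mant, sliceMat, coord_div, coord_mod]
    split_ifs with h1 h2 h2
    · rw [hw _ (Nat.mod_lt _ (by norm_num)), h2, coord_mod, if_pos rfl, ofMant_mant hz]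
    · rw [hw _ (Nat.mod_lt _ (by norm_num)), if_neg fun h => h2 (eq_coord _ _ h1 h)]
      exact (congrArg (rq · 4) (mul_zero _)).trans rq_zero
    · exact absurd (by rw [h2, coord_div]) h1
    · exact (congrArg (rq · 4) (mul_zero _)).trans rq_zero
  have hle := rq_four_le ((x (coord l hl r₀ hr₀)).mant * z)
  have hsum : ∑ i, (Fx.mul (x i) (sliceMat (W * 46) w i (coord l hl r hr))).mant =
      rq ((x (coord l hl r₀ hr₀)).mant * z) 4 := by
    simp only [hterm]
    simp
  rw [Fx.vecMul, Fx.dot]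
  rcases le_total 0 (rq ((x (coord l hl r₀ hr₀)).mant * z) 4) with h | h
  · rw [sum_mant_nonneg _ fun i => by rw [hterm]; split_ifs <;> omega, hsum]
    omega
  · rw [sum_mant_nonpos _ fun i => by rw [hterm]; split_ifs <;> omega, hsum]
    omega

/-! ### Abstract semantics of layers -/

namespace LayerSpec

variable {n : ℕ} (s : LayerSpec) (W : ℕ) (β : Fin n → ℕ → ℕ → Prop)

/-- Position `i` attends to position `j`, if `β i l c` tells whether channel `c` of slice `l` is
active at position `i`. -/
def Match (i j : Fin n) : Prop := ∀ l < W, ∀ p ∈ s.att, ¬ (β i l p.1 ∧ β j l p.2)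

/-- The active channels after attention. -/
def afterAttention (i : Fin n) (l c : ℕ) : Prop :=
  β i l c ∨ ∃ a, s.val c = some a ∧ ∃ j, s.Match W β i j ∧ β j l a

end LayerSpec

def Gate.Holds (P : ℕ → Prop) : Gate → Prop
  | .none => False
  | .and a b => P a ∧ P b
  | .not a => ¬ P a

/-- The active channels after a layer. -/
def LayerSpec.after {n : ℕ} (s : LayerSpec) (W : ℕ) (β : Fin n → ℕ → ℕ → Prop) (i : Fin n)
    (l c : ℕ) : Prop :=
  s.afterAttention W β i l c ∨ (s.gate c).Holds (s.afterAttention W β i l)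

def Gate.WellFormed : Gate → Prop
  | .none => True
  | .and a b => 0 < a ∧ 0 < b ∧ a ≠ b ∧ a < 23 ∧ b < 23
  | .not a => a < 23

structure LayerSpec.WellFormed (s : LayerSpec) : Prop where
  length_att : s.att.length ≤ 46
  att_lt : ∀ p ∈ s.att, p.1 < 23 ∧ p.2 < 23
  val_lt : ∀ c a, s.val c = some a → a < 23
  gate_wf : ∀ c, (s.gate c).WellFormed
  val_zero : s.val 0 = none
  gate_zero : s.gate 0 = .none

/-- The channels of a row have the activations `P`. -/
structure RowSim {W : ℕ} (x : Fin (W * 46) → Fx 1) (P : ℕ → ℕ → Prop) : Prop where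
  nonneg : ∀ l (hl : l < W) c (hc : 2 * c < 46), 0 ≤ (x (coord l hl (2 * c) hc)).mant
  pos_iff : ∀ l (hl : l < W) c (hc : 2 * c < 46), 0 < (x (coord l hl (2 * c) hc)).mant ↔ P l c
  one : ∀ l (hl : l < W), (x (coord l hl 0 (by norm_num))).mant = 2

/-! ### Attention -/

section Attention

variable {W n : ℕ} {s : LayerSpec} {H : Fin n → Fin (W * 46) → Fx 1} {β : Fin n → ℕ → ℕ → Prop}

/-- The weights `±3/2` lift the weakest activation `1/2` to absolute value `1`, so every clash of
query and key costs at least `1`, whatever the activations are. -/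
theorem mant_cases_pos {x y : ℤ} (hx : 0 ≤ x ∧ x ≤ 3) (hy : 0 ≤ y ∧ y ≤ 3) :
    rq (rq (x * 3) 4 * rq (y * -3) 4) 4 = 0 ∧ ¬ (0 < x ∧ 0 < y) ∨
      rq (rq (x * 3) 4 * rq (y * -3) 4) 4 ≤ -2 ∧ (0 < x ∧ 0 < y) := by
  obtain ⟨h1, h2⟩ := hx
  obtain ⟨h3, h4⟩ := hy
  interval_cases x <;> interval_cases y <;> decide

theorem vecMul_wq_none (x : Fin (W * 46) → Fx 1) {l r : ℕ} (hl : l < W) (hr : r < 46)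
    (hs : s.att[r]? = none) :
    (Fx.vecMul x (sliceMat (W * 46) s.wq) (coord l hl r hr)).mant = 0 := by
  rw [vecMul_single x s.wq hl hr (r₀ := 0) (by norm_num) (z := 0) (by norm_num) fun r' _ => by
    simp [LayerSpec.wq, hs], mul_zero, rq_zero]

theorem vecMul_wq_some (x : Fin (W * 46) → Fx 1) {l r : ℕ} (hl : l < W) (hr : r < 46) {p : ℕ × ℕ}
    (hs : s.att[r]? = some p) (hp : 2 * p.1 < 46) :
    (Fx.vecMul x (sliceMat (W * 46) s.wq) (coord l hl r hr)).mant =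
      rq ((x (coord l hl (2 * p.1) hp)).mant * 3) 4 :=
  vecMul_single x s.wq hl hr hp (by norm_num) fun r' _ => by simp [LayerSpec.wq, hs]

theorem vecMul_wk_some (x : Fin (W * 46) → Fx 1) {l r : ℕ} (hl : l < W) (hr : r < 46) {p : ℕ × ℕ}
    (hs : s.att[r]? = some p) (hp : 2 * p.2 < 46) :
    (Fx.vecMul x (sliceMat (W * 46) s.wk) (coord l hl r hr)).mant =
      rq ((x (coord l hl (2 * p.2) hp)).mant * -3) 4 :=
  vecMul_single x s.wk hl hr hp (by norm_num) fun r' _ => by simp [LayerSpec.wk, hs]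

/-- All summands are non-positive, so nothing cancels: one clash pushes the score to `-1` or below,
and without a clash every summand is zero. -/
theorem scores_spec (hs : s.WellFormed) (hH : ∀ i, RowSim (H i) (β i)) (i j : Fin n) :
    (((s.layer (W * 46)).scores H i j).mant = 0 ∧ s.Match W β i j) ∨
      (((s.layer (W * 46)).scores H i j).mant ≤ -2 ∧ ¬ s.Match W β i j) := by
  set q := Fx.vecMul (H i) (sliceMat (W * 46) s.wq) with hq
  set k := Fx.vecMul (H j) (sliceMat (W * 46) s.wk) with hk
  have hterm : ∀ l (hl : l < W) r (hr : r < 46) p, s.att[r]? = some p →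
      (Fx.mul (q (coord l hl r hr)) (k (coord l hl r hr))).mant = 0 ∧ ¬ (β i l p.1 ∧ β j l p.2) ∨
      (Fx.mul (q (coord l hl r hr)) (k (coord l hl r hr))).mant ≤ -2 ∧ (β i l p.1 ∧ β j l p.2) := by
    intro l hl r hr p hp
    obtain ⟨h1, h2⟩ := hs.att_lt p (List.mem_of_getElem? hp)
    have hp1 : 2 * p.1 < 46 := by omega
    have hp2 : 2 * p.2 < 46 := by omega
    rw [mul_mant, hq, hk, vecMul_wq_some _ hl hr hp hp1, vecMul_wk_some _ hl hr hp hp2,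
      ← (hH i).pos_iff l hl p.1 hp1, ← (hH j).pos_iff l hl p.2 hp2]
    exact mant_cases_pos ⟨(hH i).nonneg l hl p.1 hp1, (Fx.mant_le _).2⟩
      ⟨(hH j).nonneg l hl p.2 hp2, (Fx.mant_le _).2⟩
  have hnone : ∀ l (hl : l < W) r (hr : r < 46), s.att[r]? = none →
      (Fx.mul (q (coord l hl r hr)) (k (coord l hl r hr))).mant = 0 := by
    intro l hl r hr hp
    rw [mul_mant, hq, vecMul_wq_none _ hl hr hp, zero_mul, rq_zero]
  have hle : ∀ d, (Fx.mul (q d) (k d)).mant ≤ 0 := by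
    intro d
    obtain ⟨l, hl, r, hr, rfl⟩ := exists_coord d
    cases hp : s.att[r]? with
    | none => exact (hnone l hl r hr hp).le
    | some p => rcases hterm l hl r hr p hp with h | h <;> omega
  have hscore : ((s.layer (W * 46)).scores H i j).mant = max (-3) (∑ d, (Fx.mul (q d) (k d)).mant) :=
    sum_mant_nonpos _ hle
  rw [hscore]
  by_cases hm : s.Match W β i j
  · left
    refine ⟨?_, hm⟩
    rw [Finset.sum_eq_zero]
    · rfl
    · intro d _
      obtain ⟨l, hl, r, hr, rfl⟩ := exists_coord d
      cases hp : s.att[r]? with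
      | none => exact hnone l hl r hr hp
      | some p =>
        rcases hterm l hl r hr p hp with h | h
        · exact h.1
        · exact absurd h.2 (hm l hl p (List.mem_of_getElem? hp))
  · right
    refine ⟨?_, hm⟩
    unfold LayerSpec.Match at hm
    push Not at hm
    obtain ⟨l, hl, p, hp, h1, h2⟩ := hm
    obtain ⟨r, hr, hpr⟩ := List.mem_iff_getElem.1 hp
    have hr' : r < 46 := hr.trans_le hs.length_att
    have hp' : s.att[r]? = some p := by rw [List.getElem?_eq_getElem hr, hpr]
    have h3 : ∑ d, (Fx.mul (q d) (k d)).mant ≤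
        (Fx.mul (q (coord l hl r hr')) (k (coord l hl r hr'))).mant := by
      rw [← Finset.add_sum_erase _ _ (Finset.mem_univ (coord l hl r hr'))]
      have := Finset.sum_nonpos (s := Finset.univ.erase (coord l hl r hr')) fun d _ => hle d
      linarith
    rcases hterm l hl r hr' p hp' with h | h
    · exact absurd ⟨h1, h2⟩ h.2
    · omega

/-- For softmax, dividing a score of at most `-1` by the temperature `1/2` saturates at `-3/2`,
whose exponential rounds to zero, while the score `0` has weight `1`. For average hard attention,
the existence of a match makes `0` the maximal score. Both variants therefore give the indicator of
a match. -/
theorem rawWeight_spec (κ : Attention) {vis : Fin n → Prop} (hvis : ∀ j, vis j) {sc : Fin n → Fx 1}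
    {M : Fin n → Prop} (hsc : ∀ j, ((sc j).mant = 0 ∧ M j) ∨ ((sc j).mant ≤ -2 ∧ ¬ M j))
    (hM : ∃ j, M j) (j : Fin n) :
    (rawWeight κ (ofMant 1) vis sc j).mant = open Classical in if M j then 2 else 0 := by
  classical
  have htau : (ofMant 1).mant = 1 := rfl
  unfold rawWeight
  rw [if_pos (hvis j)]
  cases κ with
  | softmax =>
    dsimp only
    rcases hsc j with ⟨h, hMj⟩ | ⟨h, hMj⟩
    · rw [if_pos hMj, exp_mant_zero]
      rw [div_mant _ _ (by rw [htau]; norm_num), h, rq_zero]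
    · rw [if_neg hMj, exp_mant_min]
      rw [div_mant _ _ (by rw [htau]; norm_num), htau]
      have := (sc j).mant_le
      generalize (sc j).mant = z at h this
      have : z = -2 ∨ z = -3 := by omega
      rcases this with rfl | rfl <;> rfl
  | averageHard =>
    dsimp only
    have hval : ∀ x y : Fx 1, x.val ≤ y.val ↔ x.mant ≤ y.mant := by
      intro x y
      rw [Fx.val_one, Fx.val_one, div_le_div_iff_of_pos_right (by norm_num)]
      exact_mod_cast Iff.rfl
    have hone : (Fx.rnd 1 1).mant = 2 := by
      have := rnd_natCast_mant 1
      rw [Nat.cast_one] at this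
      rw [this]
      rfl
    obtain ⟨k, hk⟩ := hM
    have hk0 : (sc k).mant = 0 := by
      rcases hsc k with h | h
      · exact h.1
      · exact absurd hk h.2
    rcases hsc j with ⟨h, hMj⟩ | ⟨h, hMj⟩
    · rw [if_pos hMj, if_pos, hone]
      intro m _
      rw [hval, h]
      rcases hsc m with h | h <;> omega
    · rw [if_neg hMj, if_neg, zero_mant]
      intro hall
      have := hall k (hvis k)
      rw [hval, hk0] at this
      omega

theorem denominator_spec (κ : Attention) {vis : Fin n → Prop} (hvis : ∀ j, vis j)
    {sc : Fin n → Fx 1} {M : Fin n → Prop}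
    (hsc : ∀ j, ((sc j).mant = 0 ∧ M j) ∨ ((sc j).mant ≤ -2 ∧ ¬ M j)) (hM : ∃ j, M j) :
    (denominator κ (ofMant 1) vis sc).mant = 2 ∨ (denominator κ (ofMant 1) vis sc).mant = 3 := by
  classical
  have hraw := rawWeight_spec κ hvis hsc hM
  have hnn : ∀ j, 0 ≤ (rawWeight κ (ofMant 1) vis sc j).mant := by
    intro j
    rw [hraw]
    split_ifs <;> norm_num
  obtain ⟨k, hk⟩ := hM
  have h1 := Finset.single_le_sum (fun j _ => hnn j) (Finset.mem_univ k)
  rw [hraw k, if_pos hk] at h1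
  rw [denominator, sum_mant_nonneg _ hnn]
  omega

/-- However many positions match, the denominator saturates at `3/2`, so a matching weight is `1`,
or `2/3` rounded to `1/2`. Normalization to total weight one is lost, but only the sign matters. -/
theorem weight_spec (κ : Attention) {vis : Fin n → Prop} (hvis : ∀ j, vis j) {sc : Fin n → Fx 1}
    {M : Fin n → Prop} (hsc : ∀ j, ((sc j).mant = 0 ∧ M j) ∨ ((sc j).mant ≤ -2 ∧ ¬ M j))
    (hM : ∃ j, M j) (j : Fin n) :
    0 ≤ (weight κ (ofMant 1) vis sc j).mant ∧ (0 < (weight κ (ofMant 1) vis sc j).mant ↔ M j) := by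
  classical
  have hden := denominator_spec κ hvis hsc hM
  rw [weight, div_mant _ _ (by omega), rawWeight_spec κ hvis hsc hM]
  by_cases hj : M j <;> rcases hden with h | h <;> simp only [hj, h, if_true, if_false] <;> decide

theorem vecMul_wv_none (x : Fin (W * 46) → Fx 1) {l r : ℕ} (hl : l < W) (hr : r < 46)
    (hs : s.val (r / 2) = none) :
    (Fx.vecMul x (sliceMat (W * 46) s.wv) (coord l hl r hr)).mant = 0 := by
  rw [vecMul_single x s.wv hl hr (r₀ := 0) (by norm_num) (z := 0) (by norm_num) fun r' _ => by
    simp [LayerSpec.wv, hs], mul_zero, rq_zero]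

theorem vecMul_wv_some (x : Fin (W * 46) → Fx 1) {l r a : ℕ} (hl : l < W) (hr : r < 46)
    (hs : s.val (r / 2) = some a) (ha : 2 * a < 46) :
    (Fx.vecMul x (sliceMat (W * 46) s.wv) (coord l hl r hr)).mant =
      if r % 2 = 0 then (x (coord l hl (2 * a) ha)).mant else -(x (coord l hl (2 * a) ha)).mant := by
  have h := vecMul_single x s.wv hl hr ha (z := if r % 2 = 0 then 2 else -2)
    (by split_ifs <;> norm_num) fun r' _ => by simp [LayerSpec.wv, hs]
  rw [h]
  have := (x (coord l hl (2 * a) ha)).mant_le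
  generalize (x (coord l hl (2 * a) ha)).mant = z at this
  obtain ⟨h1, h2⟩ := this
  split_ifs <;> interval_cases z <;> rfl

/-- The output of attention. -/
theorem attend_spec (hs : s.WellFormed) (κ : Attention) (hH : ∀ i, RowSim (H i) (β i)) (i : Fin n)
    (hM : ∃ j, s.Match W β i j) :
    Antisymm ((s.layer (W * 46)).attend κ (ofMant 1) H i) ∧
    ∀ l (hl : l < W) c (hc : 2 * c < 46),
      0 ≤ ((s.layer (W * 46)).attend κ (ofMant 1) H i (coord l hl (2 * c) hc)).mant ∧
      (0 < ((s.layer (W * 46)).attend κ (ofMant 1) H i (coord l hl (2 * c) hc)).mant ↔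
        ∃ a, s.val c = some a ∧ ∃ j, s.Match W β i j ∧ β j l a) := by
  have hvis : ∀ j, (s.layer (W * 46)).vis i j := by
    intro j h
    exact absurd h (by simp [LayerSpec.layer])
  have hw := weight_spec κ hvis (scores_spec hs hH i) hM
  set w := weight κ (ofMant 1) ((s.layer (W * 46)).vis i) ((s.layer (W * 46)).scores H i) with hwdef
  set v : Fin n → Fin (W * 46) → Fx 1 := fun j => Fx.vecMul (H j) (sliceMat (W * 46) s.wv) with hv
  have hatt : ∀ d, (s.layer (W * 46)).attend κ (ofMant 1) H i d =
      Fx.sum (List.ofFn fun j => Fx.mul (w j) (v j d)) := fun d => rfl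
  have heven : ∀ l (hl : l < W) c (hc : 2 * c < 46) j, 0 ≤ (v j (coord l hl (2 * c) hc)).mant ∧
      (0 < (v j (coord l hl (2 * c) hc)).mant ↔ ∃ a, s.val c = some a ∧ β j l a) := by
    intro l hl c hc j
    have h2 : 2 * c / 2 = c := by omega
    cases hc' : s.val c with
    | none =>
      rw [hv]
      dsimp only
      rw [vecMul_wv_none _ hl hc (by rw [h2, hc'])]
      simp
    | some a =>
      have ha : 2 * a < 46 := by have := hs.val_lt c a hc'; omega
      rw [hv]
      dsimp only
      rw [vecMul_wv_some _ hl hc (by rw [h2, hc']) ha, if_pos (by omega)]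
      exact ⟨(hH j).nonneg l hl a ha, by simp [(hH j).pos_iff l hl a ha]⟩
  have hodd : ∀ l (hl : l < W) c (hc : 2 * c < 46) (hc' : 2 * c + 1 < 46) j,
      (v j (coord l hl (2 * c + 1) hc')).mant = -(v j (coord l hl (2 * c) hc)).mant := by
    intro l hl c hc hc' j
    have h2 : 2 * c / 2 = c := by omega
    have h3 : (2 * c + 1) / 2 = c := by omega
    rw [hv]
    dsimp only
    cases hcv : s.val c with
    | none =>
      rw [vecMul_wv_none _ hl hc (by rw [h2, hcv]), vecMul_wv_none _ hl hc' (by rw [h3, hcv])]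
      rfl
    | some a =>
      have ha : 2 * a < 46 := by have := hs.val_lt c a hcv; omega
      rw [vecMul_wv_some _ hl hc (by rw [h2, hcv]) ha, if_pos (by omega),
        vecMul_wv_some _ hl hc' (by rw [h3, hcv]) ha, if_neg (by omega)]
  have hnn : ∀ l (hl : l < W) c (hc : 2 * c < 46) j,
      0 ≤ (Fx.mul (w j) (v j (coord l hl (2 * c) hc))).mant := by
    intro l hl c hc j
    rw [mul_mant]
    exact rq_four_nonneg (mul_nonneg (hw j).1 (heven l hl c hc j).1)
  constructor
  · intro d e hd he
    obtain ⟨l, hl, r, hr, rfl⟩ := exists_coord d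
    simp only [coord] at hd he
    obtain ⟨c, rfl⟩ : ∃ c, r = 2 * c := ⟨r / 2, by omega⟩
    have hc' : 2 * c + 1 < 46 := by omega
    obtain rfl : e = coord l hl (2 * c + 1) hc' := Fin.ext (by simp only [coord]; omega)
    have hneg : ∀ j, (Fx.mul (w j) (v j (coord l hl (2 * c + 1) hc'))).mant =
        -(Fx.mul (w j) (v j (coord l hl (2 * c) hr))).mant := by
      intro j
      rw [mul_mant, mul_mant, hodd l hl c hr hc' j, mul_neg, rq_four_neg]
    -- The sums for a channel and for its shadow saturate at opposite bounds, so they remain exact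
    -- negatives of each other.
    rw [hatt, hatt, sum_mant_nonneg _ (hnn l hl c hr), sum_mant_nonpos _ fun j => by
      rw [hneg]; have := hnn l hl c hr j; omega]
    simp only [hneg, Finset.sum_neg_distrib]
    omega
  · intro l hl c hc
    rw [hatt, sum_mant_nonneg _ (hnn l hl c hc)]
    have h0 := Finset.sum_nonneg fun j (_ : j ∈ Finset.univ) => hnn l hl c hc j
    refine ⟨by omega, ?_⟩
    -- A saturated sum of non-negative terms is positive iff one of them is: averaging has become
    -- disjunction.
    have : (0 < min 3 (∑ j, (Fx.mul (w j) (v j (coord l hl (2 * c) hc))).mant)) ↔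
        ∃ j, 0 < (Fx.mul (w j) (v j (coord l hl (2 * c) hc))).mant := by
      constructor
      · intro h
        by_contra! hall
        have := Finset.sum_nonpos fun j (_ : j ∈ Finset.univ) => hall j
        omega
      · rintro ⟨j, hj⟩
        have := Finset.single_le_sum (fun j _ => hnn l hl c hc j) (Finset.mem_univ j)
        omega
    rw [this]
    constructor
    · rintro ⟨j, hj⟩
      rw [mul_mant] at hj
      have hv0 := (heven l hl c hc j).1
      have hw0 := (hw j).1
      have hvp : 0 < (v j (coord l hl (2 * c) hc)).mant := by
        rcases hv0.lt_or_eq with h | h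
        · exact h
        · rw [← h, mul_zero, rq_zero] at hj
          exact absurd hj (lt_irrefl _)
      have hwp : 0 < (w j).mant := by
        rcases hw0.lt_or_eq with h | h
        · exact h
        · rw [← h, zero_mul, rq_zero] at hj
          exact absurd hj (lt_irrefl _)
      obtain ⟨a, ha, hβ⟩ := (heven l hl c hc j).2.1 hvp
      exact ⟨a, ha, j, (hw j).2.1 hwp, hβ⟩
    · rintro ⟨a, ha, j, hj, hβ⟩
      refine ⟨j, ?_⟩
      rw [mul_mant]
      exact rq_four_pos (mul_pos ((hw j).2.2 hj) ((heven l hl c hc j).2.2 ⟨a, ha, hβ⟩))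

end Attention

/-! ### The feed-forward networks -/

section FeedForward

variable {W n : ℕ} {s : LayerSpec}

/-- The order of summation matters. The constant channel is coordinate `0` of its slice, so its
`-3/2` is added before the inputs; two strong inputs added first would saturate at `3/2` and then be
cancelled completely. -/
theorem vecMul_and {x : Fin (W * 46) → Fx 1} {P : ℕ → ℕ → Prop} (hx : RowSim x P) {l c a b : ℕ}
    (hl : l < W) (hc : c < 46) (hg : s.gate c = .and a b) (hab : (Gate.and a b).WellFormed)
    (ha : 2 * a < 46) (hb : 2 * b < 46) :
    (Fx.vecMul x (sliceMat (W * 46) s.w₁) (coord l hl c hc)).mant =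
      min 3 (-3 + rq ((x (coord l hl (2 * a) ha)).mant * 3) 4 +
        rq ((x (coord l hl (2 * b) hb)).mant * 3) 4) := by
  obtain ⟨h1, h2, h3, -, -⟩ := hab
  have hne1 : coord l hl (2 * a) ha ≠ coord l hl 0 (by norm_num) := by
    simp only [coord, ne_eq, Fin.mk.injEq]; omega
  have hne2 : coord l hl (2 * b) hb ≠ coord l hl 0 (by norm_num) := by
    simp only [coord, ne_eq, Fin.mk.injEq]; omega
  have hne3 : coord l hl (2 * a) ha ≠ coord l hl (2 * b) hb := by
    simp only [coord, ne_eq, Fin.mk.injEq]; omega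
  have hterm : ∀ i, (Fx.mul (x i) (sliceMat (W * 46) s.w₁ i (coord l hl c hc))).mant =
      (if i = coord l hl 0 (by norm_num) then -3 else 0) +
      (if i = coord l hl (2 * a) ha then rq ((x (coord l hl (2 * a) ha)).mant * 3) 4 else 0) +
      (if i = coord l hl (2 * b) hb then rq ((x (coord l hl (2 * b) hb)).mant * 3) 4 else 0) := by
    intro i
    by_cases e0 : i = coord l hl 0 (by norm_num)
    · subst e0
      rw [if_pos rfl, if_neg hne1.symm, if_neg hne2.symm, mul_mant, sliceMat, coord_div, coord_mod,
        coord_div, coord_mod, if_pos rfl, hx.one l hl]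
      simp only [LayerSpec.w₁, hg, if_true]
      rfl
    rw [if_neg e0]
    by_cases ea : i = coord l hl (2 * a) ha
    · subst ea
      rw [if_pos rfl, if_neg hne3, mul_mant, sliceMat, coord_div, coord_mod,
        coord_div, coord_mod, if_pos rfl]
      have : 2 * a ≠ 0 := by omega
      simp only [LayerSpec.w₁, hg, this, if_false, true_or, if_true]
      rw [ofMant_mant (by norm_num)]
      ring
    rw [if_neg ea]
    by_cases eb : i = coord l hl (2 * b) hb
    · subst eb
      rw [if_pos rfl, mul_mant, sliceMat, coord_div, coord_mod,
        coord_div, coord_mod, if_pos rfl]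
      have : 2 * b ≠ 0 := by omega
      simp only [LayerSpec.w₁, hg, this, if_false, or_true, if_true]
      rw [ofMant_mant (by norm_num)]
      ring
    rw [if_neg eb, mul_mant]
    have hz : (sliceMat (W * 46) s.w₁ i (coord l hl c hc)).mant = 0 := by
      rw [sliceMat, coord_div, coord_mod]
      split_ifs with h
      · have g0 : i.val % 46 ≠ 0 := fun h' => e0 (eq_coord _ _ h h')
        have ga : i.val % 46 ≠ 2 * a := fun h' => ea (eq_coord _ _ h h')
        have gb : i.val % 46 ≠ 2 * b := fun h' => eb (eq_coord _ _ h h')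
        simp only [LayerSpec.w₁, hg, g0, ga, gb, or_self, if_false]
        rfl
      · rfl
    rw [hz, mul_zero, rq_zero]
    rfl
  have hpa := rq_four_nonneg (mul_nonneg (hx.nonneg l hl a ha) (by norm_num : (0 : ℤ) ≤ 3))
  have hpb := rq_four_nonneg (mul_nonneg (hx.nonneg l hl b hb) (by norm_num : (0 : ℤ) ≤ 3))
  rw [Fx.vecMul, Fx.dot, sum_mant_mixed _ (coord l hl 0 (by norm_num))]
  · simp only [hterm, Finset.sum_add_distrib, Finset.sum_ite_eq', Finset.mem_univ, if_true]
  · intro i hi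
    rw [Fin.lt_def] at hi
    have k0 : i ≠ coord l hl 0 (by norm_num) := by
      rw [ne_eq, Fin.ext_iff]; omega
    have ka : i ≠ coord l hl (2 * a) ha := by
      rw [ne_eq, Fin.ext_iff]; simp only [coord] at hi ⊢; omega
    have kb : i ≠ coord l hl (2 * b) hb := by
      rw [ne_eq, Fin.ext_iff]; simp only [coord] at hi ⊢; omega
    rw [hterm, if_neg k0, if_neg ka, if_neg kb]
    rfl
  · intro i hi
    rw [hterm, if_neg (ne_of_gt hi)]
    split_ifs <;> omega

/-- The hidden units compute the gates. -/
theorem hidden_spec (hs : s.WellFormed) {x : Fin (W * 46) → Fx 1} {P : ℕ → ℕ → Prop}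
    (hx : RowSim x P) {l c : ℕ} (hl : l < W) (hc : c < 46) {h : Fx 1}
    (hh : h = Fx.relu (Fx.add (Fx.vecMul x (sliceMat (W * 46) s.w₁) (coord l hl c hc))
      (sliceVec (W * 46) s.c₁ (coord l hl c hc)))) :
    0 ≤ h.mant ∧ (0 < h.mant ↔ (s.gate c).Holds (P l)) := by
  subst hh
  rw [relu_mant, add_mant, sliceVec, coord_mod]
  refine ⟨le_max_right _ _, ?_⟩
  have hwf := hs.gate_wf c
  cases hg : s.gate c with
  | none =>
    rw [vecMul_single x s.w₁ hl hc (r₀ := 0) (by norm_num) (z := 0) (by norm_num) fun r' _ => by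
      simp [LayerSpec.w₁, hg], mul_zero, rq_zero]
    simp only [LayerSpec.c₁, hg, Gate.Holds, iff_false]
    decide
  | not a =>
    rw [hg] at hwf
    have ha : 2 * a < 46 := by have : a < 23 := hwf; omega
    rw [vecMul_single x s.w₁ hl hc ha (z := -3) (by norm_num) fun r' _ => by
      simp [LayerSpec.w₁, hg]]
    simp only [LayerSpec.c₁, hg, Gate.Holds]
    rw [← hx.pos_iff l hl a ha]
    have h0 := hx.nonneg l hl a ha
    have h3 := (x (coord l hl (2 * a) ha)).mant_le.2
    generalize (x (coord l hl (2 * a) ha)).mant = z at h0 h3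
    interval_cases z <;> decide
  | and a b =>
    rw [hg] at hwf
    have ha : 2 * a < 46 := by have := hwf.2.2.2.1; omega
    have hb : 2 * b < 46 := by have := hwf.2.2.2.2; omega
    rw [vecMul_and hx hl hc hg hwf ha hb]
    simp only [LayerSpec.c₁, hg, Gate.Holds]
    rw [← hx.pos_iff l hl a ha, ← hx.pos_iff l hl b hb]
    have h0 := hx.nonneg l hl a ha
    have h3 := (x (coord l hl (2 * a) ha)).mant_le.2
    have h0' := hx.nonneg l hl b hb
    have h3' := (x (coord l hl (2 * b) hb)).mant_le.2
    generalize (x (coord l hl (2 * a) ha)).mant = z at h0 h3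
    generalize (x (coord l hl (2 * b) hb)).mant = z' at h0' h3'
    interval_cases z <;> interval_cases z' <;> decide

theorem ffn_spec (hs : s.WellFormed) {x : Fin (W * 46) → Fx 1} {P : ℕ → ℕ → Prop}
    (hx : RowSim x P) :
    Antisymm ((s.layer (W * 46)).ffn x) ∧ ∀ l (hl : l < W) c (hc : 2 * c < 46),
      0 ≤ ((s.layer (W * 46)).ffn x (coord l hl (2 * c) hc)).mant ∧
      (0 < ((s.layer (W * 46)).ffn x (coord l hl (2 * c) hc)).mant ↔
        (s.gate c).Holds (P l)) := by
  set hid : Fin (W * 46) → Fx 1 := fun e => Fx.relu (Fx.add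
    (Fx.vecMul x (sliceMat (W * 46) s.w₁) e) (sliceVec (W * 46) s.c₁ e)) with hhid
  have hffn : ∀ l (hl : l < W) r (hr : r < 46) (hr' : r / 2 < 46),
      ((s.layer (W * 46)).ffn x (coord l hl r hr)).mant =
        if r % 2 = 0 then (hid (coord l hl (r / 2) hr')).mant
        else -(hid (coord l hl (r / 2) hr')).mant := by
    intro l hl r hr hr'
    have h := vecMul_single hid shadowW₂ hl hr hr' (z := if r % 2 = 0 then 2 else -2)
      (by split_ifs <;> norm_num) fun r' _ => by simp [shadowW₂]
    have h2 : ((s.layer (W * 46)).ffn x (coord l hl r hr)) =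
        Fx.add (Fx.vecMul hid (sliceMat (W * 46) shadowW₂) (coord l hl r hr))
          (ofMant 0) := rfl
    rw [h2, add_mant, h]
    have := (hid (coord l hl (r / 2) hr')).mant_le
    generalize (hid (coord l hl (r / 2) hr')).mant = z at this
    obtain ⟨h1, h2⟩ := this
    split_ifs <;> interval_cases z <;> rfl
  constructor
  · intro d e hd he
    obtain ⟨l, hl, r, hr, rfl⟩ := exists_coord d
    simp only [coord] at hd he
    obtain ⟨c, rfl⟩ : ∃ c, r = 2 * c := ⟨r / 2, by omega⟩
    have hc' : 2 * c + 1 < 46 := by omega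
    obtain rfl : e = coord l hl (2 * c + 1) hc' := Fin.ext (by simp only [coord]; omega)
    rw [hffn l hl _ hc' (by omega), hffn l hl _ hr (by omega), if_neg (by omega),
      if_pos (by omega)]
    congr 4
    omega
  · intro l hl c hc
    have h2 : 2 * c / 2 = c := by omega
    have hc' : c < 46 := by omega
    rw [hffn l hl _ hc (by omega), if_pos (by omega)]
    simp only [h2]
    exact hidden_spec hs hx hl hc' rfl

end FeedForward

/-- A layer computes its abstract semantics. -/
theorem layer_spec {W n : ℕ} {s : LayerSpec} (hs : s.WellFormed) (κ : Attention)
    {H : Fin n → Fin (W * 46) → Fx 1} {β : Fin n → ℕ → ℕ → Prop}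
    (hH : ∀ i, RowSim (H i) (β i)) (hM : ∀ i, ∃ j, s.Match W β i j) :
    ∃ H', (s.layer (W * 46)).eval κ (ofMant 1) H = some H' ∧
      ∀ i, RowSim (H' i) (s.after W β i) := by
  have hW : W * 46 % 2 = 0 := by omega
  have hatt := fun i => attend_spec hs κ hH i (hM i)
  have hn1 := fun i => pairNorm_spec hW (hatt i).1
  have hzero : ∀ {z : ℤ}, 0 ≤ z → ¬ 0 < z → z = 0 := by
    intro z h1 h2
    omega
  have hmid : ∀ i, RowSim ((s.layer (W * 46)).mid κ (ofMant 1) H i) (s.afterAttention W β i) := by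
    intro i
    have hm : ∀ d, ((s.layer (W * 46)).mid κ (ofMant 1) H i d).mant =
        clip (((s.layer (W * 46)).attend κ (ofMant 1) H i d).mant + (H i d).mant) := by
      intro d
      rw [← (hn1 i).2 d, ← add_mant]
      rfl
    refine ⟨fun l hl c hc => ?_, fun l hl c hc => ?_, fun l hl => ?_⟩
    · rw [hm, clip]
      have h1 := ((hatt i).2 l hl c hc).1
      have h2 := (hH i).nonneg l hl c hc
      omega
    · have h1 := ((hatt i).2 l hl c hc)
      have h2 := (hH i).nonneg l hl c hc
      rw [hm, LayerSpec.afterAttention, ← h1.2, ← (hH i).pos_iff l hl c hc, clip]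
      have := h1.1
      omega
    -- Positivity is not enough for the constant channel, since it serves as the bias of the
    -- conjunctions. It stays exactly `1` because nothing is ever added to it.
    · have h1 := ((hatt i).2 l hl 0 (by norm_num))
      rw [hs.val_zero] at h1
      have h2 := hzero h1.1 (by rw [h1.2]; simp)
      have h3 := (hH i).one l hl
      rw [hm]
      simp only [Nat.mul_zero] at h2
      rw [h2, h3]
      rfl
  have hffn := fun i => ffn_spec hs (hmid i)
  have hn2 := fun i => pairNorm_spec hW (hffn i).1
  have hsafe : (s.layer (W * 46)).Safe κ (ofMant 1) H := by
    intro i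
    refine ⟨fun h => ?_, (hn1 i).1, (hn2 i).1⟩
    have hvis : ∀ j, (s.layer (W * 46)).vis i j := by
      intro j h
      exact absurd h (by simp [LayerSpec.layer])
    have := denominator_spec κ hvis (scores_spec hs hH i) (hM i)
    rw [h, zero_mant] at this
    omega
  refine ⟨_, if_pos hsafe, fun i => ?_⟩
  have hm : ∀ d, (Fx.add ((s.layer (W * 46)).mid κ (ofMant 1) H i d) ((s.layer (W * 46)).norm₂.eval
      ((s.layer (W * 46)).ffn ((s.layer (W * 46)).mid κ (ofMant 1) H i)) d)).mant =
      clip (((s.layer (W * 46)).mid κ (ofMant 1) H i d).mant +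
        ((s.layer (W * 46)).ffn ((s.layer (W * 46)).mid κ (ofMant 1) H i) d).mant) := by
    intro d
    rw [add_mant, ← (hn2 i).2 d]
    rfl
  refine ⟨fun l hl c hc => ?_, fun l hl c hc => ?_, fun l hl => ?_⟩
  · rw [hm, clip]
    have h1 := ((hffn i).2 l hl c hc).1
    have h2 := (hmid i).nonneg l hl c hc
    omega
  · have h1 := ((hffn i).2 l hl c hc)
    have h2 := (hmid i).nonneg l hl c hc
    rw [hm, LayerSpec.after, ← h1.2, ← (hmid i).pos_iff l hl c hc, clip]
    have := h1.1
    omega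
  · have h1 := ((hffn i).2 l hl 0 (by norm_num))
    rw [hs.gate_zero] at h1
    have h2 := hzero h1.1 (by rw [h1.2]; simp [Gate.Holds])
    have h3 := (hmid i).one l hl
    rw [hm]
    simp only [Nat.mul_zero] at h2
    rw [h2, h3]
    rfl

/-! ### Paths of bounded length -/

section Reach

variable {V : Type} (E : V → V → Prop)

/-- There is a path with at most `d` edges. -/
def ReachIn : ℕ → V → V → Prop
  | 0, a, b => a = b
  | d + 1, a, b => ReachIn d a b ∨ ∃ c, ReachIn d a c ∧ E c b

variable {E}

theorem ReachIn.succ {d : ℕ} {a b : V} (h : ReachIn E d a b) : ReachIn E (d + 1) a b := Or.inl h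

theorem ReachIn.mono {d e : ℕ} (hde : d ≤ e) {a b : V} (h : ReachIn E d a b) : ReachIn E e a b := by
  induction hde with
  | refl => exact h
  | step _ ih => exact ih.succ

theorem reachIn_one {a b : V} : ReachIn E 1 a b ↔ a = b ∨ E a b := by
  simp [ReachIn]

/-- A path is cut after its first part. With `d = e` this is the squaring step of the loop. -/
theorem reachIn_add {d e : ℕ} {a b : V} :
    ReachIn E (d + e) a b ↔ ∃ c, ReachIn E d a c ∧ ReachIn E e c b := by
  induction e generalizing b with
  | zero => simp [ReachIn]
  | succ e ih =>
    rw [← Nat.add_assoc]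
    constructor
    · rintro (h | ⟨c, h, hc⟩)
      · obtain ⟨c, h1, h2⟩ := ih.1 h
        exact ⟨c, h1, Or.inl h2⟩
      · obtain ⟨c', h1, h2⟩ := ih.1 h
        exact ⟨c', h1, Or.inr ⟨c, h2, hc⟩⟩
    · rintro ⟨c, h1, h2 | ⟨c', h2, h3⟩⟩
      · exact Or.inl (ih.2 ⟨c, h1, h2⟩)
      · exact Or.inr ⟨c', ih.2 ⟨c, h1, h2⟩, h3⟩

theorem ReachIn.reflTransGen {d : ℕ} {a b : V} (h : ReachIn E d a b) :
    Relation.ReflTransGen E a b := by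
  induction d generalizing b with
  | zero => exact h ▸ Relation.ReflTransGen.refl
  | succ d ih =>
    rcases h with h | ⟨c, h, hc⟩
    · exact ih h
    · exact (ih h).tail hc

theorem reachIn_stable {d : ℕ} {a : V} (h : ∀ b, ReachIn E (d + 1) a b → ReachIn E d a b) {b : V}
    (hb : Relation.ReflTransGen E a b) : ReachIn E d a b := by
  induction hb with
  | refl => exact ReachIn.mono (Nat.zero_le d) rfl
  | tail _ hc ih => exact h _ (Or.inr ⟨_, ih, hc⟩)

/-- The sets of vertices within distance `d` of `a` grow strictly until they become stationary, and
they cannot grow beyond the number of vertices. Once stationary, they are closed under edges and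
contain everything reachable. -/
theorem reachIn_card [Fintype V] {a b : V} (hb : Relation.ReflTransGen E a b) {d : ℕ}
    (hd : Fintype.card V ≤ d) : ReachIn E d a b := by
  classical
  let S : ℕ → Finset V := fun d => Finset.univ.filter fun b => ReachIn E d a b
  have key : ∀ d, (∃ e ≤ d, ∀ b, ReachIn E (e + 1) a b → ReachIn E e a b) ∨ d + 1 ≤ (S d).card := by
    intro d
    induction d with
    | zero =>
      right
      exact Finset.card_pos.2 ⟨a, Finset.mem_filter.2 ⟨Finset.mem_univ _, rfl⟩⟩
    | succ d ih =>
      rcases ih with ⟨e, he, h⟩ | h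
      · exact Or.inl ⟨e, by omega, h⟩
      · by_cases hst : ∀ b, ReachIn E (d + 1) a b → ReachIn E d a b
        · exact Or.inl ⟨d, by omega, hst⟩
        · right
          push Not at hst
          obtain ⟨b, h1, h2⟩ := hst
          have : S d ⊂ S (d + 1) := by
            refine Finset.ssubset_iff_subset_ne.2 ⟨fun c hc => ?_, fun heq => h2 ?_⟩
            · simp only [S, Finset.mem_filter, Finset.mem_univ, true_and] at hc ⊢
              exact hc.succ
            · have : b ∈ S d := by rw [heq]; simpa [S] using h1
              simpa [S] using this
          have := Finset.card_lt_card this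
          omega
  rcases key d with ⟨e, he, h⟩ | h
  · exact (reachIn_stable h hb).mono he
  · have := Finset.card_le_univ (S d)
    omega

end Reach

/-! ### Positions -/

theorem hasBit_iff {v l : ℕ} : HasBit v l ↔ v.testBit l = true := by
  rw [Nat.testBit_eq_decide_div_mod_eq, HasBit, decide_eq_true_iff]

theorem eq_of_hasBit {W u v : ℕ} (hu : u < 2 ^ W) (hv : v < 2 ^ W)
    (h : ∀ l < W, HasBit u l ↔ HasBit v l) : u = v := by
  refine Nat.eq_of_testBit_eq fun l => ?_
  rcases Nat.lt_or_ge l W with hl | hl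
  · rw [Bool.eq_iff_iff, ← hasBit_iff, ← hasBit_iff, h l hl]
  · rw [Nat.testBit_lt_two_pow (hu.trans_le (Nat.pow_le_pow_right (by norm_num) hl)),
      Nat.testBit_lt_two_pow (hv.trans_le (Nat.pow_le_pow_right (by norm_num) hl))]

section Positions

variable {N : ℕ}

def adjPos (a b : Fin N) : ℕ := a * N + b

def padPos (a b c : Fin N) : ℕ := N * N + ((a * N + b) * N + c)

theorem isAdj_adjPos (a b : Fin N) : IsAdj N (adjPos a b) := by
  unfold IsAdj adjPos
  have ha := a.isLt
  have hb := b.isLt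
  nlinarith

theorem vertI_adjPos (a b : Fin N) : vertI N (adjPos a b) = a := by
  have h : adjPos a b < N * N := isAdj_adjPos a b
  rw [vertI, if_pos h, adjPos, Nat.mul_comm, Nat.mul_add_div (by have := a.isLt; omega),
    Nat.div_eq_of_lt b.isLt, Nat.add_zero]

theorem vertJ_adjPos (a b : Fin N) : vertJ N (adjPos a b) = b := by
  have h : adjPos a b < N * N := isAdj_adjPos a b
  rw [vertJ, if_pos h, adjPos, Nat.mul_comm, Nat.mul_add_mod, Nat.mod_eq_of_lt b.isLt]

theorem exists_adjPos {p : ℕ} (h : IsAdj N p) : ∃ a b : Fin N, p = adjPos a b := by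
  have hN : 0 < N := by
    rcases Nat.eq_zero_or_pos N with rfl | h0
    · exact absurd h (by simp [IsAdj])
    · exact h0
  refine ⟨⟨p / N, (Nat.div_lt_iff_lt_mul hN).2 h⟩, ⟨p % N, Nat.mod_lt _ hN⟩, ?_⟩
  simp only [adjPos]
  rw [Nat.mul_comm]
  exact (Nat.div_add_mod p N).symm

theorem padPos_lt (a b c : Fin N) : (a.val * N + b) * N + c < N * N * N := by
  have h := isAdj_adjPos a b
  unfold IsAdj adjPos at h
  have hc := c.isLt
  nlinarith

theorem isPad_padPos (a b c : Fin N) : IsPad N (padPos a b c) :=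
  ⟨Nat.le_add_right _ _, Nat.add_lt_add_left (padPos_lt a b c) _⟩

theorem padPos_sub (a b c : Fin N) : padPos a b c - N * N = (a * N + b) * N + c :=
  Nat.add_sub_cancel_left _ _

theorem not_adj_padPos (a b c : Fin N) : ¬ padPos a b c < N * N := by
  unfold padPos
  omega

theorem padPos_div (a b c : Fin N) : ((a.val * N + b) * N + c) / N = a * N + b := by
  rw [Nat.mul_comm, Nat.mul_add_div (by have := a.isLt; omega), Nat.div_eq_of_lt c.isLt,
    Nat.add_zero]

theorem vertI_padPos (a b c : Fin N) : vertI N (padPos a b c) = a := by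
  rw [vertI, if_neg (not_adj_padPos a b c), padPos_sub, ← Nat.div_div_eq_div_mul, padPos_div,
    Nat.mul_comm, Nat.mul_add_div (by have := a.isLt; omega), Nat.div_eq_of_lt b.isLt, Nat.add_zero]

theorem vertJ_padPos (a b c : Fin N) : vertJ N (padPos a b c) = b := by
  rw [vertJ, if_neg (not_adj_padPos a b c), padPos_sub, padPos_div, Nat.mul_comm, Nat.mul_add_mod,
    Nat.mod_eq_of_lt b.isLt]

theorem vertK_padPos (a b c : Fin N) : vertK N (padPos a b c) = c := by
  rw [vertK, padPos_sub, Nat.mul_comm, Nat.mul_add_mod, Nat.mod_eq_of_lt c.isLt]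

theorem exists_padPos {p : ℕ} (h : IsPad N p) : ∃ a b c : Fin N, p = padPos a b c := by
  obtain ⟨h1, h2⟩ := h
  have hN : 0 < N := by
    rcases Nat.eq_zero_or_pos N with rfl | h0
    · simp at h2
    · exact h0
  obtain ⟨q, rfl⟩ := Nat.exists_eq_add_of_le h1
  have hq : q / N < N * N := (Nat.div_lt_iff_lt_mul hN).2 (by omega)
  obtain ⟨a, b, hab⟩ := exists_adjPos (N := N) (p := q / N) hq
  refine ⟨a, b, ⟨q % N, Nat.mod_lt _ hN⟩, ?_⟩
  rw [adjPos] at hab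
  rw [padPos, ← hab, Nat.mul_comm (q / N)]
  simp only
  rw [Nat.div_add_mod]

theorem connLen_eq : connLen N = N * N + N * N * N + 2 * (Nat.clog 2 N + 1) := by
  rw [connLen]
  ring

end Positions

/-! ### Matching of vertices -/

section Match

variable {n : ℕ} {N W : ℕ} {β : Fin n → ℕ → ℕ → Prop}

/-- The channels `c` and `c + 1` of position `i` hold the bits of `v` and their complements. -/
def Field (W : ℕ) (β : Fin n → ℕ → ℕ → Prop) (i : Fin n) (c v : ℕ) : Prop :=
  ∀ l < W, (β i l c ↔ HasBit v l) ∧ (β i l (c + 1) ↔ ¬ HasBit v l)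

/-- The channels `c` and `c + 1` of position `i` are empty. -/
def Wild (W : ℕ) (β : Fin n → ℕ → ℕ → Prop) (i : Fin n) (c : ℕ) : Prop :=
  ∀ l < W, ¬ β i l c ∧ ¬ β i l (c + 1)

/-- No bit of the field `q` of `i` differs from that of the field `k` of `j`. -/
def Agree (W : ℕ) (β : Fin n → ℕ → ℕ → Prop) (i j : Fin n) (q k : ℕ) : Prop :=
  ∀ l < W, ¬ (β i l q ∧ β j l (k + 1)) ∧ ¬ (β i l (q + 1) ∧ β j l k)

/-- Attention can only forbid that two channels are both active. Testing bit against complement and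
complement against bit turns this into equality of bits. -/
theorem Field.agree_iff {i j : Fin n} {q k u v : ℕ} (hi : Field W β i q u) (hj : Field W β j k v)
    (hu : u < 2 ^ W) (hv : v < 2 ^ W) : Agree W β i j q k ↔ u = v := by
  constructor
  · intro h
    refine eq_of_hasBit hu hv fun l hl => ?_
    have h1 := hi l hl
    have h2 := hj l hl
    have h3 := h l hl
    rw [h1.1, h1.2, h2.1, h2.2] at h3
    tauto
  · rintro rfl l hl
    have h1 := hi l hl
    have h2 := hj l hl
    rw [h1.1, h1.2, h2.1, h2.2]
    tauto

/-- Positions that carry no vertex in the queried field also perform every layer. Their empty query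
matches every key, which keeps their attention defined. -/
theorem Wild.agree {i j : Fin n} {q k : ℕ} (hi : Wild W β i q) : Agree W β i j q k := by
  intro l hl
  have := hi l hl
  tauto

/-- The first four pairs compare two vertices. The pair `(0, m)` restricts the type of the attended
position: channel `0` is always active, so positions with channel `m` active are excluded. -/
theorem match_iff {s : LayerSpec} {q₁ k₁ q₂ k₂ m : ℕ}
    (hs : s.att = [(q₁, k₁ + 1), (q₁ + 1, k₁), (q₂, k₂ + 1), (q₂ + 1, k₂), (0, m)]) {i j : Fin n}
    (hone : ∀ l < W, β i l 0) (hW : 0 < W) {Q : Prop} (hm : ∀ l < W, β j l m ↔ ¬ Q) :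
    s.Match W β i j ↔ Agree W β i j q₁ k₁ ∧ Agree W β i j q₂ k₂ ∧ Q := by
  unfold LayerSpec.Match Agree
  rw [hs]
  simp only [List.mem_cons, List.not_mem_nil, or_false, forall_eq_or_imp, forall_eq]
  constructor
  · intro h
    refine ⟨fun l hl => ⟨(h l hl).1, (h l hl).2.1⟩, fun l hl => ⟨(h l hl).2.2.1, (h l hl).2.2.2.1⟩, ?_⟩
    by_contra hQ
    exact (h 0 hW).2.2.2.2 ⟨hone 0 hW, (hm 0 hW).2 hQ⟩
  · rintro ⟨h1, h2, h3⟩ l hl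
    exact ⟨(h1 l hl).1, (h1 l hl).2, (h2 l hl).1, (h2 l hl).2, fun h => (hm l hl).1 h.2 h3⟩

end Match

/-! ### Running a list of layers -/

section Computes

variable {n W : ℕ}

theorem LayerSpec.after_of_none {s : LayerSpec} {β : Fin n → ℕ → ℕ → Prop} {c : ℕ}
    (hv : s.val c = none) (hg : s.gate c = .none) (i : Fin n) (l : ℕ) :
    s.after W β i l c ↔ β i l c := by
  simp [LayerSpec.after, LayerSpec.afterAttention, hv, hg, Gate.Holds]

theorem LayerSpec.after_of_val {s : LayerSpec} {β : Fin n → ℕ → ℕ → Prop} {c a : ℕ}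
    (hv : s.val c = some a) (hg : s.gate c = .none) (i : Fin n) (l : ℕ) :
    s.after W β i l c ↔ β i l c ∨ ∃ j, s.Match W β i j ∧ β j l a := by
  simp [LayerSpec.after, LayerSpec.afterAttention, hv, hg, Gate.Holds]

theorem LayerSpec.afterAttention_of_none {s : LayerSpec} {β : Fin n → ℕ → ℕ → Prop} {c : ℕ}
    (hv : s.val c = none) (i : Fin n) (l : ℕ) : s.afterAttention W β i l c ↔ β i l c := by
  simp [LayerSpec.afterAttention, hv]

theorem LayerSpec.afterAttention_of_val {s : LayerSpec} {β : Fin n → ℕ → ℕ → Prop} {c a : ℕ}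
    (hv : s.val c = some a) (i : Fin n) (l : ℕ) :
    s.afterAttention W β i l c ↔ β i l c ∨ ∃ j, s.Match W β i j ∧ β j l a := by
  simp [LayerSpec.afterAttention, hv]

/-- The layers `L` turn the activations `β` into `γ`, and every position always finds a match. -/
inductive Computes (W : ℕ) : List LayerSpec → (Fin n → ℕ → ℕ → Prop) → (Fin n → ℕ → ℕ → Prop) → Prop
  | nil (β) : Computes W [] β β
  | cons {s L β γ} (hs : s.WellFormed) (hM : ∀ i, ∃ j, s.Match W β i j)
      (h : Computes W L (s.after W β) γ) : Computes W (s :: L) β γ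

theorem Computes.append {L L' : List LayerSpec} {β γ δ : Fin n → ℕ → ℕ → Prop}
    (h : Computes W L β γ) (h' : Computes W L' γ δ) : Computes W (L ++ L') β δ := by
  induction h with
  | nil => exact h'
  | cons hs hM _ ih => exact .cons hs hM (ih h')

theorem Computes.evalLayers {L : List LayerSpec} {β γ : Fin n → ℕ → ℕ → Prop}
    (h : Computes W L β γ) (κ : Attention) {H : Fin n → Fin (W * 46) → Fx 1}
    (hH : ∀ i, RowSim (H i) (β i)) :
    ∃ H', evalLayers κ (ofMant 1) (L.map (LayerSpec.layer (W * 46))) H = some H' ∧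
      ∀ i, RowSim (H' i) (γ i) := by
  induction h generalizing H with
  | nil => exact ⟨H, rfl, hH⟩
  | cons hs hM _ ih =>
    obtain ⟨H₁, h1, h2⟩ := layer_spec hs κ hH hM
    obtain ⟨H', h3, h4⟩ := ih h2
    exact ⟨H', by rw [List.map_cons, LPT.evalLayers, h1, Option.bind_some, h3], h4⟩

end Computes

/-! ### Well-formedness of the six layers -/

theorem specEdge_wf : specEdge.WellFormed where
  length_att := by decide
  att_lt := by decide
  val_lt c a := by unfold specEdge; dsimp only; split_ifs <;> simp; omega
  gate_wf c := by unfold specEdge; dsimp only; split_ifs <;> simp [Gate.WellFormed]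
  val_zero := rfl
  gate_zero := rfl

theorem specGather_wf : specGather.WellFormed where
  length_att := by decide
  att_lt := by decide
  val_lt c a := by unfold specGather; dsimp only; split_ifs <;> simp <;> omega
  gate_wf c := by unfold specGather; dsimp only; split_ifs <;> simp [Gate.WellFormed]
  val_zero := rfl
  gate_zero := rfl

theorem specLeft_wf : specLeft.WellFormed where
  length_att := by decide
  att_lt := by decide
  val_lt c a := by unfold specLeft; dsimp only; split_ifs <;> simp; omega
  gate_wf _ := trivial
  val_zero := rfl
  gate_zero := rfl

theorem specRight_wf : specRight.WellFormed where
  length_att := by decide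
  att_lt := by decide
  val_lt c a := by unfold specRight; dsimp only; split_ifs <;> simp; omega
  gate_wf c := by unfold specRight; dsimp only; split_ifs <;> simp [Gate.WellFormed]
  val_zero := rfl
  gate_zero := rfl

theorem specJoin_wf : specJoin.WellFormed where
  length_att := by decide
  att_lt := by decide
  val_lt c a := by unfold specJoin; dsimp only; split_ifs <;> simp; omega
  gate_wf _ := trivial
  val_zero := rfl
  gate_zero := rfl

theorem specAnswer_wf : specAnswer.WellFormed where
  length_att := by decide
  att_lt := by decide
  val_lt c a := by unfold specAnswer; dsimp only; split_ifs <;> simp; omega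
  gate_wf _ := trivial
  val_zero := rfl
  gate_zero := rfl

/-! ### The activations of the input -/

section Static

variable {N n : ℕ} {one : ℕ → Prop} {γ : Fin n → ℕ → ℕ → Prop}

/-- The activations before the first layer, where `one` tells which symbols are `1`. -/
def inputActive (N : ℕ) (one : ℕ → Prop) (p l c : ℕ) : Prop :=
  posActive N p l c ∨ c = 11 ∧ one p

/-- The channels of the input are intact. -/
def Static (N : ℕ) (one : ℕ → Prop) (γ : Fin n → ℕ → ℕ → Prop) : Prop :=
  ∀ i l, ∀ c ≤ 11, γ i l c ↔ inputActive N one i l c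

theorem Static.after {W : ℕ} {s : LayerSpec} (h : Static N one γ) (hv : ∀ c ≤ 11, s.val c = none)
    (hg : ∀ c ≤ 11, s.gate c = .none) : Static N one (s.after W γ) := fun i l c hc => by
  rw [LayerSpec.after_of_none (hv c hc) (hg c hc), h i l c hc]

theorem Static.apply (h : Static N one γ) (i : Fin n) (l : ℕ) {c : ℕ} (hc : c < 11) :
    γ i l c ↔ posActive N i l c := by
  rw [h i l c hc.le, inputActive, or_iff_left]
  omega

theorem Static.zero (h : Static N one γ) (i : Fin n) (l : ℕ) : γ i l 0 :=
  (h.apply i l (by norm_num)).2 trivial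

theorem Static.field_one (h : Static N one γ) (W : ℕ) {i : Fin n} (hi : IsAdj N i ∨ IsPad N i) :
    Field W γ i 1 (vertI N i) := fun l _ => by
  rw [h.apply i l (by norm_num), h.apply i l (by norm_num)]
  simp [posActive, hi]

theorem Static.field_three (h : Static N one γ) (W : ℕ) {i : Fin n} (hi : IsAdj N i ∨ IsPad N i) :
    Field W γ i 3 (vertJ N i) := fun l _ => by
  rw [h.apply i l (by norm_num), h.apply i l (by norm_num)]
  simp [posActive, hi]

theorem Static.field_five (h : Static N one γ) (W : ℕ) {i : Fin n} (hi : IsPad N i) :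
    Field W γ i 5 (vertK N i) := fun l _ => by
  rw [h.apply i l (by norm_num), h.apply i l (by norm_num)]
  simp [posActive, hi]

/-- Every query for a vertex can be answered. -/
def Answerable (N W : ℕ) (γ : Fin n → ℕ → ℕ → Prop) (i : Fin n) (q k : ℕ) : Prop :=
  ∃ v : Fin N, ∀ j, Field W γ j k v → Agree W γ i j q k

theorem Field.answerable {W : ℕ} (hN : N ≤ 2 ^ W) {i : Fin n} {q : ℕ} {v : Fin N}
    (h : Field W γ i q v) (k : ℕ) : Answerable N W γ i q k :=
  ⟨v, fun _ hj => (h.agree_iff hj (v.isLt.trans_le hN) (v.isLt.trans_le hN)).2 rfl⟩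

theorem Wild.answerable {W : ℕ} (hN : 0 < N) {i : Fin n} {q : ℕ} (h : Wild W γ i q) (k : ℕ) :
    Answerable N W γ i q k := ⟨⟨0, hN⟩, fun _ _ => h.agree⟩

theorem Static.answerable (h : Static N one γ) {W : ℕ} (hN : 0 < N) (hW : N ≤ 2 ^ W) (i : Fin n)
    {q : ℕ} (hq : q = 1 ∨ q = 3 ∨ q = 5) (k : ℕ) : Answerable N W γ i q k := by
  by_cases hp : IsPad N i
  · obtain ⟨a, b, c, hi⟩ := exists_padPos hp
    rcases hq with rfl | rfl | rfl
    · have := h.field_one W (Or.inr hp)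
      rw [hi, vertI_padPos] at this
      exact this.answerable hW k
    · have := h.field_three W (Or.inr hp)
      rw [hi, vertJ_padPos] at this
      exact this.answerable hW k
    · have := h.field_five W hp
      rw [hi, vertK_padPos] at this
      exact this.answerable hW k
  by_cases ha : IsAdj N i
  · obtain ⟨a, b, hi⟩ := exists_adjPos ha
    rcases hq with rfl | rfl | rfl
    · have := h.field_one W (Or.inl ha)
      rw [hi, vertI_adjPos] at this
      exact this.answerable hW k
    · have := h.field_three W (Or.inl ha)
      rw [hi, vertJ_adjPos] at this
      exact this.answerable hW k
    · refine Wild.answerable hN (fun l _ => ?_) k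
      rw [h.apply i l (by norm_num), h.apply i l (by norm_num)]
      simp [posActive, hp]
  · refine Wild.answerable hN (fun l _ => ?_) k
    rcases hq with rfl | rfl | rfl <;>
      rw [h.apply i l (by norm_num), h.apply i l (by norm_num)] <;>
      simp [posActive, hp, ha]

/-- Attention to the adjacency positions of a pair of vertices. -/
theorem match_adj (h : Static N one γ) {W : ℕ} (hW0 : 0 < W) (hW : N ≤ 2 ^ W) {s : LayerSpec}
    {q₁ q₂ : ℕ} (hs : s.att = [(q₁, 2), (q₁ + 1, 1), (q₂, 4), (q₂ + 1, 3), (0, 7)]) {i : Fin n}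
    {u v : Fin N} (hu : Field W γ i q₁ u) (hv : Field W γ i q₂ v) (j : Fin n) :
    s.Match W γ i j ↔ j.val = adjPos u v := by
  rw [match_iff (k₁ := 1) (k₂ := 3) hs (fun l _ => h.zero i l) hW0 (Q := IsAdj N j) fun l _ =>
    h.apply j l (by norm_num)]
  have hlt : ∀ w : Fin N, w.val < 2 ^ W := fun w => w.isLt.trans_le hW
  constructor
  · rintro ⟨h1, h2, h3⟩
    have f1 := h.field_one W (Or.inl h3)
    have f2 := h.field_three W (Or.inl h3)
    obtain ⟨a, b, hj⟩ := exists_adjPos h3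
    rw [hj, vertI_adjPos] at f1
    rw [hj, vertJ_adjPos] at f2
    rw [hu.agree_iff f1 (hlt _) (hlt _)] at h1
    rw [hv.agree_iff f2 (hlt _) (hlt _)] at h2
    rw [hj, Fin.ext h1, Fin.ext h2]
  · intro hj
    have h3 : IsAdj N j := hj ▸ isAdj_adjPos u v
    have f1 := h.field_one W (Or.inl h3)
    have f2 := h.field_three W (Or.inl h3)
    rw [hj, vertI_adjPos] at f1
    rw [hj, vertJ_adjPos] at f2
    exact ⟨(hu.agree_iff f1 (hlt _) (hlt _)).2 rfl, (hv.agree_iff f2 (hlt _) (hlt _)).2 rfl, h3⟩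

/-- Attention to the padding positions of a pair of vertices. -/
theorem match_pad (h : Static N one γ) {W : ℕ} (hW0 : 0 < W) (hW : N ≤ 2 ^ W) {s : LayerSpec}
    {q₁ q₂ : ℕ} (hs : s.att = [(q₁, 2), (q₁ + 1, 1), (q₂, 4), (q₂ + 1, 3), (0, 8)]) {i : Fin n}
    {u v : Fin N} (hu : Field W γ i q₁ u) (hv : Field W γ i q₂ v) (j : Fin n) :
    s.Match W γ i j ↔ ∃ c, j.val = padPos u v c := by
  rw [match_iff (k₁ := 1) (k₂ := 3) hs (fun l _ => h.zero i l) hW0 (Q := IsPad N j) fun l _ =>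
    h.apply j l (by norm_num)]
  have hlt : ∀ w : Fin N, w.val < 2 ^ W := fun w => w.isLt.trans_le hW
  constructor
  · rintro ⟨h1, h2, h3⟩
    have f1 := h.field_one W (Or.inr h3)
    have f2 := h.field_three W (Or.inr h3)
    obtain ⟨a, b, c, hj⟩ := exists_padPos h3
    rw [hj, vertI_padPos] at f1
    rw [hj, vertJ_padPos] at f2
    rw [hu.agree_iff f1 (hlt _) (hlt _)] at h1
    rw [hv.agree_iff f2 (hlt _) (hlt _)] at h2
    exact ⟨c, by rw [hj, Fin.ext h1, Fin.ext h2]⟩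
  · rintro ⟨c, hj⟩
    have h3 : IsPad N j := hj ▸ isPad_padPos u v c
    have f1 := h.field_one W (Or.inr h3)
    have f2 := h.field_three W (Or.inr h3)
    rw [hj, vertI_padPos] at f1
    rw [hj, vertJ_padPos] at f2
    exact ⟨(hu.agree_iff f1 (hlt _) (hlt _)).2 rfl, (hv.agree_iff f2 (hlt _) (hlt _)).2 rfl, h3⟩

theorem padPos_lt_length (hn : n = connLen N) (a b c : Fin N) : padPos a b c < n := by
  have := (isPad_padPos a b c).2
  rw [hn, connLen_eq]
  omega

theorem adjPos_lt_length (hn : n = connLen N) (a b : Fin N) : adjPos a b < n := by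
  have : adjPos a b < N * N := isAdj_adjPos a b
  rw [hn, connLen_eq]
  omega

/-- Without any match all softmax weights would round to zero and the normalization would be an
error. So every position, also one whose result is never used, needs some position to attend to. -/
theorem exists_match_adj (h : Static N one γ) (hn : n = connLen N) {W : ℕ} (hW0 : 0 < W)
    {s : LayerSpec} {q₁ q₂ : ℕ}
    (hs : s.att = [(q₁, 2), (q₁ + 1, 1), (q₂, 4), (q₂ + 1, 3), (0, 7)]) {i : Fin n}
    (h1 : Answerable N W γ i q₁ 1) (h2 : Answerable N W γ i q₂ 3) : ∃ j, s.Match W γ i j := by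
  obtain ⟨u, hu⟩ := h1
  obtain ⟨v, hv⟩ := h2
  refine ⟨⟨adjPos u v, adjPos_lt_length hn u v⟩, ?_⟩
  set j : Fin n := ⟨adjPos u v, adjPos_lt_length hn u v⟩ with hj
  have h3 : IsAdj N j := isAdj_adjPos u v
  have f1 := h.field_one W (Or.inl h3)
  have f2 := h.field_three W (Or.inl h3)
  rw [vertI_adjPos] at f1
  rw [vertJ_adjPos] at f2
  exact (match_iff (k₁ := 1) (k₂ := 3) hs (fun l _ => h.zero i l) hW0 (Q := IsAdj N j) fun l _ =>
    h.apply j l (by norm_num)).2 ⟨hu j f1, hv j f2, h3⟩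

theorem exists_match_pad (h : Static N one γ) (hn : n = connLen N) {W : ℕ} (hW0 : 0 < W)
    {s : LayerSpec} {q₁ q₂ : ℕ}
    (hs : s.att = [(q₁, 2), (q₁ + 1, 1), (q₂, 4), (q₂ + 1, 3), (0, 8)]) {i : Fin n}
    (h1 : Answerable N W γ i q₁ 1) (h2 : Answerable N W γ i q₂ 3) : ∃ j, s.Match W γ i j := by
  obtain ⟨u, hu⟩ := h1
  obtain ⟨v, hv⟩ := h2
  refine ⟨⟨padPos u v u, padPos_lt_length hn u v u⟩, ?_⟩
  set j : Fin n := ⟨padPos u v u, padPos_lt_length hn u v u⟩ with hj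
  have h3 : IsPad N j := isPad_padPos u v u
  have f1 := h.field_one W (Or.inr h3)
  have f2 := h.field_three W (Or.inr h3)
  rw [vertI_padPos] at f1
  rw [vertJ_padPos] at f2
  exact (match_iff (k₁ := 1) (k₂ := 3) hs (fun l _ => h.zero i l) hW0 (Q := IsPad N j) fun l _ =>
    h.apply j l (by norm_num)).2 ⟨hu j f1, hv j f2, h3⟩

theorem Static.field_pad (h : Static N one γ) (W : ℕ) {i : Fin n} {a b c : Fin N}
    (hi : i.val = padPos a b c) : Field W γ i 1 a ∧ Field W γ i 3 b ∧ Field W γ i 5 c := by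
  have hp : IsPad N i := hi ▸ isPad_padPos a b c
  have f1 := h.field_one W (Or.inr hp)
  have f2 := h.field_three W (Or.inr hp)
  have f3 := h.field_five W hp
  rw [hi, vertI_padPos] at f1
  rw [hi, vertJ_padPos] at f2
  rw [hi, vertK_padPos] at f3
  exact ⟨f1, f2, f3⟩

end Static

/-! ### The computation on graphs -/

section Graph

variable {N n W : ℕ} {one : ℕ → Prop} {E : Fin N → Fin N → Prop} {s t : Fin N}
  {γ : Fin n → ℕ → ℕ → Prop}

/-- The positions of the symbol `1` in the encoding of a graph and two vertices. -/
structure Encodes (N : ℕ) (one : ℕ → Prop) (E : Fin N → Fin N → Prop) (s t : Fin N) : Prop where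
  adj : ∀ a b, one (adjPos a b) ↔ E a b
  src : ∀ l ≤ Nat.clog 2 N, one (N * N + N * N * N + (Nat.clog 2 N - l)) ↔ HasBit s l
  tgt : ∀ l ≤ Nat.clog 2 N, one (N * N + N * N * N + (2 * Nat.clog 2 N + 1 - l)) ↔ HasBit t l

/-- The state of the computation when paths with at most `d` edges have been found. -/
structure Found (N W : ℕ) (one : ℕ → Prop) (E : Fin N → Fin N → Prop) (s t : Fin N) (d : ℕ)
    (γ : Fin n → ℕ → ℕ → Prop) : Prop where
  static : Static N one γ
  src : ∀ i, Field W γ i 18 s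
  tgt : ∀ i, Field W γ i 20 t
  answer : ∀ i, ∀ l < W, ¬ γ i l 22
  reach : ∀ (i : Fin n) a b c, i.val = padPos a b c → ∀ l < W, γ i l 12 ↔ ReachIn E d a b
  left : ∀ (i : Fin n) a b c, i.val = padPos a b c → ∀ l < W, γ i l 13 → ReachIn E d a c
  right : ∀ (i : Fin n) a b c, i.val = padPos a b c → ∀ l < W, γ i l 14 → ReachIn E d c b
  join : ∀ (i : Fin n) a b c, i.val = padPos a b c → ∀ l < W, γ i l 15 →
    ReachIn E d a c ∧ ReachIn E d c b

/-- In slice `l`, channel `9` marks only the position of digit `l` of `s`, and channel `10` that of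
`t`. Conjunction with the symbol leaves the digits in channels `16` and `17`, so uniform attention
to all positions, which is a disjunction, delivers bit `l` in slice `l` everywhere. The gates of the
second layer then add the complements. -/
theorem computes_pre (hE : Encodes N one E s t) (hn : n = connLen N) (hN : N ≤ 2 ^ Nat.clog 2 N)
    (hW : W = Nat.clog 2 N + 1) : ∃ γ : Fin n → ℕ → ℕ → Prop,
      Computes W [specEdge, specGather] (fun i => inputActive N one i) γ ∧
        Found N W one E s t 1 γ := by
  have hN0 : 0 < N := (Nat.zero_le _).trans_lt s.isLt
  have hW0 : 0 < W := by omega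
  have hNW : N ≤ 2 ^ W := hN.trans (Nat.pow_le_pow_right (by norm_num) (by omega))
  have h0 : Static N one fun i : Fin n => inputActive N one i := fun i l c _ => Iff.rfl
  have hM0 : ∀ i, ∃ j, specEdge.Match W (fun i : Fin n => inputActive N one i) i j := fun i =>
    exists_match_adj h0 hn hW0 rfl (h0.answerable hN0 hNW i (Or.inl rfl) 1)
      (h0.answerable hN0 hNW i (Or.inr (Or.inl rfl)) 3)
  refine ⟨_, .cons specEdge_wf hM0 (.cons specGather_wf (fun i => ⟨i, fun l _ p hp => by
    simp [specGather] at hp⟩) (.nil _)), ?_⟩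
  set γ₁ := specEdge.after W fun i : Fin n => inputActive N one i with hγ₁
  have h1 : Static N one γ₁ := h0.after
    (fun c hc => by unfold specEdge; dsimp only; rw [if_neg]; omega)
    (fun c hc => by unfold specEdge; dsimp only; rw [if_neg, if_neg] <;> omega)
  have h2 : Static N one (specGather.after W γ₁) := h1.after
    (fun c hc => by unfold specGather; dsimp only; rw [if_neg, if_neg] <;> omega)
    (fun c hc => by unfold specGather; dsimp only; rw [if_neg, if_neg] <;> omega)
  have hmatch : ∀ i j, specGather.Match W γ₁ i j := fun i j l _ p hp => by
    simp [specGather] at hp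
  have hlen : ∀ l ≤ Nat.clog 2 N, N * N + N * N * N + (Nat.clog 2 N - l) < n ∧
      N * N + N * N * N + (2 * Nat.clog 2 N + 1 - l) < n := fun l hl => by
    rw [hn, connLen_eq]
    omega
  have h16 : ∀ j l, γ₁ j l 16 ↔ posActive N j l 9 ∧ one j := fun j l => by
    rw [hγ₁, LayerSpec.after, LayerSpec.afterAttention_of_none rfl]
    change _ ∨ (specEdge.afterAttention W _ j l 9 ∧ specEdge.afterAttention W _ j l 11) ↔ _
    rw [LayerSpec.afterAttention_of_none rfl, LayerSpec.afterAttention_of_none rfl]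
    simp [inputActive, posActive]
  have h17 : ∀ j l, γ₁ j l 17 ↔ posActive N j l 10 ∧ one j := fun j l => by
    rw [hγ₁, LayerSpec.after, LayerSpec.afterAttention_of_none rfl]
    change _ ∨ (specEdge.afterAttention W _ j l 10 ∧ specEdge.afterAttention W _ j l 11) ↔ _
    rw [LayerSpec.afterAttention_of_none rfl, LayerSpec.afterAttention_of_none rfl]
    simp [inputActive, posActive]
  have hstay : ∀ c, 12 < c → c ≠ 16 → c ≠ 17 → ∀ i l, ¬ γ₁ i l c := fun c h3 h4 h5 i l => by
    rw [hγ₁, LayerSpec.after_of_none (by unfold specEdge; dsimp only; rw [if_neg]; omega)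
      (by unfold specEdge; dsimp only; rw [if_neg, if_neg] <;> omega)]
    rintro (h6 | h6)
    · unfold posActive at h6
      split at h6 <;> omega
    · omega
  have hs : ∀ i, ∀ l < W, specGather.afterAttention W γ₁ i l 18 ↔ HasBit s l := fun i l hl => by
    rw [LayerSpec.afterAttention_of_val rfl, or_iff_right (hstay 18 (by norm_num) (by norm_num)
      (by norm_num) i l), ← hE.src l (by omega)]
    constructor
    · rintro ⟨j, -, hj⟩
      rw [h16] at hj
      obtain ⟨⟨h3, h4⟩, h5⟩ := hj
      rwa [show N * N + N * N * N + (Nat.clog 2 N - l) = j by omega]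
    · intro h
      refine ⟨⟨_, (hlen l (by omega)).1⟩, hmatch _ _, (h16 _ _).2 ⟨⟨?_, ?_⟩, h⟩⟩ <;>
        simp only <;> omega
  have ht : ∀ i, ∀ l < W, specGather.afterAttention W γ₁ i l 20 ↔ HasBit t l := fun i l hl => by
    rw [LayerSpec.afterAttention_of_val rfl, or_iff_right (hstay 20 (by norm_num) (by norm_num)
      (by norm_num) i l), ← hE.tgt l (by omega)]
    constructor
    · rintro ⟨j, -, hj⟩
      rw [h17] at hj
      obtain ⟨⟨h3, h4⟩, h5⟩ := hj
      rwa [show N * N + N * N * N + (2 * Nat.clog 2 N + 1 - l) = j by omega]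
    · intro h
      refine ⟨⟨_, (hlen l (by omega)).2⟩, hmatch _ _, (h17 _ _).2 ⟨⟨?_, ?_⟩, h⟩⟩ <;>
        simp only <;> omega
  have hkeep : ∀ c, 12 < c → c < 16 ∨ c = 22 → ∀ i l, ¬ specGather.after W γ₁ i l c :=
    fun c h3 h4 i l => by
      rw [LayerSpec.after_of_none
        (by unfold specGather; dsimp only; rw [if_neg, if_neg] <;> omega)
        (by unfold specGather; dsimp only; rw [if_neg, if_neg] <;> omega)]
      exact hstay c h3 (by omega) (by omega) i l
  refine ⟨h2, fun i l hl => ⟨?_, ?_⟩, fun i l hl => ⟨?_, ?_⟩,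
    fun i l _ => hkeep 22 (by norm_num) (by norm_num) i l, ?_,
    fun i _ _ _ _ l _ h => absurd h (hkeep 13 (by norm_num) (by norm_num) i l),
    fun i _ _ _ _ l _ h => absurd h (hkeep 14 (by norm_num) (by norm_num) i l),
    fun i _ _ _ _ l _ h => absurd h (hkeep 15 (by norm_num) (by norm_num) i l)⟩
  · exact (or_iff_left id).trans (hs i l hl)
  · rw [LayerSpec.after, LayerSpec.afterAttention_of_none rfl,
      or_iff_right (hstay _ (by norm_num) (by norm_num) (by norm_num) i l), ← hs i l hl]
    rfl
  · exact (or_iff_left id).trans (ht i l hl)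
  · rw [LayerSpec.after, LayerSpec.afterAttention_of_none rfl,
      or_iff_right (hstay _ (by norm_num) (by norm_num) (by norm_num) i l), ← ht i l hl]
    rfl
  · intro i a b c hi l hl
    obtain ⟨f1, f2, -⟩ := h0.field_pad W hi
    rw [LayerSpec.after_of_none rfl rfl, hγ₁, LayerSpec.after_of_val rfl rfl, reachIn_one]
    refine or_congr ?_ ?_
    -- The empty paths come from the positional encoding, which activates channel `12` where `i =
    -- j`.
    · simp only [inputActive, posActive, hi, vertI_padPos, vertJ_padPos, Fin.ext_iff]
      simp [isPad_padPos]
    · constructor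
      · rintro ⟨j, hj, hj'⟩
        rw [match_adj h0 hW0 hNW rfl f1 f2] at hj
        rw [← hE.adj, ← hj]
        rcases hj' with h | h
        · exact h.elim
        · exact h.2
      · intro h
        exact ⟨⟨adjPos a b, adjPos_lt_length hn a b⟩, (match_adj h0 hW0 hNW rfl f1 f2 _).2 rfl,
          Or.inr ⟨rfl, (hE.adj a b).2 h⟩⟩

theorem Field.congr {γ' : Fin n → ℕ → ℕ → Prop} {i : Fin n} {c v : ℕ}
    (h : ∀ l, ∀ c' ∈ [c, c + 1], γ' i l c' ↔ γ i l c') (hf : Field W γ i c v) :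
    Field W γ' i c v := fun l hl => by
  rw [h l c (by simp), h l (c + 1) (by simp)]
  exact hf l hl

/-- The residual stream never clears a channel, so channels `13`, `14` and `15` still hold the
results of earlier rounds. These are harmless because `ReachIn` is monotone in the number of edges;
hence `Found` demands only an implication for them, and an equivalence for channel `12`. A lookup of
`(i, k)` attends to all triples `(i, k, *)`, which agree on channel `12`; in the last layer
attending to all `(i, j, *)` is the quantification over `k`. -/
theorem Found.computes_block {d : ℕ} (h : Found N W one E s t d γ) (hn : n = connLen N)
    (hW0 : 0 < W) (hNW : N ≤ 2 ^ W) : ∃ γ' : Fin n → ℕ → ℕ → Prop,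
      Computes W [specLeft, specRight, specJoin] γ γ' ∧ Found N W one E s t (d + d) γ' := by
  have hN0 : 0 < N := (Nat.zero_le _).trans_lt s.isLt
  have h0 := h.static
  set γ₁ := specLeft.after W γ with hγ₁
  set γ₂ := specRight.after W γ₁ with hγ₂
  set γ₃ := specJoin.after W γ₂ with hγ₃
  have k₁ : ∀ c ≠ 13, ∀ i l, γ₁ i l c ↔ γ i l c := fun c hc i l =>
    LayerSpec.after_of_none (if_neg hc) rfl i l
  have k₂ : ∀ c, c ≠ 14 → c ≠ 15 → ∀ i l, γ₂ i l c ↔ γ₁ i l c := fun c hc hc' i l =>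
    LayerSpec.after_of_none (if_neg hc) (if_neg hc') i l
  have k₃ : ∀ c ≠ 12, ∀ i l, γ₃ i l c ↔ γ₂ i l c := fun c hc i l =>
    LayerSpec.after_of_none (if_neg hc) rfl i l
  have h1 : Static N one γ₁ := fun i l c hc => by rw [k₁ c (by omega), h0 i l c hc]
  have h2 : Static N one γ₂ := fun i l c hc => by rw [k₂ c (by omega) (by omega), h1 i l c hc]
  have h3 : Static N one γ₃ := fun i l c hc => by rw [k₃ c (by omega), h2 i l c hc]
  refine ⟨γ₃, .cons specLeft_wf (fun i => exists_match_pad h0 hn hW0 rfl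
    (h0.answerable hN0 hNW i (by simp) 1) (h0.answerable hN0 hNW i (by simp) 3))
    (.cons specRight_wf (fun i => exists_match_pad h1 hn hW0 rfl
    (h1.answerable hN0 hNW i (by simp) 1) (h1.answerable hN0 hNW i (by simp) 3))
    (.cons specJoin_wf (fun i => exists_match_pad h2 hn hW0 rfl
    (h2.answerable hN0 hNW i (by simp) 1) (h2.answerable hN0 hNW i (by simp) 3)) (.nil _))), ?_⟩
  have r13 : ∀ (i : Fin n) a b c, i.val = padPos a b c → ∀ l < W, γ₁ i l 13 ↔ ReachIn E d a c := by
    intro i a b c hi l hl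
    obtain ⟨f1, -, f3⟩ := h0.field_pad W hi
    rw [hγ₁, LayerSpec.after_of_val rfl rfl]
    constructor
    · rintro (h4 | ⟨j, hj, h4⟩)
      · exact h.left i a b c hi l hl h4
      · obtain ⟨c', hj⟩ := (match_pad h0 hW0 hNW rfl f1 f3 j).1 hj
        exact (h.reach j _ _ _ hj l hl).1 h4
    · exact fun h4 => Or.inr ⟨⟨padPos a c c, padPos_lt_length hn a c c⟩,
        (match_pad h0 hW0 hNW rfl f1 f3 _).2 ⟨c, rfl⟩, (h.reach _ a c c rfl l hl).2 h4⟩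
  have r14 : ∀ (i : Fin n) a b c, i.val = padPos a b c → ∀ l < W,
      specRight.afterAttention W γ₁ i l 14 ↔ ReachIn E d c b := by
    intro i a b c hi l hl
    obtain ⟨-, f2, f3⟩ := h1.field_pad W hi
    rw [LayerSpec.afterAttention_of_val rfl, k₁ 14 (by norm_num)]
    constructor
    · rintro (h4 | ⟨j, hj, h4⟩)
      · exact h.right i a b c hi l hl h4
      · obtain ⟨c', hj⟩ := (match_pad h1 hW0 hNW rfl f3 f2 j).1 hj
        rw [k₁ 12 (by norm_num)] at h4
        exact (h.reach j _ _ _ hj l hl).1 h4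
    · exact fun h4 => Or.inr ⟨⟨padPos c b c, padPos_lt_length hn c b c⟩,
        (match_pad h1 hW0 hNW rfl f3 f2 _).2 ⟨c, rfl⟩,
        (k₁ 12 (by norm_num) _ _).2 ((h.reach _ c b c rfl l hl).2 h4)⟩
  have r15 : ∀ (i : Fin n) a b c, i.val = padPos a b c → ∀ l < W,
      γ₂ i l 15 ↔ ReachIn E d a c ∧ ReachIn E d c b := by
    intro i a b c hi l hl
    rw [hγ₂, LayerSpec.after, LayerSpec.afterAttention_of_none rfl, k₁ 15 (by norm_num)]
    change _ ∨ (specRight.afterAttention W γ₁ i l 13 ∧ specRight.afterAttention W γ₁ i l 14) ↔ _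
    rw [LayerSpec.afterAttention_of_none rfl, r13 i a b c hi l hl, r14 i a b c hi l hl]
    exact or_iff_right_of_imp (h.join i a b c hi l hl)
  have hdd : d ≤ d + d := by omega
  refine ⟨h3, fun i => Field.congr (γ := γ) ?_ (h.src i), fun i => Field.congr (γ := γ) ?_ (h.tgt i),
    ?_, ?_, ?_, ?_, ?_⟩
  · intro l c hc
    have : c ≠ 12 ∧ c ≠ 13 ∧ c ≠ 14 ∧ c ≠ 15 := by simp at hc; omega
    rw [k₃ c this.1, k₂ c this.2.2.1 this.2.2.2, k₁ c this.2.1]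
  · intro l c hc
    have : c ≠ 12 ∧ c ≠ 13 ∧ c ≠ 14 ∧ c ≠ 15 := by simp at hc; omega
    rw [k₃ c this.1, k₂ c this.2.2.1 this.2.2.2, k₁ c this.2.1]
  · intro i l hl
    rw [k₃ 22 (by norm_num), k₂ 22 (by norm_num) (by norm_num), k₁ 22 (by norm_num)]
    exact h.answer i l hl
  · intro i a b c hi l hl
    obtain ⟨f1, f2, -⟩ := h2.field_pad W hi
    rw [hγ₃, LayerSpec.after_of_val rfl rfl, k₂ 12 (by norm_num) (by norm_num), k₁ 12 (by norm_num),
      h.reach i a b c hi l hl]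
    constructor
    · rintro (h4 | ⟨j, hj, h4⟩)
      · exact h4.mono hdd
      · obtain ⟨c', hj⟩ := (match_pad h2 hW0 hNW rfl f1 f2 j).1 hj
        exact reachIn_add.2 ⟨c', (r15 j a b c' hj l hl).1 h4⟩
    · intro h4
      obtain ⟨c', h4⟩ := reachIn_add.1 h4
      exact Or.inr ⟨⟨padPos a b c', padPos_lt_length hn a b c'⟩,
        (match_pad h2 hW0 hNW rfl f1 f2 _).2 ⟨c', rfl⟩, (r15 _ a b c' rfl l hl).2 h4⟩
  · intro i a b c hi l hl h4
    rw [k₃ 13 (by norm_num), k₂ 13 (by norm_num) (by norm_num), r13 i a b c hi l hl] at h4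
    exact h4.mono hdd
  · intro i a b c hi l hl h4
    have h5 : γ₂ i l 14 ↔ specRight.afterAttention W γ₁ i l 14 := or_iff_left id
    rw [k₃ 14 (by norm_num), h5, r14 i a b c hi l hl] at h4
    exact h4.mono hdd
  · intro i a b c hi l hl h4
    rw [k₃ 15 (by norm_num), r15 i a b c hi l hl] at h4
    exact ⟨h4.1.mono hdd, h4.2.mono hdd⟩

theorem Found.computes_loop {d : ℕ} (h : Found N W one E s t d γ) (hn : n = connLen N)
    (hW0 : 0 < W) (hNW : N ≤ 2 ^ W) (m : ℕ) : ∃ γ' : Fin n → ℕ → ℕ → Prop,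
      Computes W (List.replicate m [specLeft, specRight, specJoin]).flatten γ γ' ∧
        Found N W one E s t (2 ^ m * d) γ' := by
  induction m generalizing d γ with
  | zero => exact ⟨γ, .nil _, by simpa using h⟩
  | succ m ih =>
    obtain ⟨γ₁, h1, h2⟩ := h.computes_block hn hW0 hNW
    obtain ⟨γ₂, h3, h4⟩ := ih h2
    refine ⟨γ₂, ?_, ?_⟩
    · rw [List.replicate_succ, List.flatten_cons]
      exact h1.append h3
    · rwa [pow_succ, Nat.mul_assoc, Nat.two_mul]

theorem Found.computes_post {d : ℕ} (h : Found N W one E s t d γ) (hn : n = connLen N)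
    (hW0 : 0 < W) (hNW : N ≤ 2 ^ W) : ∃ γ' : Fin n → ℕ → ℕ → Prop,
      Computes W [specAnswer] γ γ' ∧ ∀ i, ∀ l < W, γ' i l 22 ↔ ReachIn E d s t := by
  have h0 := h.static
  refine ⟨_, .cons specAnswer_wf (fun i => exists_match_pad h0 hn hW0 rfl
    ((h.src i).answerable hNW 1) ((h.tgt i).answerable hNW 3)) (.nil _), fun i l hl => ?_⟩
  rw [LayerSpec.after_of_val rfl rfl, or_iff_right (h.answer i l hl)]
  constructor
  · rintro ⟨j, hj, h4⟩
    obtain ⟨c, hj⟩ := (match_pad h0 hW0 hNW rfl (h.src i) (h.tgt i) j).1 hj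
    exact (h.reach j _ _ _ hj l hl).1 h4
  · exact fun h4 => ⟨⟨padPos s t s, padPos_lt_length hn s t s⟩,
      (match_pad h0 hW0 hNW rfl (h.src i) (h.tgt i) _).2 ⟨s, rfl⟩, (h.reach _ s t s rfl l hl).2 h4⟩

/-- All layers together decide reachability. -/
theorem computes_conn (hE : Encodes N one E s t) (hn : n = connLen N) :
    ∃ γ : Fin n → ℕ → ℕ → Prop,
      Computes (Nat.clog 2 N + 1) ([specEdge, specGather] ++
        (List.replicate (Nat.clog 2 N) [specLeft, specRight, specJoin]).flatten ++ [specAnswer])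
        (fun i => inputActive N one i) γ ∧
      ∀ i, ∀ l < Nat.clog 2 N + 1, γ i l 22 ↔ Relation.ReflTransGen E s t := by
  have hN : N ≤ 2 ^ Nat.clog 2 N := Nat.le_pow_clog (by norm_num) N
  have hW0 : 0 < Nat.clog 2 N + 1 := by omega
  have hNW : N ≤ 2 ^ (Nat.clog 2 N + 1) := hN.trans (Nat.pow_le_pow_right (by norm_num) (by omega))
  obtain ⟨γ₁, h1, f1⟩ := computes_pre hE hn hN rfl
  obtain ⟨γ₂, h2, f2⟩ := f1.computes_loop hn hW0 hNW (Nat.clog 2 N)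
  obtain ⟨γ₃, h3, f3⟩ := f2.computes_post hn hW0 hNW
  refine ⟨γ₃, (h1.append h2).append h3, fun i l hl => (f3 i l hl).trans ?_⟩
  -- After `Nat.clog 2 N` doublings, starting from one edge, the length bound is at least `N`.
  exact ⟨ReachIn.reflTransGen, fun h => reachIn_card h (by simpa using hN)⟩

end Graph

/-! ### The symbols of the input -/

theorem getElem?_flatten_mul_add {α : Type} {N b : ℕ} (hb : b < N) (L : List (List α))
    (hL : ∀ l ∈ L, l.length = N) (a : ℕ) : L.flatten[a * N + b]? = L[a]?.bind (·[b]?) := by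
  induction L generalizing a with
  | nil => simp
  | cons l L ih =>
    have hl : l.length = N := hL l (by simp)
    rw [List.flatten_cons]
    cases a with
    | zero =>
      rw [List.getElem?_append_left (by omega)]
      simp
    | succ a =>
      have : (a + 1) * N + b = N + (a * N + b) := by ring
      rw [this, List.getElem?_append_right (by omega), hl, Nat.add_sub_cancel_left,
        ih (fun l' h => hL l' (by simp [h])), List.getElem?_cons_succ]

theorem getElem?_bits {w n l : ℕ} (hl : l < w) : (bits w n)[w - 1 - l]? = some (n.testBit l) := by
  have h : w - 1 - l < (bits w n).length := by
    simp only [bits, List.length_map, List.length_reverse, List.length_range]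
    omega
  rw [List.getElem?_eq_getElem h]
  simp only [bits, List.getElem_map, List.getElem_reverse, List.getElem_range, List.length_range]
  congr 2
  omega

theorem ofBool_eq_one {b : Bool} : some (Tok.ofBool b) = some Tok.one ↔ b = true := by
  cases b <;> simp [Tok.ofBool]

/-- There is one slice more than there are digits, so that a slice exists even for `N = 1`. The
digit position of this top slice is the separator, which is not the symbol `1` and is thus read
correctly as a leading zero. -/
theorem not_hasBit_clog {N : ℕ} (v : Fin N) : ¬ HasBit v (Nat.clog 2 N) := by
  rw [hasBit_iff, Nat.testBit_lt_two_pow (v.isLt.trans_le (Nat.le_pow_clog (by norm_num) N))]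
  simp

theorem encodes_connInput {N : ℕ} (A : Matrix (Fin N) (Fin N) Bool) (s t : Fin N) :
    Encodes N (fun p => (connInput A s t)[p]? = some Tok.one) (fun a b => A a b = true) s t := by
  set X := (List.finRange N).flatMap fun i => (List.finRange N).map fun j => Tok.ofBool (A i j)
    with hX
  set R := List.replicate (N ^ 3) Tok.pad with hR
  set Y := (bits (Nat.clog 2 N) s).map Tok.ofBool with hY
  set Z := (bits (Nat.clog 2 N) t).map Tok.ofBool with hZ
  have hin : connInput A s t = (X ++ R) ++ (Tok.sep :: Y ++ Tok.sep :: Z) := by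
    rw [connInput, List.append_assoc (X ++ R)]
  have hXl : X.length = N * N := by simp [hX, List.length_flatMap]
  have hXR : (X ++ R).length = N * N + N * N * N := by
    rw [List.length_append, hXl, hR, List.length_replicate]
    ring
  have hYl : Y.length = Nat.clog 2 N := by simp [hY, bits]
  have hget : ∀ k, (connInput A s t)[N * N + N * N * N + k]? =
      (Tok.sep :: Y ++ Tok.sep :: Z)[k]? := fun k => by
    rw [hin, List.getElem?_append_right (by omega), hXR, Nat.add_sub_cancel_left]
  refine ⟨fun a b => ?_, fun l hl => ?_, fun l hl => ?_⟩
  · have hlt : adjPos a b < N * N := isAdj_adjPos a b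
    rw [hin, List.getElem?_append_left (by omega), List.getElem?_append_left (by omega), hX, adjPos,
      List.flatMap_def, getElem?_flatten_mul_add b.isLt _ (by simp)]
    rw [List.getElem?_eq_getElem (by simp), Option.bind_some, List.getElem?_eq_getElem (by simp)]
    simp only [List.getElem_map, List.getElem_finRange, ofBool_eq_one]
    exact Iff.rfl
  · rw [hget]
    rcases hl.lt_or_eq with h | rfl
    -- The most significant digit comes first, and the separator in front shifts the index by one.
    · rw [show Nat.clog 2 N - l = Nat.clog 2 N - 1 - l + 1 by omega,
        List.getElem?_append_left (by simp only [List.length_cons]; omega), List.getElem?_cons_succ,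
        hY, List.getElem?_map, getElem?_bits h, Option.map_some, ofBool_eq_one, hasBit_iff]
    · rw [Nat.sub_self]
      simp [not_hasBit_clog]
  · rw [hget, List.getElem?_append_right (by simp only [List.length_cons]; omega), List.length_cons,
      hYl]
    rcases hl.lt_or_eq with h | rfl
    · rw [show 2 * Nat.clog 2 N + 1 - l - (Nat.clog 2 N + 1) = Nat.clog 2 N - 1 - l + 1 by omega,
        List.getElem?_cons_succ, hZ, List.getElem?_map, getElem?_bits h, Option.map_some,
        ofBool_eq_one, hasBit_iff]
    · rw [show 2 * Nat.clog 2 N + 1 - Nat.clog 2 N - (Nat.clog 2 N + 1) = 0 by omega]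
      simp [not_hasBit_clog]

/-- The embedding writes only to coordinate `22`, that is, to channel `11`, which the positional
encoding leaves empty; so the two are added without interference. -/
theorem rowSim_input {N W p : ℕ} {one : ℕ → Prop} {x : Fin (W * 46) → Fx 1} {e : ℕ → ℤ}
    (hx : ∀ d, x d = Fx.add (sliceVec (W * 46) e d) (ofMant (posMant N p d)))
    (he : ∀ r, (r = 22 ∧ one p → e r = 2) ∧ (¬ (r = 22 ∧ one p) → e r = 0)) : RowSim x (inputActive N one p) := by
  classical
  have hx : ∀ l (hl : l < W) c (hc : 2 * c < 46), (x (coord l hl (2 * c) hc)).mant =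
      clip ((if c = 11 ∧ one p then 2 else 0) + if posActive N p l c then 2 else 0) := by
    intro l hl c hc
    have he' : e (2 * c) = if c = 11 ∧ one p then 2 else 0 := by
      split_ifs with h
      · exact (he _).1 ⟨by omega, h.2⟩
      · exact (he _).2 fun h' => h ⟨by omega, h'.2⟩
    rw [hx, add_mant, sliceVec, posMant, coord_mod, coord_div, he', show 2 * c / 2 = c by omega,
      show 2 * c % 2 = 0 by omega, ofMant_mant (by split_ifs <;> norm_num),
      ofMant_mant (by split_ifs <;> norm_num)]
    simp only [true_and]
  refine ⟨fun l hl c hc => ?_, fun l hl c hc => ?_, fun l hl => ?_⟩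
  · rw [hx]
    split_ifs <;> decide
  · rw [hx, inputActive]
    split_ifs with h1 h2 h2
    · exact iff_of_true (by decide) (Or.inl h2)
    · exact iff_of_true (by decide) (Or.inr h1)
    · exact iff_of_true (by decide) (Or.inl h2)
    · exact iff_of_false (by decide) (not_or.2 ⟨h2, h1⟩)
  · have := hx l hl 0 (by norm_num)
    simp only [Nat.mul_zero] at this
    rw [this, if_neg (by omega), if_pos (by trivial)]
    rfl

/-! ### Correctness -/

theorem unrolled_connTransformer (N : ℕ) : (connTransformer N).unrolled =
    ([specEdge, specGather] ++
      (List.replicate (Nat.clog 2 N) [specLeft, specRight, specJoin]).flatten ++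
        [specAnswer]).map (LayerSpec.layer (width N)) := by
  simp [LoopedTransformer.unrolled, connTransformer, List.map_flatten]
  rfl

/-- Coordinate `44` is the answer channel `22`. It is read in all slices, which agree, and the
saturating sum of these non-negative values is positive iff the answer is. -/
theorem threshold_spec {W : ℕ} (hW : 0 < W) {x : Fin (W * 46) → Fx 1} {P : ℕ → ℕ → Prop}
    (hx : RowSim x P) {Q : Prop} (hP : ∀ l < W, P l 22 ↔ Q) :
    0 < (Fx.add (Fx.dot (sliceVec (W * 46) fun r => if r = 44 then 2 else 0) x) (ofMant 0)).mant ↔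
      Q := by
  set w : Fin (W * 46) → Fx 1 := sliceVec (W * 46) fun r => if r = 44 then 2 else 0 with hw
  have hterm : ∀ l (hl : l < W) r (hr : r < 46),
      (Fx.mul (w (coord l hl r hr)) (x (coord l hl r hr))).mant =
        if r = 44 then (x (coord l hl r hr)).mant else 0 := by
    intro l hl r hr
    rw [mul_mant]
    simp only [hw, sliceVec, coord_mod]
    split_ifs
    · have := (x (coord l hl r hr)).mant_le
      generalize (x (coord l hl r hr)).mant = z at this
      obtain ⟨h1, h2⟩ := this
      interval_cases z <;> rfl
    · rw [ofMant_mant (by norm_num), zero_mul, rq_zero]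
  have hnn : ∀ d : Fin (W * 46), 0 ≤ (Fx.mul (w d) (x d)).mant := by
    intro d
    obtain ⟨l, hl, r, hr, rfl⟩ := exists_coord d
    rw [hterm]
    split_ifs with h
    · subst h
      exact hx.nonneg l hl 22 hr
    · exact le_rfl
  have hout : (Fx.add (Fx.dot w x) (ofMant 0)).mant =
      min 3 (∑ d, (Fx.mul (w d) (x d)).mant) := by
    have h0 := Finset.sum_nonneg fun d (_ : d ∈ Finset.univ) => hnn d
    rw [add_mant, Fx.dot, sum_mant_nonneg _ hnn, show (ofMant 0).mant = 0 from rfl,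
      add_zero, clip_of]
    omega
  rw [hout]
  constructor
  · intro h
    by_contra hQ
    have : ∑ d, (Fx.mul (w d) (x d)).mant ≤ 0 := by
      refine Finset.sum_nonpos fun d _ => ?_
      obtain ⟨l, hl, r, hr, rfl⟩ := exists_coord d
      rw [hterm]
      split_ifs with h'
      · subst h'
        have := (hx.pos_iff l hl 22 hr).not.2 ((hP l hl).not.2 hQ)
        exact not_lt.1 this
      · exact le_rfl
    omega
  · intro hQ
    have h1 := (hx.pos_iff 0 hW 22 (by norm_num)).2 ((hP 0 hW).2 hQ)
    have h2 := Finset.single_le_sum (fun d _ => hnn d)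
      (Finset.mem_univ (coord 0 hW 44 (by norm_num)))
    rw [hterm, if_pos rfl] at h2
    have h3 := h1.trans_le h2
    omega

theorem run_connTransformer (κ : Attention) (N : ℕ) (A : Matrix (Fin N) (Fin N) Bool)
    (s t : Fin N) : ∃ answer : Bool, (connTransformer N).run κ (connInput A s t) = some answer ∧
      (answer = true ↔ HasPath A s t) := by
  have hlen := length_connInput A s t
  have hpos : 0 < (connInput A s t).length := by
    rw [hlen, connLen_eq]
    omega
  obtain ⟨γ, h1, h2⟩ := computes_conn (encodes_connInput A s t) hlen
  obtain ⟨H, h3, h4⟩ := h1.evalLayers κ fun i =>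
    rowSim_input (N := N) (p := i) (x := fun d => Fx.add
      ((connTransformer N).embed ((connInput A s t).get i) d) ((connTransformer N).pe i d))
      (fun d => rfl) fun r => by
        rw [List.getElem?_eq_getElem i.isLt, Option.some_inj, List.get_eq_getElem]
        cases (connInput A s t)[i.val] <;> simp +contextual
  have h5 : (connTransformer N).represent κ (connInput A s t) = some H := by
    rw [LoopedTransformer.represent, unrolled_connTransformer]
    exact h3
  refine ⟨_, (dif_pos hpos).trans (congrArg _ h5), ?_⟩
  exact decide_eq_true_iff.trans (threshold_spec (Nat.succ_pos _) (h4 _) (h2 _))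

/-! ### Size -/

/-- With `L` the ceiling logarithm, take logarithms in `2 ^ (L - 1) < N ≤ 2 ^ L`. The factor `2` in
the first constant absorbs the rounding, since `log 2 ≤ log N` for `N ≥ 2`. -/
theorem isTheta_clog : (fun N : ℕ => (Nat.clog 2 N : ℝ)) =Θ[atTop] fun N : ℕ => Real.log N := by
  have hlog2 : 0 < Real.log 2 := Real.log_pos (by norm_num)
  constructor
  · refine IsBigO.of_bound (2 / Real.log 2) ?_
    filter_upwards [eventually_ge_atTop 2] with N hN
    have hN' : (2 : ℝ) ≤ N := by exact_mod_cast hN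
    have hlogN : Real.log 2 ≤ Real.log N := Real.log_le_log (by norm_num) hN'
    rw [Real.norm_of_nonneg (Nat.cast_nonneg _), Real.norm_of_nonneg (hlog2.le.trans hlogN)]
    have h1 : 2 ^ (Nat.clog 2 N - 1) < N := Nat.pow_pred_clog_lt_self (by norm_num) (by omega)
    have h2 : (2 : ℝ) ^ (Nat.clog 2 N - 1) ≤ N := by exact_mod_cast h1.le
    have h3 := Real.log_le_log (by positivity) h2
    rw [Real.log_pow] at h3
    have h4 : (Nat.clog 2 N : ℝ) ≤ ((Nat.clog 2 N - 1 : ℕ) : ℝ) + 1 := by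
      exact_mod_cast (by omega : Nat.clog 2 N ≤ Nat.clog 2 N - 1 + 1)
    rw [div_mul_eq_mul_div, le_div_iff₀ hlog2]
    nlinarith
  · refine IsBigO.of_bound (Real.log 2) ?_
    filter_upwards [eventually_ge_atTop 1] with N hN
    have hN' : (1 : ℝ) ≤ N := by exact_mod_cast hN
    rw [Real.norm_of_nonneg (Nat.cast_nonneg _), Real.norm_of_nonneg (Real.log_nonneg hN')]
    have h1 : (N : ℝ) ≤ 2 ^ Nat.clog 2 N := by exact_mod_cast Nat.le_pow_clog (by norm_num) N
    have h2 := Real.log_le_log (by linarith) h1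
    rw [Real.log_pow] at h2
    linarith

theorem isTheta_width : (fun N : ℕ => (width N : ℝ)) =Θ[atTop] fun N : ℕ => Real.log N := by
  refine IsTheta.trans ?_ isTheta_clog
  constructor
  · refine IsBigO.of_bound 92 ?_
    filter_upwards [eventually_ge_atTop 2] with N hN
    have h1 : 1 ≤ Nat.clog 2 N := Nat.clog_pos (by norm_num) hN
    rw [Real.norm_of_nonneg (Nat.cast_nonneg _), Real.norm_of_nonneg (Nat.cast_nonneg _)]
    have : width N ≤ 92 * Nat.clog 2 N := by
      unfold width
      omega
    exact_mod_cast this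
  · refine IsBigO.of_bound 1 (Eventually.of_forall fun N => ?_)
    rw [Real.norm_of_nonneg (Nat.cast_nonneg _), Real.norm_of_nonneg (Nat.cast_nonneg _), one_mul]
    have : Nat.clog 2 N ≤ width N := by
      unfold width
      omega
    exact_mod_cast this

theorem isTheta_const {c : ℝ} (hc : c ≠ 0) :
    (fun _ : ℕ => c) =Θ[atTop] fun _ => (1 : ℝ) :=
  ⟨isBigO_const_const _ one_ne_zero _, isBigO_const_const _ hc _⟩

theorem size_connTransformer : ConstPrecLogWidthLogLooped connTransformer where
  precision := isTheta_const (c := ((1 : ℕ) : ℝ)) (by norm_num)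
  width := isTheta_width
  hidden := isTheta_width.1
  depth := isTheta_const (c := ((6 : ℕ) : ℝ)) (by norm_num)
  loops := isTheta_clog

end LPT

end

theorem mainTheorem11 (κ : LPT.Attention) :
    ∃ T : ℕ → LPT.LoopedTransformer,
      LPT.LUniform T LPT.connLen ∧
      LPT.ConstPrecLogWidthLogLooped T ∧
      ∀ (N : ℕ) (A : Matrix (Fin N) (Fin N) Bool) (s t : Fin N),
        ∃ answer : Bool,
          (T N).run κ (LPT.connInput A s t) = some answer ∧
          (answer = true ↔ LPT.HasPath A s t) :=
  ⟨LPT.connTransformer, LPT.lUniform_connTransformer, LPT.size_connTransformer,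
    fun N A s t => LPT.run_connTransformer κ N A s t⟩
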